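/- Let $p>0$, $A\in SO(3)$, $a\in\mathbb{R}^3$, and let $\mathcal{M}$ be the space of smooth immersions $\gamma:\mathbb{R}\to\mathbb{R}^3$ with $\gamma(s+p)=A\gamma(s)+a$; its tangent space at $\gamma$ consists of the smooth $\xi:\mathbb{R}\to\mathbb{R}^3$ with $\xi(s+p)=A\xi(s)$. Fix $x_0\in\mathbb{R}$ and put $I=[x_0,x_0+p]$. For $\gamma\in\mathcal{M}$ let $dx=|\dot\gamma(s)|\,ds$, let $'$ denote $d/dx$, put $T=\gamma'$, and let $\sigma_\gamma(\xi,\eta)=\int_I\det(d\gamma,\xi,\eta)$ be the Marsden–Weinstein form. Define $$Y_0=T,\qquad Y_{k+1}=T\times Y_k'-\tfrac12\sum_{i=1}^{k}(Y_i,Y_{k-i+1})\,T\quad(k\ge 0).$$ Let $E_1=\int_I dx$ be the length and let $E_2\in\mathbb{R}/2\pi\mathbb{Z}$ be the total torsion: if $\xi$ is a unit normal field parallel in the normal bundle of $\gamma$, then $A\xi(x_0)=\cos E_2\,\xi(x_0+p)+\sin E_2\,T(x_0+p)\times\xi(x_0+p)$. Define functionals $E_k$, $k\ge0$, by the generating function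 (an identity of formal power series in $\lambda^{-1}$) $$\sum_{k\ge0}E_k\lambda^{-k}=0+E_1\lambda^{-1}+E_2\lambda^{-2}+\tfrac12\lambda^{-2}\int_I\ \sum_{i\ge1,\,j\ge0}(Y_i,Y_1)\lambda^{-i}(-1)^j\Big(\sum_{l\ge2}\tfrac12(T,Y_l)\lambda^{-l}\Big)^j dx .$$ Then the following hold. 1. The $Y_k$ are vector fields on $\mathcal{M}$ (that is, $Y_k(\gamma)\in T_\gamma\mathcal{M}$), they satisfy $Y_k'+T\times Y_{k+1}=0$, and they commute: for all $k,l$ the derivative of $Y_l$ at $\gamma$ in direction $Y_k(\gamma)$ equals the derivative of $Y_k$ at $\gamma$ in direction $Y_l(\gamma)$. 2. For every $k\ge0$, $E_k$ is a Hamiltonian for $Y_k$: for every $\gamma\in\mathcal M$ and every smooth variation $\gamma_t\in\mathcal{M}$ of $\gamma=\gamma_0$ one has $\frac{d}{dt}\big|_{t=0}E_k(\gamma_t)=\sigma_\gamma(Y_k,\dot\gamma)$, where for $k=2$ a suitable real-valued lift of $t\mapsto E_2(\gamma_t)$ near $t=0$ is differentiated. 3. The $E_k$ are the coefficients of the expansion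 of $\lambda^{-2}\theta_\lambda$ at $\lambda=\infty$, where $\theta_\lambda$ is the monodromy angle of the associated family of $\gamma$. Precisely, for $\lambda\in\mathbb{R}$ let $F_\lambda:\mathbb{R}\to SO(3)$ solve $F_\lambda'v=\lambda F_\lambda(T\times v)$ for all $v\in\mathbb{R}^3$, $F_\lambda(x_0)=\mathrm{Id}$. For every real representative of $E_2$ there is a function $\theta:\mathbb{R}\to\mathbb{R}$ such that, for all $\lambda$, $\tilde A_\lambda=F_\lambda(x_0+p)A$ is the right-handed rotation by the angle $\theta_\lambda$ about some oriented axis, and, for every $N\geq 0$, $$\lambda^{-2}\theta_\lambda=\sum_{k=0}^{N}E_k\lambda^{-k}+O(|\lambda|^{-N-1})\qquad(\lambda\in\mathbb{R},\ |\lambda|\to\infty).$$ 4. In particular $$E_4=-\tfrac12\int_I\det(\gamma',\gamma'',\gamma''')\,dx,\qquad E_5=\int_I\big(\tfrac12|\gamma'''|^2-\tfrac58|\gamma''|^4\big)dx,$$ $$E_6=\int_I\big(-\tfrac12\det(\gamma',\gamma''',\gamma'''')+\tfrac78|\gamma''|^2\det(\gamma',\gamma'',\gamma''')\big)dx .$$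 -/

import Mathlib

open scoped Matrix ContDiff

noncomputable section

namespace SpaceCurve

/-- Euclidean 3-space; the inner product is `⬝ᵥ`, the vector product is `⨯₃`. -/
abbrev R3 : Type := Fin 3 → ℝ

/-- The determinant of three vectors. -/
def det3 (u v w : R3) : ℝ := Matrix.det (Matrix.of ![u, v, w])

/-- The space `𝓜` of smooth immersed curves `γ : ℝ → ℝ³` with monodromy `q ↦ A q + a` with respect
to the translation `s ↦ s + p` of the parameter line. -/
def curveSpace (p : ℝ) (A : Matrix (Fin 3) (Fin 3) ℝ) (a : R3) : Set (ℝ → R3) :=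
  {γ | ContDiff ℝ ∞ γ ∧ (∀ s, deriv γ s ≠ 0) ∧ ∀ s, γ (s + p) = A *ᵥ γ s + a}

/-- The tangent space `T_γ 𝓜`: smooth vector fields along the curve compatible with the
monodromy. -/
def tangentSpace (p : ℝ) (A : Matrix (Fin 3) (Fin 3) ℝ) : Set (ℝ → R3) :=
  {ξ | ContDiff ℝ ∞ ξ ∧ ∀ s, ξ (s + p) = A *ᵥ ξ s}

/-- The Euclidean length of the velocity, so that `dx = speed γ s ds`. -/
def speed (γ : ℝ → R3) (s : ℝ) : ℝ := Real.sqrt (deriv γ s ⬝ᵥ deriv γ s)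

/-- The derivative `f' = df/dx` with respect to the arclength `x` of `γ`. -/
def arcDeriv (γ : ℝ → R3) (f : ℝ → R3) (s : ℝ) : R3 := (speed γ s)⁻¹ • deriv f s

/-- The `n`-th arclength derivative of `γ` itself. -/
def arcD (γ : ℝ → R3) (n : ℕ) : ℝ → R3 := (arcDeriv γ)^[n] γ

/-- The unit tangent `T = γ'`. -/
def tangent (γ : ℝ → R3) : ℝ → R3 := arcDeriv γ γ

/-- `∫_I f dx` over the fundamental domain `I = [x₀, x₀ + p]`. -/
def arcIntegral (x₀ p : ℝ) (γ : ℝ → R3) (f : ℝ → ℝ) : ℝ :=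
  ∫ s in x₀..(x₀ + p), f s * speed γ s

/-- The Marsden–Weinstein form `σ_γ(ξ, η) = ∫_I det(dγ, ξ, η)`. -/
def sigma (x₀ p : ℝ) (γ ξ η : ℝ → R3) : ℝ :=
  ∫ s in x₀..(x₀ + p), det3 (deriv γ s) (ξ s) (η s)

/-- The hierarchy `Y₀ = T`,
`Y_{k+1} = T × Y_k' - ½ (∑_{i=1}^{k} (Y_i, Y_{k-i+1})) T`; in the sum below `i = j + 1`. -/
def flowY (γ : ℝ → R3) : ℕ → ℝ → R3
  | 0 => tangent γ
  | k + 1 => fun s =>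
      tangent γ s ⨯₃ arcDeriv γ (flowY γ k) s
        - ((1 / 2 : ℝ) * ∑ j : Fin k, flowY γ (j + 1) s ⬝ᵥ flowY γ (k - j) s) • tangent γ s
  termination_by k => k
  decreasing_by all_goals omega

/-- A smooth variation `Γ t`, `|t| < ε`, of `γ` through curves of the same monodromy. -/
structure IsVariation (p : ℝ) (A : Matrix (Fin 3) (Fin 3) ℝ) (a : R3) (γ : ℝ → R3)
    (ε : ℝ) (Γ : ℝ → ℝ → R3) : Prop where
  eps_pos : 0 < ε
  smooth : ContDiffOn ℝ ∞ (fun q : ℝ × ℝ => Γ q.1 q.2) (Set.Ioo (-ε) ε ×ˢ Set.univ)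
  mem : ∀ t ∈ Set.Ioo (-ε) ε, Γ t ∈ curveSpace p A a
  start : Γ 0 = γ

/-- The variational vector field `γ̇ = ∂Γ/∂t` at `t = 0`. -/
def velocity (Γ : ℝ → ℝ → R3) (s : ℝ) : R3 := deriv (fun t => Γ t s) 0

/-- `ξ` is a unit length section of the normal bundle of `γ`, parallel for the normal connection
(the normal part of its derivative vanishes). -/
structure IsParallelUnitNormal (γ ξ : ℝ → R3) : Prop where
  smooth : ContDiff ℝ ∞ ξ
  normal : ∀ s, ξ s ⬝ᵥ tangent γ s = 0
  unit : ∀ s, ξ s ⬝ᵥ ξ s = 1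
  parallel : ∀ s, arcDeriv γ ξ s - (arcDeriv γ ξ s ⬝ᵥ tangent γ s) • tangent γ s = 0

/-- `α` is a value of the total torsion (a number modulo `2π`): the angle, measured with respect to
the complex structure `T ×` of the normal plane at the end point `x₀ + p`, from the parallel
transport of a normal vector over `[x₀, x₀ + p]` to its image under the monodromy. -/
def IsTotalTorsion (x₀ p : ℝ) (A : Matrix (Fin 3) (Fin 3) ℝ) (γ : ℝ → R3) (α : ℝ) : Prop :=
  ∃ ξ : ℝ → R3, IsParallelUnitNormal γ ξ ∧
    A *ᵥ ξ x₀ = Real.cos α • ξ (x₀ + p)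
      + Real.sin α • (tangent γ (x₀ + p) ⨯₃ ξ (x₀ + p))

/-- `∑_{j ≥ 0} (-1)^j g^j` for a power series `g` with zero constant term (the powers with
`j > n` do not contribute to the `n`-th coefficient). -/
def geomSeries (g : PowerSeries ℝ) : PowerSeries ℝ :=
  PowerSeries.mk fun n => ∑ j ∈ Finset.range (n + 1), (-1 : ℝ) ^ j * PowerSeries.coeff n (g ^ j)

/-- The integrand `∑_{i ≥ 1, j ≥ 0} (Y_i, Y₁) λ^{-i} (-1)^j (∑_{l ≥ 2} ½ (T, Y_l) λ^{-l})^j` at the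
parameter `s`, as a formal power series in `λ⁻¹`. -/
def densitySeries (γ : ℝ → R3) (s : ℝ) : PowerSeries ℝ :=
  (PowerSeries.mk fun i => if 1 ≤ i then flowY γ i s ⬝ᵥ flowY γ 1 s else 0) *
    geomSeries
      (PowerSeries.mk fun l => if 2 ≤ l then (1 / 2 : ℝ) * (tangent γ s ⬝ᵥ flowY γ l s) else 0)

/-- The generating function
`0 + E₁ λ⁻¹ + E₂ λ⁻² + ½ λ⁻² ∫_I (densitySeries) dx` as a formal power series in `λ⁻¹`, where
`E₁` is the length and `e₂` stands for a value of the total torsion. -/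
def hamiltonianSeries (x₀ p : ℝ) (γ : ℝ → R3) (e₂ : ℝ) : PowerSeries ℝ :=
  PowerSeries.C (arcIntegral x₀ p γ fun _ => 1) * PowerSeries.X
    + PowerSeries.C e₂ * PowerSeries.X ^ 2
    + PowerSeries.X ^ 2 * PowerSeries.mk fun n =>
        (1 / 2 : ℝ) * arcIntegral x₀ p γ fun s => PowerSeries.coeff n (densitySeries γ s)

/-- The Hamiltonian `E_k`, the coefficient of `λ^{-k}`. -/
def hamiltonian (x₀ p : ℝ) (γ : ℝ → R3) (e₂ : ℝ) (k : ℕ) : ℝ :=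
  PowerSeries.coeff k (hamiltonianSeries x₀ p γ e₂)

/-- The extended frame: for each real `l` the solution `F l : ℝ → SO(3)` of `F' = l F T`,
`F(x₀) = 1`, where `' = d/dx` and `T` acts as the skew matrix `v ↦ T × v`. -/
structure IsExtendedFrame (x₀ : ℝ) (γ : ℝ → R3) (F : ℝ → ℝ → Matrix (Fin 3) (Fin 3) ℝ) :
    Prop where
  initial : ∀ l, F l x₀ = 1
  ode : ∀ l s v,
    HasDerivAt (fun u => F l u *ᵥ v) ((l * speed γ s) • (F l s *ᵥ (tangent γ s ⨯₃ v))) s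

/-- `R` is the right-handed rotation by the angle `θ` about some oriented axis. -/
def IsRotationAngle (R : Matrix (Fin 3) (Fin 3) ℝ) (θ : ℝ) : Prop :=
  ∃ y : R3, y ⬝ᵥ y = 1 ∧ ∀ v : R3,
    R *ᵥ v = Real.cos θ • v + Real.sin θ • (y ⨯₃ v) + ((1 - Real.cos θ) * (y ⬝ᵥ v)) • y

end SpaceCurve

end

/-!
All four parts come from the formal vector field `Y = ∑ Y_k X^k`, with `X = λ⁻¹`: it is the
unit-length solution of `X Y' = -T × Y` with constant term `T`.

*Recursion and commutation.* The scalar part of the definition of `Y_{k+1}` makes `(Y, Y) = 1`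
(`sum_flowY_dot_flowY`). By differentiation `Y_k'` is orthogonal to `T`, inductively together with
the relation `Y_k' + T × Y_{k+1} = 0`. A variation in the direction `Y_k` preserves arclength, and
differentiating the relation and the unit length condition determines the derivative of each `Y_l`
recursively. The brackets `∑_{d+m=l} Y_{k+1+d} × Y_m` satisfy the same recursion
(`flowBracket_lax`), so they are the derivatives (`ImmersedFamily.dT_flowY`); they are symmetric in
`k` and `l` (`flowBracket_comm`).

*Hamiltonians.* The one-form `-(T × Y, dT + dY) / (1 + (T, Y))` has as its exterior derivative the
difference of the pull-backs of the area form of the sphere under `Y` and `T`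
(`area_form_identity`). Evaluated along the curve it is, up to the length, the energy density
(`ImmersedFamily.X_mul_density`). As `Y` solves the equation above, the area form of `Y` is
elementary, while that of `T` enters only in degree zero. So, in positive degree `n`, the variation
of the density is the pairing of `Y_{n+1}` with the derivative of the variation, up to an exact term
(`ImmersedFamily.dT_coeff_density`). Integration by parts turns the pairing into the symplectic form
(`sigma_flowY_succ`). The total torsion is treated with the same one-form for two honest unit vector
fields: the minimal rotations from `T` to `u` carry normal fields of `T` to normal fields of `u`,
and the monodromy angles differ by the spherical area between the two fields
(`exists_rotatingNormal`).

*Asymptotics.* For large `λ` the normalized partial sum `u` of `Y` is almost fixed by the extended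
frame. A normal field of `u` turning with the opposite of the frame rotation is then almost
constant in the frame, so the trace of `F_λ(x₀ + p) A` is close to `1 + 2 cos Θ`, where `Θ` is its
monodromy angle (`IsExtendedFrame.abs_trace_sub_le`). By comparison with `T`, the angle `Θ` is the
total torsion plus the integral of a rate which agrees with the truncated density
(`IsHierarchyBound.abs_areaRate_sub_le`), that is, the partial sum of the generating function
(`exists_approximate_angle`). Passing from the cosine to the angle costs half of the order, which is
recovered by starting with twice as many terms (`exists_angle_expansion`). A rotation angle is free
up to sign and multiples of `2π`, the sign being absorbed by the orientation of the axis, so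
choosing at each `λ` an angle good to the largest available order gives one function with the
expansion to all orders (`exists_expansion_all_orders`).

*Explicit formulas.* Modulo derivatives `(Y₁, Y_{k+1})` is `-(T'', Y_k)`
(`arcIntegral_flowY_one_dot`), and the density satisfies a linear recursion; the formulas follow
from `Y₁`, `Y₂` and `Y₃`.
-/

noncomputable section

namespace SpaceCurve

/-! ### Vector algebra over a commutative ring and the area form identity -/

section Algebra
variable {R : Type*} [CommRing R]

theorem dot_eq (v w : Fin 3 → R) : v ⬝ᵥ w = v 0 * w 0 + v 1 * w 1 + v 2 * w 2 :=
  Matrix.vec3_dotProduct v w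

theorem cross_zero (v w : Fin 3 → R) : (v ⨯₃ w) 0 = v 1 * w 2 - v 2 * w 1 := rfl
theorem cross_one (v w : Fin 3 → R) : (v ⨯₃ w) 1 = v 2 * w 0 - v 0 * w 2 := rfl
theorem cross_two (v w : Fin 3 → R) : (v ⨯₃ w) 2 = v 0 * w 1 - v 1 * w 0 := rfl

theorem cross_dot_eq (u v w : Fin 3 → R) : (u ⨯₃ v) ⬝ᵥ w = u ⬝ᵥ (v ⨯₃ w) := by
  simp only [dot_eq, cross_zero, cross_one, cross_two]; ring

/-- For `m, n` orthogonal to the unit vector `u` one has `m × n = det(u, m, n) u`; paired with `T`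
this reads as follows. -/
theorem dot_cross_of_perp (T u m n : Fin 3 → R) (hu : u ⬝ᵥ u = 1) (hm : u ⬝ᵥ m = 0)
    (hn : u ⬝ᵥ n = 0) : T ⬝ᵥ (m ⨯₃ n) = (T ⬝ᵥ u) * (u ⬝ᵥ (m ⨯₃ n)) := by
  have h : u ⨯₃ (m ⨯₃ n) = 0 := by
    rw [cross_cross_eq_smul_sub_smul', dotProduct_comm m u, hn, hm]; simp
  have h2 : T ⬝ᵥ (u ⨯₃ (u ⨯₃ (m ⨯₃ n))) = 0 := by rw [h]; simp
  rw [cross_cross_eq_smul_sub_smul', dotProduct_sub, dotProduct_smul, dotProduct_smul, hu] at h2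
  simp only [smul_eq_mul] at h2
  linear_combination -h2

/-- The curvature identity behind the area formula on the sphere, for unit vectors `T`, `u` with
derivatives `a, b` resp. `m, n` in two directions: the exterior derivative of the one-form
`-(T × u, dT + du) / (1 + (T, u))` is the difference of the area forms of `u` and `T`.  Terms
containing second derivatives cancel and are left out. -/
theorem area_form_identity (T u a b m n : Fin 3 → R) (q : R) (hq : q * (1 + T ⬝ᵥ u) = 1)
    (hT : T ⬝ᵥ T = 1) (hu : u ⬝ᵥ u = 1) (ha : T ⬝ᵥ a = 0) (hb : T ⬝ᵥ b = 0)
    (hm : u ⬝ᵥ m = 0) (hn : u ⬝ᵥ n = 0) :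
    (q ^ 2 * (b ⬝ᵥ u + T ⬝ᵥ n) * ((T ⨯₃ u) ⬝ᵥ (a + m))
        - q * ((b ⨯₃ u + T ⨯₃ n) ⬝ᵥ (a + m)))
      - (q ^ 2 * (a ⬝ᵥ u + T ⬝ᵥ m) * ((T ⨯₃ u) ⬝ᵥ (b + n))
        - q * ((a ⨯₃ u + T ⨯₃ m) ⬝ᵥ (b + n)))
      = u ⬝ᵥ (m ⨯₃ n) - T ⬝ᵥ (a ⨯₃ b) := by
  have h1 := dot_cross_of_perp T u m n hu hm hn
  have h2 := dot_cross_of_perp u T a b hT ha hb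
  have hP : (T ⨯₃ u) ⨯₃ (T + u) = (1 + T ⬝ᵥ u) • (u - T) := by
    rw [cross_cross_eq_smul_sub_smul, dotProduct_add, dotProduct_add, hT, hu,
      dotProduct_comm u T, add_comm (T ⬝ᵥ u) 1, smul_sub]
  have key : (b ⬝ᵥ u + T ⬝ᵥ n) * ((T ⨯₃ u) ⬝ᵥ (a + m))
      - (a ⬝ᵥ u + T ⬝ᵥ m) * ((T ⨯₃ u) ⬝ᵥ (b + n))
      = (1 + T ⬝ᵥ u) * ((u - T) ⬝ᵥ ((a + m) ⨯₃ (b + n))) := by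
    have e1 : b ⬝ᵥ u + T ⬝ᵥ n = (T + u) ⬝ᵥ (b + n) := by
      simp only [add_dotProduct, dotProduct_add, hb, hn, dotProduct_comm b u]; ring
    have e2 : a ⬝ᵥ u + T ⬝ᵥ m = (T + u) ⬝ᵥ (a + m) := by
      simp only [add_dotProduct, dotProduct_add, ha, hm, dotProduct_comm a u]; ring
    have e3 : (1 + T ⬝ᵥ u) * ((u - T) ⬝ᵥ ((a + m) ⨯₃ (b + n)))
        = (((T ⨯₃ u) ⨯₃ (T + u)) ⬝ᵥ ((a + m) ⨯₃ (b + n))) := by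
      rw [hP, smul_dotProduct, smul_eq_mul]
    rw [e1, e2, e3, cross_dot_cross]
    ring
  have hc : u ⬝ᵥ T = T ⬝ᵥ u := dotProduct_comm u T
  rw [hc] at h2
  have ex : (u - T) ⬝ᵥ ((a + m) ⨯₃ (b + n)) - ((b ⨯₃ u + T ⨯₃ n) ⬝ᵥ (a + m))
      + ((a ⨯₃ u + T ⨯₃ m) ⬝ᵥ (b + n))
      = T ⬝ᵥ (m ⨯₃ n) + u ⬝ᵥ (m ⨯₃ n) - u ⬝ᵥ (a ⨯₃ b) - T ⬝ᵥ (a ⨯₃ b) := by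
    simp only [dot_eq, cross_zero, cross_one, cross_two, Pi.add_apply, Pi.sub_apply]; ring
  linear_combination q ^ 2 * key + q * ex + q * h1 - q * h2
    + (q * ((u - T) ⬝ᵥ ((a + m) ⨯₃ (b + n))) + u ⬝ᵥ (m ⨯₃ n) - T ⬝ᵥ (a ⨯₃ b)) * hq

end Algebra

theorem det3_eq (u v w : R3) : det3 u v w = u ⬝ᵥ (v ⨯₃ w) := by
  rw [triple_product_eq_det]; rfl

/-! ### Derivatives of scalar and vector products -/

section Products

theorem HasDerivAt.dot {f g : ℝ → R3} {f' g' : R3} {x : ℝ} (hf : HasDerivAt f f' x)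
    (hg : HasDerivAt g g' x) :
    HasDerivAt (fun y => f y ⬝ᵥ g y) (f' ⬝ᵥ g x + f x ⬝ᵥ g') x := by
  simp only [dot_eq]
  have hf := hasDerivAt_pi.1 hf
  have hg := hasDerivAt_pi.1 hg
  refine ((((hf 0).mul (hg 0)).add ((hf 1).mul (hg 1))).add ((hf 2).mul (hg 2))).congr_deriv ?_
  ring

theorem HasDerivAt.cross {f g : ℝ → R3} {f' g' : R3} {x : ℝ} (hf : HasDerivAt f f' x)
    (hg : HasDerivAt g g' x) :
    HasDerivAt (fun y => f y ⨯₃ g y) (f' ⨯₃ g x + f x ⨯₃ g') x := by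
  have hf := hasDerivAt_pi.1 hf
  have hg := hasDerivAt_pi.1 hg
  refine hasDerivAt_pi.2 fun i => ?_
  fin_cases i
  · refine (((hf 1).mul (hg 2)).sub ((hf 2).mul (hg 1))).congr_deriv ?_
    simp only [Fin.zero_eta, Pi.add_apply, cross_zero]; ring
  · refine (((hf 2).mul (hg 0)).sub ((hf 0).mul (hg 2))).congr_deriv ?_
    simp only [Fin.mk_one, Pi.add_apply, cross_one]; ring
  · refine (((hf 0).mul (hg 1)).sub ((hf 1).mul (hg 0))).congr_deriv ?_
    simp only [Fin.reduceFinMk, Pi.add_apply, cross_two]; ring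

theorem HasDerivAt.mulVec (M : Matrix (Fin 3) (Fin 3) ℝ) {f : ℝ → R3} {f' : R3} {x : ℝ}
    (hf : HasDerivAt f f' x) : HasDerivAt (fun y => M *ᵥ f y) (M *ᵥ f') x :=
  (Matrix.mulVecLin M).toContinuousLinearMap.hasFDerivAt.comp_hasDerivAt x hf

variable {V : Type*} [NormedAddCommGroup V] [NormedSpace ℝ V] {n : WithTop ℕ∞} {U : Set V}

theorem ContDiffOn.dot {f g : V → R3} (hf : ContDiffOn ℝ n f U) (hg : ContDiffOn ℝ n g U) :
    ContDiffOn ℝ n (fun y => f y ⬝ᵥ g y) U := by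
  simp only [dot_eq]
  have hf := contDiffOn_pi.1 hf
  have hg := contDiffOn_pi.1 hg
  exact (((hf 0).mul (hg 0)).add ((hf 1).mul (hg 1))).add ((hf 2).mul (hg 2))

theorem ContDiffOn.cross {f g : V → R3} (hf : ContDiffOn ℝ n f U) (hg : ContDiffOn ℝ n g U) :
    ContDiffOn ℝ n (fun y => f y ⨯₃ g y) U := by
  have hf := contDiffOn_pi.1 hf
  have hg := contDiffOn_pi.1 hg
  refine contDiffOn_pi.2 fun i => ?_
  fin_cases i
  · exact ((hf 1).mul (hg 2)).sub ((hf 2).mul (hg 1))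
  · exact ((hf 2).mul (hg 0)).sub ((hf 0).mul (hg 2))
  · exact ((hf 0).mul (hg 1)).sub ((hf 1).mul (hg 0))

theorem ContDiff.dot {f g : V → R3} (hf : ContDiff ℝ n f) (hg : ContDiff ℝ n g) :
    ContDiff ℝ n (fun y => f y ⬝ᵥ g y) :=
  contDiffOn_univ.1 (ContDiffOn.dot hf.contDiffOn hg.contDiffOn)

theorem ContDiff.cross {f g : V → R3} (hf : ContDiff ℝ n f) (hg : ContDiff ℝ n g) :
    ContDiff ℝ n (fun y => f y ⨯₃ g y) :=
  contDiffOn_univ.1 (ContDiffOn.cross hf.contDiffOn hg.contDiffOn)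

end Products

/-! ### Jointly smooth functions of two parameters -/

section Partial
variable {E : Type*} [NormedAddCommGroup E] [NormedSpace ℝ E]

/-- Joint smoothness on `U` of a function of the variation parameter `t` and the curve parameter
`s`, given in curried form. -/
def JointSmoothOn (U : Set (ℝ × ℝ)) (f : ℝ → ℝ → E) : Prop :=
  ContDiffOn ℝ ∞ (fun q : ℝ × ℝ => f q.1 q.2) U

/-- The partial derivative with respect to the curve parameter `s`. -/
def dS (f : ℝ → ℝ → E) (t s : ℝ) : E := deriv (f t) s

/-- The partial derivative with respect to the variation parameter `t`. -/
def dT (f : ℝ → ℝ → E) (t s : ℝ) : E := deriv (fun r => f r s) t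

variable {U : Set (ℝ × ℝ)} {f : ℝ → ℝ → E} {t s : ℝ}

theorem JointSmoothOn.hasFDerivAt (hf : JointSmoothOn U f) (hU : IsOpen U) (h : (t, s) ∈ U) :
    HasFDerivAt (fun q : ℝ × ℝ => f q.1 q.2) (fderiv ℝ (fun q : ℝ × ℝ => f q.1 q.2) (t, s))
      (t, s) :=
  ((hf.differentiableOn (by simp)).differentiableAt (hU.mem_nhds h)).hasFDerivAt

theorem JointSmoothOn.hasDerivAt_fderiv_s (hf : JointSmoothOn U f) (hU : IsOpen U)
    (h : (t, s) ∈ U) :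
    HasDerivAt (f t) (fderiv ℝ (fun q : ℝ × ℝ => f q.1 q.2) (t, s) (0, 1)) s :=
  (hf.hasFDerivAt hU h).comp_hasDerivAt (f := fun r : ℝ => (t, r)) s
    ((hasDerivAt_const s t).prodMk (hasDerivAt_id s))

theorem JointSmoothOn.hasDerivAt_fderiv_t (hf : JointSmoothOn U f) (hU : IsOpen U)
    (h : (t, s) ∈ U) :
    HasDerivAt (fun r => f r s) (fderiv ℝ (fun q : ℝ × ℝ => f q.1 q.2) (t, s) (1, 0)) t :=
  (hf.hasFDerivAt hU h).comp_hasDerivAt (f := fun r : ℝ => (r, s)) t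
    ((hasDerivAt_id t).prodMk (hasDerivAt_const t s))

theorem JointSmoothOn.hasDerivAt_s (hf : JointSmoothOn U f) (hU : IsOpen U) (h : (t, s) ∈ U) :
    HasDerivAt (f t) (dS f t s) s :=
  (hf.hasDerivAt_fderiv_s hU h).differentiableAt.hasDerivAt

theorem JointSmoothOn.hasDerivAt_t (hf : JointSmoothOn U f) (hU : IsOpen U) (h : (t, s) ∈ U) :
    HasDerivAt (fun r => f r s) (dT f t s) t :=
  (hf.hasDerivAt_fderiv_t hU h).differentiableAt.hasDerivAt

theorem JointSmoothOn.fderiv_apply (hf : JointSmoothOn U f) (hU : IsOpen U) (v : ℝ × ℝ) :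
    ContDiffOn ℝ ∞ (fun q => fderiv ℝ (fun q : ℝ × ℝ => f q.1 q.2) q v) U :=
  ((contDiffOn_infty_iff_fderiv_of_isOpen hU).1 hf).2.clm_apply contDiffOn_const

theorem JointSmoothOn.dS (hf : JointSmoothOn U f) (hU : IsOpen U) : JointSmoothOn U (dS f) :=
  (hf.fderiv_apply hU (0, 1)).congr fun _ hq => (hf.hasDerivAt_fderiv_s hU hq).deriv

theorem JointSmoothOn.dT (hf : JointSmoothOn U f) (hU : IsOpen U) : JointSmoothOn U (dT f) :=
  (hf.fderiv_apply hU (1, 0)).congr fun _ hq => (hf.hasDerivAt_fderiv_t hU hq).deriv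

theorem JointSmoothOn.hasDerivAt_dS_t (hf : JointSmoothOn U f) (hU : IsOpen U)
    (h : (t, s) ∈ U) :
    HasDerivAt (fun r => SpaceCurve.dS f r s) (SpaceCurve.dT (SpaceCurve.dS f) t s) t :=
  (hf.dS hU).hasDerivAt_t hU h

/-- Partial derivatives commute. -/
theorem JointSmoothOn.dT_dS (hf : JointSmoothOn U f) (hU : IsOpen U) (h : (t, s) ∈ U) :
    SpaceCurve.dT (SpaceCurve.dS f) t s = SpaceCurve.dS (SpaceCurve.dT f) t s := by
  have hn : U ∈ nhds (t, s) := hU.mem_nhds h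
  set F : ℝ × ℝ → E := fun q => f q.1 q.2
  have hc : ContDiffAt ℝ ∞ F (t, s) := ContDiffOn.contDiffAt hf hn
  have hsym := hc.isSymmSndFDerivAt (by simpa using WithTop.coe_le_coe.2 (le_top : (2 : ℕ∞) ≤ ⊤))
  have hd : HasFDerivAt (fderiv ℝ F) (fderiv ℝ (fderiv ℝ F) (t, s)) (t, s) :=
    ((((contDiffOn_infty_iff_fderiv_of_isOpen hU).1 hf).2.differentiableOn
      (by simp)).differentiableAt hn).hasFDerivAt
  have h1 : HasDerivAt (fun r => fderiv ℝ F (r, s) (0, 1))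
      (fderiv ℝ (fderiv ℝ F) (t, s) (1, 0) (0, 1)) t := by
    have := hd.comp_hasDerivAt (f := fun r : ℝ => (r, s)) t
      ((hasDerivAt_id t).prodMk (hasDerivAt_const t s))
    simpa using this.clm_apply (hasDerivAt_const t ((0 : ℝ), (1 : ℝ)))
  have h2 : HasDerivAt (fun r => fderiv ℝ F (t, r) (1, 0))
      (fderiv ℝ (fderiv ℝ F) (t, s) (0, 1) (1, 0)) s := by
    have := hd.comp_hasDerivAt (f := fun r : ℝ => (t, r)) s
      ((hasDerivAt_const s t).prodMk (hasDerivAt_id s))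
    simpa using this.clm_apply (hasDerivAt_const s ((1 : ℝ), (0 : ℝ)))
  have n1 : ∀ᶠ r in nhds t, (r, s) ∈ U :=
    (Continuous.tendsto (f := fun r : ℝ => (r, s)) (by fun_prop) t).eventually hn
  have n2 : ∀ᶠ r in nhds s, (t, r) ∈ U :=
    (Continuous.tendsto (f := fun r : ℝ => (t, r)) (by fun_prop) s).eventually hn
  have e1 : HasDerivAt (fun r => SpaceCurve.dS f r s)
      (fderiv ℝ (fderiv ℝ F) (t, s) (1, 0) (0, 1)) t :=
    h1.congr_of_eventuallyEq (n1.mono fun r hr => (hf.hasDerivAt_fderiv_s hU hr).deriv)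
  have e2 : HasDerivAt (fun r => SpaceCurve.dT f t r)
      (fderiv ℝ (fderiv ℝ F) (t, s) (0, 1) (1, 0)) s :=
    h2.congr_of_eventuallyEq (n2.mono fun r hr => (hf.hasDerivAt_fderiv_t hU hr).deriv)
  exact e1.deriv.trans ((hsym.eq (1, 0) (0, 1)).trans e2.deriv.symm)

theorem JointSmoothOn.continuous_s (hf : JointSmoothOn U f) (h : ∀ r, (t, r) ∈ U) :
    Continuous (f t) :=
  continuousOn_univ.1 (hf.continuousOn.comp (f := fun r : ℝ => (t, r)) (by fun_prop)
    fun r _ => h r)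

theorem JointSmoothOn.contDiff_s (hf : JointSmoothOn U f) (h : ∀ r, (t, r) ∈ U) :
    ContDiff ℝ ∞ (f t) :=
  contDiffOn_univ.1 (ContDiffOn.comp hf (f := fun r : ℝ => (t, r))
    (by fun_prop : ContDiff ℝ ∞ fun r : ℝ => (t, r)).contDiffOn fun r _ => h r)

/-- The strip of parameters `(t, s)` with `|t| < ε`. -/
def strip (ε : ℝ) : Set (ℝ × ℝ) := Set.Ioo (-ε) ε ×ˢ Set.univ

theorem isOpen_strip (ε : ℝ) : IsOpen (strip ε) := isOpen_Ioo.prod isOpen_univ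

theorem mem_strip {ε t s : ℝ} : (t, s) ∈ strip ε ↔ t ∈ Set.Ioo (-ε) ε := by simp [strip]

/-- Differentiation under the integral sign for jointly smooth integrands. -/
theorem JointSmoothOn.hasDerivAt_integral {ε : ℝ} (hε : 0 < ε) {f : ℝ → ℝ → ℝ}
    (hf : JointSmoothOn (strip ε) f) (a b : ℝ) :
    HasDerivAt (fun t => ∫ s in a..b, f t s) (∫ s in a..b, SpaceCurve.dT f 0 s) 0 := by
  have hU := isOpen_strip ε
  have hmem : ∀ t ∈ Set.Icc (-(ε / 2)) (ε / 2), ∀ s, (t, s) ∈ strip ε := fun t ht s =>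
    mem_strip.2 ⟨by linarith [ht.1], by linarith [ht.2]⟩
  have hmem' : ∀ t ∈ Set.Ioo (-(ε / 2)) (ε / 2), ∀ s, (t, s) ∈ strip ε := fun t ht s =>
    hmem t ⟨ht.1.le, ht.2.le⟩ s
  have h0 : (0 : ℝ) ∈ Set.Icc (-(ε / 2)) (ε / 2) := ⟨by linarith, by linarith⟩
  have hcomp : IsCompact (Set.Icc (-(ε / 2)) (ε / 2) ×ˢ Set.uIcc a b) :=
    isCompact_Icc.prod isCompact_uIcc
  obtain ⟨C, hC⟩ := hcomp.exists_bound_of_continuousOn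
    (f := fun q : ℝ × ℝ => SpaceCurve.dT f q.1 q.2)
    ((hf.dT hU).continuousOn.mono fun q hq => hmem q.1 hq.1 q.2)
  have hs : Set.Ioo (-(ε / 2)) (ε / 2) ∈ nhds (0 : ℝ) :=
    Ioo_mem_nhds (by linarith) (by linarith)
  refine (intervalIntegral.hasDerivAt_integral_of_dominated_loc_of_deriv_le
    (F := f) (F' := SpaceCurve.dT f) (bound := fun _ => C) hs ?_ ?_ ?_ ?_ ?_ ?_).2
  · filter_upwards [hs] with t ht
    exact (hf.continuous_s (hmem' t ht)).aestronglyMeasurable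
  · exact (hf.continuous_s (hmem 0 h0)).intervalIntegrable _ _
  · exact ((hf.dT hU).continuous_s (hmem 0 h0)).aestronglyMeasurable
  · refine Filter.Eventually.of_forall fun s hs t ht => ?_
    exact hC (t, s) ⟨⟨ht.1.le, ht.2.le⟩, Set.uIoc_subset_uIcc hs⟩
  · exact intervalIntegrable_const
  · exact Filter.Eventually.of_forall fun s _ t ht => hf.hasDerivAt_t hU (hmem' t ht s)

end Partial

/-! ### Sequences of vectors with the formal unit length condition -/

section Sequences
open Finset

/-- The formal vector field `∑ Y_n X^n` of a sequence of vectors. -/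
def vecSeries (Y : ℕ → R3) : Fin 3 → PowerSeries ℝ := fun i => PowerSeries.mk fun n => Y n i

theorem coeff_dot_vecSeries (Y Z : ℕ → R3) (n : ℕ) :
    PowerSeries.coeff n (vecSeries Y ⬝ᵥ vecSeries Z) = ∑ q ∈ antidiagonal n, Y q.1 ⬝ᵥ Z q.2 := by
  simp only [dot_eq, map_add, PowerSeries.coeff_mul, vecSeries, PowerSeries.coeff_mk,
    sum_add_distrib]

theorem cross_vecSeries (Y Z : ℕ → R3) :
    vecSeries Y ⨯₃ vecSeries Z
      = vecSeries fun n => ∑ q ∈ antidiagonal n, Y q.1 ⨯₃ Z q.2 := by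
  funext i
  ext n
  fin_cases i <;>
  simp [cross_zero, cross_one, cross_two, PowerSeries.coeff_mul, vecSeries,
    PowerSeries.coeff_mk, sum_sub_distrib, Finset.sum_apply]

theorem sum_antidiagonal_cross_self (Y : ℕ → R3) (n : ℕ) :
    ∑ q ∈ antidiagonal n, Y q.1 ⨯₃ Y q.2 = 0 := by
  have h : ∑ q ∈ antidiagonal n, Y q.1 ⨯₃ Y q.2
      = -∑ q ∈ antidiagonal n, Y q.1 ⨯₃ Y q.2 := by
    rw [← sum_neg_distrib, ← Nat.sum_antidiagonal_swap]
    exact sum_congr rfl fun q _ => (cross_anticomm _ _).symm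
  exact self_eq_neg.1 h

/-- The value `∑_{d+m=l} Y_{k+1+d} × Y_m` of the derivative of `Y_l` in the direction `Y_k`. -/
def flowBracket (Y : ℕ → R3) (k l : ℕ) : R3 :=
  ∑ q ∈ antidiagonal l, Y (k + 1 + q.1) ⨯₃ Y q.2

theorem flowBracket_succ_right (Y : ℕ → R3) (k l : ℕ) :
    flowBracket Y k (l + 1) = Y (k + 1) ⨯₃ Y (l + 1) + flowBracket Y (k + 1) l := by
  rw [flowBracket, Nat.sum_antidiagonal_succ, flowBracket]
  simp only [add_zero]
  congr 1
  exact sum_congr rfl fun q _ => by rw [show k + 1 + (q.1 + 1) = k + 1 + 1 + q.1 by ring]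

/-- The brackets are symmetric: adjacent brackets differ by a term which is antisymmetric in the
indices. -/
theorem flowBracket_comm (Y : ℕ → R3) (k l : ℕ) : flowBracket Y k l = flowBracket Y l k := by
  induction l generalizing k with
  | zero =>
    have h := sum_antidiagonal_cross_self Y (k + 1)
    rw [Nat.sum_antidiagonal_succ] at h
    simp only [flowBracket, Nat.antidiagonal_zero, sum_singleton, add_zero, zero_add]
    rw [← cross_anticomm, neg_eq_iff_add_eq_zero]
    simpa only [add_comm 1] using h
  | succ l ih =>
    rw [flowBracket_succ_right, ih (k + 1), flowBracket_succ_right, ← add_assoc,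
      cross_anticomm', zero_add]

/-- The formal bracket is the product of a series with `Y`, hence orthogonal to `Y`. -/
theorem sum_flowBracket_dot (Y : ℕ → R3) (k n : ℕ) :
    ∑ q ∈ antidiagonal n, flowBracket Y k q.1 ⬝ᵥ Y q.2 = 0 := by
  have h : flowBracket Y k = fun l => ∑ q ∈ antidiagonal l, (fun d => Y (k + 1 + d)) q.1 ⨯₃ Y q.2 :=
    rfl
  rw [← coeff_dot_vecSeries, h, ← cross_vecSeries (fun d => Y (k + 1 + d)) Y, cross_dot_eq]
  simp

/-- The Lax equation for the brackets: with `Y_m' = -T × Y_{m+1}` inserted, this is the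
derivative of the relation `Y_l' + T × Y_{l+1} = 0` in the direction `Y_k`. -/
theorem flowBracket_lax (Y : ℕ → R3) (k l : ℕ) :
    ∑ q ∈ antidiagonal l, (-(Y 0 ⨯₃ Y (k + 1 + q.1 + 1)) ⨯₃ Y q.2
      + Y (k + 1 + q.1) ⨯₃ -(Y 0 ⨯₃ Y (q.2 + 1)))
      + flowBracket Y k 0 ⨯₃ Y (l + 1) + Y 0 ⨯₃ flowBracket Y k (l + 1) = 0 := by
  have h : Y 0 ⨯₃ flowBracket Y k (l + 1)
      = ∑ q ∈ antidiagonal (l + 1), (Y 0 ⨯₃ Y (k + 1 + q.1)) ⨯₃ Y q.2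
        + ∑ q ∈ antidiagonal (l + 1), Y (k + 1 + q.1) ⨯₃ (Y 0 ⨯₃ Y q.2) := by
    rw [flowBracket, map_sum, ← sum_add_distrib]
    exact sum_congr rfl fun q _ => leibniz_cross _ _ _
  rw [h, Nat.sum_antidiagonal_succ, Nat.sum_antidiagonal_succ', sum_add_distrib]
  simp only [flowBracket, Nat.antidiagonal_zero, sum_singleton, add_zero, cross_self, map_zero,
    map_neg, sum_neg_distrib, LinearMap.neg_apply, ← add_assoc]
  rw [← cross_anticomm (Y (k + 1)) (Y 0)]
  simp only [map_neg, LinearMap.neg_apply]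
  abel

end Sequences

/-! ### The hierarchy along a single curve -/

section Curve
open Finset

theorem dot_self_nonneg (v : R3) : 0 ≤ v ⬝ᵥ v := by
  rw [dot_eq]
  exact add_nonneg (add_nonneg (mul_self_nonneg _) (mul_self_nonneg _)) (mul_self_nonneg _)

theorem dot_self_pos {v : R3} (hv : v ≠ 0) : 0 < v ⬝ᵥ v :=
  lt_of_le_of_ne (dot_self_nonneg v) (Ne.symm (dotProduct_self_eq_zero.not.2 hv))

variable {γ : ℝ → R3} {s : ℝ}

theorem speed_pos (h : deriv γ s ≠ 0) : 0 < speed γ s := Real.sqrt_pos.2 (dot_self_pos h)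

theorem speed_sq : speed γ s * speed γ s = deriv γ s ⬝ᵥ deriv γ s :=
  Real.mul_self_sqrt (dot_self_nonneg _)

theorem speed_smul_arcDeriv (h : deriv γ s ≠ 0) (f : ℝ → R3) :
    speed γ s • arcDeriv γ f s = deriv f s := by
  rw [arcDeriv, smul_smul, mul_inv_cancel₀ (speed_pos h).ne', one_smul]

theorem speed_smul_tangent (h : deriv γ s ≠ 0) : speed γ s • tangent γ s = deriv γ s :=
  speed_smul_arcDeriv h γ

theorem tangent_dot_self (h : deriv γ s ≠ 0) : tangent γ s ⬝ᵥ tangent γ s = 1 := by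
  have h1 := (speed_pos h).ne'
  simp only [tangent, arcDeriv, smul_dotProduct, dotProduct_smul, ← speed_sq, smul_eq_mul]
  field_simp

theorem flowY_zero (γ : ℝ → R3) : flowY γ 0 = tangent γ := by rw [flowY]

theorem flowY_succ (γ : ℝ → R3) (k : ℕ) (s : ℝ) :
    flowY γ (k + 1) s = tangent γ s ⨯₃ arcDeriv γ (flowY γ k) s
      - ((1 / 2 : ℝ) * ∑ j ∈ range k, flowY γ (j + 1) s ⬝ᵥ flowY γ (k - j) s) •
        tangent γ s := by
  rw [flowY, Finset.sum_range]

theorem tangent_dot_flowY_succ (h : deriv γ s ≠ 0) (k : ℕ) :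
    tangent γ s ⬝ᵥ flowY γ (k + 1) s
      = -((1 / 2 : ℝ) * ∑ j ∈ range k, flowY γ (j + 1) s ⬝ᵥ flowY γ (k - j) s) := by
  rw [flowY_succ, dotProduct_sub, dot_self_cross, dotProduct_smul, tangent_dot_self h]
  simp

/-- The formal vector field `∑ Y_n X^n` has unit length. -/
theorem sum_flowY_dot_flowY (h : deriv γ s ≠ 0) (k : ℕ) :
    ∑ q ∈ antidiagonal k, flowY γ q.1 s ⬝ᵥ flowY γ q.2 s = if k = 0 then 1 else 0 := by
  cases k with
  | zero => simpa [flowY_zero] using tangent_dot_self h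
  | succ k =>
    rw [Nat.sum_antidiagonal_eq_sum_range_succ (fun i j => flowY γ i s ⬝ᵥ flowY γ j s),
      sum_range_succ, sum_range_succ', flowY_zero, if_neg (Nat.succ_ne_zero k)]
    simp only [Nat.add_sub_add_right, Nat.sub_zero, Nat.sub_self, flowY_zero]
    rw [dotProduct_comm (flowY γ (k + 1) s), tangent_dot_flowY_succ h]
    ring

theorem tangent_cross_flowY_succ (h : deriv γ s ≠ 0) (k : ℕ)
    (hk : tangent γ s ⬝ᵥ arcDeriv γ (flowY γ k) s = 0) :
    arcDeriv γ (flowY γ k) s + tangent γ s ⨯₃ flowY γ (k + 1) s = 0 := by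
  rw [flowY_succ, map_sub, map_smul, cross_self, smul_zero, sub_zero,
    cross_cross_eq_smul_sub_smul', hk, tangent_dot_self h]
  simp

end Curve

/-! ### The hierarchy along a family of curves -/

section Family
open Finset

/-- A smooth family of curves which is immersed at all parameters `(t, s)` in the open set `U`. -/
structure ImmersedFamily (U : Set (ℝ × ℝ)) (Γ : ℝ → ℝ → R3) : Prop where
  isOpen : IsOpen U
  smooth : JointSmoothOn U Γ
  immersed : ∀ t s, (t, s) ∈ U → deriv (Γ t) s ≠ 0

variable {U : Set (ℝ × ℝ)} {Γ : ℝ → ℝ → R3} {t s : ℝ}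

theorem JointSmoothOn.dot {f g : ℝ → ℝ → R3} (hf : JointSmoothOn U f) (hg : JointSmoothOn U g) :
    JointSmoothOn U fun t s => f t s ⬝ᵥ g t s := ContDiffOn.dot hf hg

theorem JointSmoothOn.cross {f g : ℝ → ℝ → R3} (hf : JointSmoothOn U f)
    (hg : JointSmoothOn U g) : JointSmoothOn U fun t s => f t s ⨯₃ g t s := ContDiffOn.cross hf hg

namespace ImmersedFamily

theorem speed (hΓ : ImmersedFamily U Γ) :
    JointSmoothOn U fun t s => SpaceCurve.speed (Γ t) s :=
  ((hΓ.smooth.dS hΓ.isOpen).dot (hΓ.smooth.dS hΓ.isOpen)).sqrt fun q hq =>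
    (dot_self_pos (hΓ.immersed q.1 q.2 hq)).ne'

theorem arcDeriv (hΓ : ImmersedFamily U Γ) {f : ℝ → ℝ → R3} (hf : JointSmoothOn U f) :
    JointSmoothOn U fun t s => SpaceCurve.arcDeriv (Γ t) (f t) s :=
  ContDiffOn.smul (hΓ.speed.inv fun q hq => (speed_pos (hΓ.immersed q.1 q.2 hq)).ne')
    (hf.dS hΓ.isOpen)

theorem tangent (hΓ : ImmersedFamily U Γ) :
    JointSmoothOn U fun t s => SpaceCurve.tangent (Γ t) s := hΓ.arcDeriv hΓ.smooth

theorem flowY (hΓ : ImmersedFamily U Γ) (k : ℕ) :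
    JointSmoothOn U fun t s => SpaceCurve.flowY (Γ t) k s := by
  induction k using Nat.strong_induction_on with
  | _ k ih =>
    cases k with
    | zero => simpa only [flowY_zero] using hΓ.tangent
    | succ k =>
      rw [show (fun t s => SpaceCurve.flowY (Γ t) (k + 1) s) = _ from
        funext fun t => funext fun s => flowY_succ (Γ t) k s]
      refine ContDiffOn.sub (hΓ.tangent.cross (hΓ.arcDeriv (ih k (by omega))))
        
        (ContDiffOn.fun_smul (contDiffOn_const.mul (ContDiffOn.sum fun j hj => ?_)) hΓ.tangent)
      have := mem_range.1 hj
      exact (ih (j + 1) (by omega)).dot (ih (k - j) (by omega))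

theorem hasDerivAt_flowY_deriv (hΓ : ImmersedFamily U Γ) (k : ℕ) (h : (t, s) ∈ U) :
    HasDerivAt (SpaceCurve.flowY (Γ t) k) (deriv (SpaceCurve.flowY (Γ t) k) s) s :=
  (hΓ.flowY k).hasDerivAt_s hΓ.isOpen h

theorem sum_deriv_flowY_dot (hΓ : ImmersedFamily U Γ) (k : ℕ) (h : (t, s) ∈ U) :
    ∑ q ∈ antidiagonal k, deriv (SpaceCurve.flowY (Γ t) q.1) s ⬝ᵥ SpaceCurve.flowY (Γ t) q.2 s
      = 0 := by
  have n1 : ∀ᶠ r in nhds s, (t, r) ∈ U :=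
    (Continuous.tendsto (f := fun r : ℝ => (t, r)) (by fun_prop) s).eventually
      (hΓ.isOpen.mem_nhds h)
  have h1 : HasDerivAt (fun r => ∑ q ∈ antidiagonal k,
      SpaceCurve.flowY (Γ t) q.1 r ⬝ᵥ SpaceCurve.flowY (Γ t) q.2 r) 0 s :=
    (hasDerivAt_const s (if k = 0 then (1 : ℝ) else 0)).congr_of_eventuallyEq
      (n1.mono fun r hr => sum_flowY_dot_flowY (hΓ.immersed t r hr) k)
  have h2 := HasDerivAt.fun_sum (u := antidiagonal k) fun q _ =>
    HasDerivAt.dot (hΓ.hasDerivAt_flowY_deriv q.1 h) (hΓ.hasDerivAt_flowY_deriv q.2 h)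
  have h3 := h1.unique h2
  rw [sum_add_distrib, ← Nat.sum_antidiagonal_swap (f := fun q =>
    SpaceCurve.flowY (Γ t) q.1 s ⬝ᵥ deriv (SpaceCurve.flowY (Γ t) q.2) s)] at h3
  simp only [Prod.fst_swap, Prod.snd_swap] at h3
  simp only [dotProduct_comm (SpaceCurve.flowY (Γ t) _ s)] at h3
  linarith

/-- The relation `Y_k' + T × Y_{k+1} = 0`.  That `Y_k'` is orthogonal to `T` comes from
differentiating the unit length condition; the remaining terms cancel by antisymmetry of the
determinant. -/
theorem arcDeriv_add_cross (hΓ : ImmersedFamily U Γ) (k : ℕ) (h : (t, s) ∈ U) :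
    SpaceCurve.arcDeriv (Γ t) (SpaceCurve.flowY (Γ t) k) s
      + SpaceCurve.tangent (Γ t) s ⨯₃ SpaceCurve.flowY (Γ t) (k + 1) s = 0 := by
  induction k using Nat.strong_induction_on with
  | _ k ih =>
    have him := hΓ.immersed t s h
    refine tangent_cross_flowY_succ him k ?_
    have h1 := hΓ.sum_deriv_flowY_dot k h
    simp only [← speed_smul_arcDeriv him, smul_dotProduct, ← smul_sum] at h1
    have h2 := (smul_eq_zero.1 h1).resolve_left (speed_pos him).ne'
    cases k with
    | zero => simpa [flowY_zero, dotProduct_comm] using h2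
    | succ k =>
      rw [Nat.sum_antidiagonal_succ'] at h2
      have h3 : ∑ q ∈ antidiagonal k,
          SpaceCurve.arcDeriv (Γ t) (SpaceCurve.flowY (Γ t) q.1) s
            ⬝ᵥ SpaceCurve.flowY (Γ t) (q.2 + 1) s
          = -(SpaceCurve.tangent (Γ t) s ⬝ᵥ ∑ q ∈ antidiagonal k,
            SpaceCurve.flowY (Γ t) (q.1 + 1) s ⨯₃ SpaceCurve.flowY (Γ t) (q.2 + 1) s) := by
        rw [dotProduct_sum, ← sum_neg_distrib]
        refine sum_congr rfl fun q hq => ?_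
        rw [eq_neg_of_add_eq_zero_left (ih q.1 (by have := mem_antidiagonal.1 hq; omega)),
          neg_dotProduct, cross_dot_eq]
      rw [h3, sum_antidiagonal_cross_self fun n => SpaceCurve.flowY (Γ t) (n + 1) s] at h2
      simpa [flowY_zero, dotProduct_comm] using h2

theorem deriv_flowY (hΓ : ImmersedFamily U Γ) (k : ℕ) (h : (t, s) ∈ U) :
    deriv (SpaceCurve.flowY (Γ t) k) s = -(SpaceCurve.speed (Γ t) s •
      (SpaceCurve.tangent (Γ t) s ⨯₃ SpaceCurve.flowY (Γ t) (k + 1) s)) := by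
  rw [← speed_smul_arcDeriv (hΓ.immersed t s h),
    eq_neg_of_add_eq_zero_left (hΓ.arcDeriv_add_cross k h), smul_neg]

theorem hasDerivAt_flowY (hΓ : ImmersedFamily U Γ) (k : ℕ) (h : (t, s) ∈ U) :
    HasDerivAt (SpaceCurve.flowY (Γ t) k) (-(SpaceCurve.speed (Γ t) s •
      (SpaceCurve.tangent (Γ t) s ⨯₃ SpaceCurve.flowY (Γ t) (k + 1) s))) s :=
  hΓ.deriv_flowY k h ▸ hΓ.hasDerivAt_flowY_deriv k h

end ImmersedFamily

variable {p : ℝ} {A : Matrix (Fin 3) (Fin 3) ℝ} {a : R3} {γ : ℝ → R3}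

/-- A curve as a constant family. -/
theorem ImmersedFamily.const (hγ : γ ∈ curveSpace p A a) :
    ImmersedFamily Set.univ fun _ => γ :=
  ⟨isOpen_univ, (hγ.1.comp contDiff_snd).contDiffOn, fun _ s _ => hγ.2.1 s⟩

theorem contDiff_flowY (hγ : γ ∈ curveSpace p A a) (k : ℕ) : ContDiff ℝ ∞ (flowY γ k) :=
  ((ImmersedFamily.const hγ).flowY k).contDiff_s (t := 0) fun _ => Set.mem_univ _

theorem contDiff_tangent (hγ : γ ∈ curveSpace p A a) : ContDiff ℝ ∞ (tangent γ) :=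
  flowY_zero γ ▸ contDiff_flowY hγ 0

theorem contDiff_speed (hγ : γ ∈ curveSpace p A a) : ContDiff ℝ ∞ (speed γ) :=
  (ImmersedFamily.const hγ).speed.contDiff_s (t := 0) fun _ => Set.mem_univ _

theorem hasDerivAt_flowY (hγ : γ ∈ curveSpace p A a) (k : ℕ) (s : ℝ) :
    HasDerivAt (flowY γ k) (-(speed γ s • (tangent γ s ⨯₃ flowY γ (k + 1) s))) s :=
  (ImmersedFamily.const hγ).hasDerivAt_flowY (t := 0) k (Set.mem_univ _)

end Family

/-! ### Rotations and vector products -/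

section Rotations
variable {A : Matrix (Fin 3) (Fin 3) ℝ}

theorem transpose_mul_self (hA : A ∈ Matrix.specialOrthogonalGroup (Fin 3) ℝ) : Aᵀ * A = 1 :=
  (Matrix.mem_orthogonalGroup_iff' _ _).1 (Matrix.mem_specialOrthogonalGroup_iff.1 hA).1

theorem mul_transpose_self (hA : A ∈ Matrix.specialOrthogonalGroup (Fin 3) ℝ) : A * Aᵀ = 1 :=
  (Matrix.mem_orthogonalGroup_iff _ _).1 (Matrix.mem_specialOrthogonalGroup_iff.1 hA).1

theorem mulVec_dot_mulVec (hA : A ∈ Matrix.specialOrthogonalGroup (Fin 3) ℝ) (v w : R3) :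
    (A *ᵥ v) ⬝ᵥ (A *ᵥ w) = v ⬝ᵥ w := by
  rw [Matrix.dotProduct_mulVec, ← Matrix.mulVec_transpose, Matrix.mulVec_mulVec,
    transpose_mul_self hA, Matrix.one_mulVec]

theorem mulVec_cross_mulVec_eq_adjugate (A : Matrix (Fin 3) (Fin 3) ℝ) (v w : R3) :
    (A *ᵥ v) ⨯₃ (A *ᵥ w) = A.adjugateᵀ *ᵥ (v ⨯₃ w) := by
  funext i
  fin_cases i <;>
  simp [cross_apply, Matrix.mulVec, dot_eq, Matrix.adjugate_fin_three, Matrix.transpose_apply] <;>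
  ring

theorem mulVec_cross_mulVec (hA : A ∈ Matrix.specialOrthogonalGroup (Fin 3) ℝ) (v w : R3) :
    (A *ᵥ v) ⨯₃ (A *ᵥ w) = A *ᵥ (v ⨯₃ w) := by
  have h : A.adjugate = Aᵀ := by
    have h1 : A.adjugate * A * Aᵀ = Aᵀ := by
      rw [Matrix.adjugate_mul, (Matrix.mem_specialOrthogonalGroup_iff.1 hA).2]; simp
    rwa [mul_assoc, mul_transpose_self hA, mul_one] at h1
  rw [mulVec_cross_mulVec_eq_adjugate, h, Matrix.transpose_transpose]

end Rotations

/-! ### Equivariance under the monodromy -/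

section Equivariance
open Finset
variable {p : ℝ} {A : Matrix (Fin 3) (Fin 3) ℝ} {a : R3} {γ : ℝ → R3}

theorem deriv_equivariant {f : ℝ → R3} (c : R3) (hf : Differentiable ℝ f)
    (h : ∀ s, f (s + p) = A *ᵥ f s + c) (s : ℝ) : deriv f (s + p) = A *ᵥ deriv f s := by
  have h1 : HasDerivAt (fun r => f (r + p)) (deriv f (s + p)) s :=
    (hf (s + p)).hasDerivAt.comp_add_const s p
  have h2 : HasDerivAt (fun r => A *ᵥ f r + c) (A *ᵥ deriv f s) s :=
    (HasDerivAt.mulVec A (hf s).hasDerivAt).add_const c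
  rw [funext h] at h1
  exact h1.unique h2

variable (hA : A ∈ Matrix.specialOrthogonalGroup (Fin 3) ℝ) (hγ : γ ∈ curveSpace p A a)
include hγ

theorem differentiable_curve : Differentiable ℝ γ := hγ.1.differentiable (by simp)

theorem deriv_curve_equivariant (s : ℝ) : deriv γ (s + p) = A *ᵥ deriv γ s :=
  deriv_equivariant a (differentiable_curve hγ) hγ.2.2 s

include hA

theorem speed_periodic (s : ℝ) : speed γ (s + p) = speed γ s := by
  rw [speed, speed, deriv_curve_equivariant hγ, mulVec_dot_mulVec hA]

theorem arcDeriv_equivariant {f : ℝ → R3} (c : R3) (hf : Differentiable ℝ f)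
    (h : ∀ s, f (s + p) = A *ᵥ f s + c) (s : ℝ) :
    arcDeriv γ f (s + p) = A *ᵥ arcDeriv γ f s := by
  rw [arcDeriv, arcDeriv, deriv_equivariant c hf h, speed_periodic hA hγ, Matrix.mulVec_smul]

theorem tangent_equivariant (s : ℝ) : tangent γ (s + p) = A *ᵥ tangent γ s :=
  arcDeriv_equivariant hA hγ a (differentiable_curve hγ) hγ.2.2 s

theorem flowY_equivariant (k : ℕ) (s : ℝ) : flowY γ k (s + p) = A *ᵥ flowY γ k s := by
  induction k using Nat.strong_induction_on generalizing s with
  | _ k ih =>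
    cases k with
    | zero => rw [flowY_zero, tangent_equivariant hA hγ]
    | succ k =>
      rw [flowY_succ, flowY_succ, tangent_equivariant hA hγ,
        arcDeriv_equivariant hA hγ 0 ((contDiff_flowY hγ k).differentiable (by simp))
          fun s => by rw [ih k (by omega), add_zero],
        mulVec_cross_mulVec hA, Matrix.mulVec_sub, Matrix.mulVec_smul]
      congr 3
      refine sum_congr rfl fun j hj => ?_
      have := mem_range.1 hj
      rw [ih (j + 1) (by omega), ih (k - j) (by omega), mulVec_dot_mulVec hA]

theorem flowY_mem_tangentSpace (k : ℕ) : flowY γ k ∈ tangentSpace p A :=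
  ⟨contDiff_flowY hγ k, flowY_equivariant hA hγ k⟩

end Equivariance

/-! ### Commutation of the flows -/

section Commutation
open Finset
variable {U : Set (ℝ × ℝ)} {Γ : ℝ → ℝ → R3} {s : ℝ}

/-- Differentiation of the relation `speed² = |γ̇|²` in a variation. -/
theorem ImmersedFamily.speed_mul_dT_speed (hΓ : ImmersedFamily U Γ) {t s : ℝ}
    (h : (t, s) ∈ U) :
    dT (fun t s => SpaceCurve.speed (Γ t) s) t s
      = SpaceCurve.tangent (Γ t) s ⬝ᵥ dT (dS Γ) t s := by
  have n1 : ∀ᶠ r in nhds t, (r, s) ∈ U :=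
    (Continuous.tendsto (f := fun r : ℝ => (r, s)) (by fun_prop) t).eventually
      (hΓ.isOpen.mem_nhds h)
  have h1 := (hΓ.speed.hasDerivAt_t hΓ.isOpen h).fun_mul (hΓ.speed.hasDerivAt_t hΓ.isOpen h)
  have h2 := HasDerivAt.dot (hΓ.smooth.hasDerivAt_dS_t hΓ.isOpen h)
    (hΓ.smooth.hasDerivAt_dS_t hΓ.isOpen h)
  have h3 := h1.unique (h2.congr_of_eventuallyEq (Filter.Eventually.of_forall fun r => speed_sq))
  have h4 : dS Γ t s = SpaceCurve.speed (Γ t) s • SpaceCurve.tangent (Γ t) s :=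
    (speed_smul_tangent (hΓ.immersed t s h)).symm
  rw [dotProduct_comm (dT (dS Γ) t s), h4, smul_dotProduct, smul_eq_mul] at h3
  have h5 := speed_pos (hΓ.immersed t s h)
  refine mul_left_cancel₀ h5.ne' ?_
  linarith

theorem ImmersedFamily.dT_dS_eq (hΓ : ImmersedFamily U Γ) {t s : ℝ} (h : (t, s) ∈ U) :
    dT (dS Γ) t s = dT (fun t s => SpaceCurve.speed (Γ t) s) t s • SpaceCurve.tangent (Γ t) s
      + SpaceCurve.speed (Γ t) s • dT (fun t s => SpaceCurve.tangent (Γ t) s) t s := by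
  have n1 : ∀ᶠ r in nhds t, (r, s) ∈ U :=
    (Continuous.tendsto (f := fun r : ℝ => (r, s)) (by fun_prop) t).eventually
      (hΓ.isOpen.mem_nhds h)
  have h1 := (hΓ.speed.hasDerivAt_t hΓ.isOpen h).fun_smul
    (hΓ.tangent.hasDerivAt_t hΓ.isOpen h)
  have h2 := (hΓ.smooth.hasDerivAt_dS_t hΓ.isOpen h)
  rw [add_comm]
  exact h2.unique (h1.congr_of_eventuallyEq
    (n1.mono fun r hr => (speed_smul_tangent (hΓ.immersed r s hr)).symm))

/-- The derivative of the hierarchy in the direction of one of its members.  The variation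
through `Y_k` preserves arclength, so differentiating `Y_l' + T × Y_{l+1} = 0` and the unit length
condition determines the derivative of `Y_{l+1}` from those of the earlier `Y_l`; the brackets
satisfy the same recursion. -/
theorem ImmersedFamily.dT_flowY (hΓ : ImmersedFamily U Γ) (hU : ∀ s, ((0 : ℝ), s) ∈ U) (k : ℕ)
    (hk : ∀ s, dT Γ 0 s = SpaceCurve.flowY (Γ 0) k s) (l : ℕ) (s : ℝ) :
    dT (fun t s => SpaceCurve.flowY (Γ t) l s) 0 s
      = flowBracket (fun n => SpaceCurve.flowY (Γ 0) n s) k l := by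
  have him : ∀ s, deriv (Γ 0) s ≠ 0 := fun s => hΓ.immersed 0 s (hU s)
  have hst : ∀ s, dT (dS Γ) 0 s = -(SpaceCurve.speed (Γ 0) s •
      (SpaceCurve.tangent (Γ 0) s ⨯₃ SpaceCurve.flowY (Γ 0) (k + 1) s)) := fun s => by
    rw [hΓ.smooth.dT_dS hΓ.isOpen (hU s), dS, show dT Γ 0 = SpaceCurve.flowY (Γ 0) k from
      funext hk, hΓ.deriv_flowY k (hU s)]
  have hv : ∀ s, dT (fun t s => SpaceCurve.speed (Γ t) s) 0 s = 0 := fun s => by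
    rw [hΓ.speed_mul_dT_speed (hU s), hst]
    simp
  have hT : ∀ s, dT (fun t s => SpaceCurve.tangent (Γ t) s) 0 s
      = flowBracket (fun n => SpaceCurve.flowY (Γ 0) n s) k 0 := fun s => by
    have h1 := hΓ.dT_dS_eq (hU s)
    rw [hv, hst, zero_smul, zero_add, ← smul_neg] at h1
    have h2 := smul_right_injective R3 (speed_pos (him s)).ne' h1
    rw [← h2, cross_anticomm]
    simp [flowBracket, flowY_zero]
  induction l using Nat.strong_induction_on generalizing s with
  | _ l ih =>
    cases l with
    | zero => simpa only [flowY_zero] using hT s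
    | succ l =>
      have n1 : ∀ᶠ r in nhds (0 : ℝ), (r, s) ∈ U :=
        (Continuous.tendsto (f := fun r : ℝ => (r, s)) (by fun_prop) 0).eventually
          (hΓ.isOpen.mem_nhds (hU s))
      set W := dT (fun t s => SpaceCurve.flowY (Γ t) (l + 1) s) 0 s
      set Z := flowBracket (fun n => SpaceCurve.flowY (Γ 0) n s) k (l + 1)
      -- differentiate the relation between `Y_l'` and `Y_{l+1}` in `t`, in two ways
      have h1 : HasDerivAt (fun r => dS (fun t s => SpaceCurve.flowY (Γ t) l s) r s)
          (-(SpaceCurve.speed (Γ 0) s •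
            (flowBracket (fun n => SpaceCurve.flowY (Γ 0) n s) k 0
              ⨯₃ SpaceCurve.flowY (Γ 0) (l + 1) s + SpaceCurve.tangent (Γ 0) s ⨯₃ W))) 0 := by
        have h := ((hΓ.speed.hasDerivAt_t hΓ.isOpen (hU s)).fun_smul
          (HasDerivAt.cross (hΓ.tangent.hasDerivAt_t hΓ.isOpen (hU s))
            ((hΓ.flowY (l + 1)).hasDerivAt_t hΓ.isOpen (hU s)))).fun_neg
        rw [hv, hT, zero_smul, add_zero] at h
        exact h.congr_of_eventuallyEq (n1.mono fun r hr => hΓ.deriv_flowY l hr)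
      have h2 : HasDerivAt (fun r => dS (fun t s => SpaceCurve.flowY (Γ t) l s) r s)
          (SpaceCurve.speed (Γ 0) s • ∑ q ∈ antidiagonal l,
            (-(SpaceCurve.flowY (Γ 0) 0 s ⨯₃ SpaceCurve.flowY (Γ 0) (k + 1 + q.1 + 1) s)
                ⨯₃ SpaceCurve.flowY (Γ 0) q.2 s
              + SpaceCurve.flowY (Γ 0) (k + 1 + q.1) s ⨯₃
                -(SpaceCurve.flowY (Γ 0) 0 s ⨯₃ SpaceCurve.flowY (Γ 0) (q.2 + 1) s))) 0 := by
        have h := (hΓ.flowY l).hasDerivAt_dS_t hΓ.isOpen (hU s)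
        refine h.congr_deriv ?_
        rw [(hΓ.flowY l).dT_dS hΓ.isOpen (hU s), dS,
          show dT (fun t s => SpaceCurve.flowY (Γ t) l s) 0
            = fun s => flowBracket (fun n => SpaceCurve.flowY (Γ 0) n s) k l from
            funext (ih l (by omega))]
        refine HasDerivAt.deriv ?_
        have h' := HasDerivAt.fun_sum (u := antidiagonal l) fun q _ =>
          HasDerivAt.cross (hΓ.hasDerivAt_flowY (k + 1 + q.1) (hU s))
            (hΓ.hasDerivAt_flowY q.2 (hU s))
        refine h'.congr_deriv ?_
        rw [smul_sum]
        refine sum_congr rfl fun q _ => ?_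
        simp only [flowY_zero, map_neg, map_smul, LinearMap.neg_apply, LinearMap.smul_apply,
          smul_add, smul_neg]
      have h3 := h1.unique h2
      rw [← smul_neg] at h3
      have h4 := smul_right_injective R3 (speed_pos (him s)).ne' h3
      have h5 := flowBracket_lax (fun n => SpaceCurve.flowY (Γ 0) n s) k l
      simp only [← h4] at h5
      -- the two derivatives and the Lax equation determine the part orthogonal to `T`
      have hcross : SpaceCurve.tangent (Γ 0) s ⨯₃ (W - Z) = 0 := by
        rw [map_sub, sub_eq_zero]
        simp only [flowY_zero] at h5
        rw [neg_add, add_assoc, add_assoc] at h5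
        have h6 : ∀ x y z : R3, -x + (-y + (x + z)) = 0 → y = z := fun x y z h => by
          have : z - y = 0 := by rw [← h]; abel
          exact (sub_eq_zero.1 this).symm
        exact h6 _ _ _ h5
      -- the unit length condition determines the component along `T`
      have hdot : SpaceCurve.tangent (Γ 0) s ⬝ᵥ (W - Z) = 0 := by
        have e1 : HasDerivAt (fun r => ∑ q ∈ antidiagonal (l + 1),
            SpaceCurve.flowY (Γ r) q.1 s ⬝ᵥ SpaceCurve.flowY (Γ r) q.2 s) 0 0 :=
          (hasDerivAt_const (0 : ℝ) (if l + 1 = 0 then (1 : ℝ) else 0)).congr_of_eventuallyEq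
            (n1.mono fun r hr => sum_flowY_dot_flowY (hΓ.immersed r s hr) (l + 1))
        have e2 := HasDerivAt.fun_sum (u := antidiagonal (l + 1)) fun q _ =>
          HasDerivAt.dot ((hΓ.flowY q.1).hasDerivAt_t hΓ.isOpen (hU s))
            ((hΓ.flowY q.2).hasDerivAt_t hΓ.isOpen (hU s))
        have e3 := e1.unique e2
        rw [sum_add_distrib, ← Nat.sum_antidiagonal_swap (f := fun q =>
          SpaceCurve.flowY (Γ 0) q.1 s ⬝ᵥ
            dT (fun t s => SpaceCurve.flowY (Γ t) q.2 s) 0 s)] at e3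
        simp only [Prod.fst_swap, Prod.snd_swap] at e3
        simp only [dotProduct_comm (SpaceCurve.flowY (Γ 0) _ s)] at e3
        have e4 := sum_flowBracket_dot (fun n => SpaceCurve.flowY (Γ 0) n s) k (l + 1)
        rw [Nat.sum_antidiagonal_succ'] at e3 e4
        have e5 : ∑ q ∈ antidiagonal l, dT (fun t s => SpaceCurve.flowY (Γ t) q.1 s) 0 s
              ⬝ᵥ SpaceCurve.flowY (Γ 0) (q.2 + 1) s
            = ∑ q ∈ antidiagonal l, flowBracket (fun n => SpaceCurve.flowY (Γ 0) n s) k q.1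
              ⬝ᵥ SpaceCurve.flowY (Γ 0) (q.2 + 1) s :=
          sum_congr rfl fun q hq => by
            rw [ih q.1 (by have := mem_antidiagonal.1 hq; omega)]
        simp only [flowY_zero] at e3 e4
        rw [dotProduct_sub, dotProduct_comm _ W, dotProduct_comm _ Z]
        simp only [W, Z]
        linarith
      have hfin := cross_cross_eq_smul_sub_smul' (SpaceCurve.tangent (Γ 0) s)
        (SpaceCurve.tangent (Γ 0) s) (W - Z)
      rw [hcross, hdot, tangent_dot_self (him s)] at hfin
      rw [map_zero, zero_smul, one_smul, zero_sub] at hfin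
      exact sub_eq_zero.1 (neg_eq_zero.1 hfin.symm)

/-- The variation of a curve by a multiple of a member of the hierarchy, on the open set of
parameters where it is immersed. -/
theorem immersedFamily_add_smul {p : ℝ} {A : Matrix (Fin 3) (Fin 3) ℝ} {a : R3} {γ : ℝ → R3}
    (hγ : γ ∈ curveSpace p A a) (k : ℕ) :
    ImmersedFamily {q : ℝ × ℝ | deriv (fun u => γ u + q.1 • flowY γ k u) q.2 ≠ 0}
      fun t u => γ u + t • flowY γ k u := by
  have hs : JointSmoothOn Set.univ fun t u => γ u + t • flowY γ k u :=
    ((hγ.1.comp contDiff_snd).add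
      (contDiff_fst.smul ((contDiff_flowY hγ k).comp contDiff_snd))).contDiffOn
  refine ⟨?_, hs.mono (Set.subset_univ _), fun t s h => h⟩
  have hc : Continuous fun q : ℝ × ℝ => deriv (fun u => γ u + q.1 • flowY γ k u) q.2 :=
    continuousOn_univ.1 (hs.dS isOpen_univ).continuousOn
  exact isOpen_ne_fun hc continuous_const

/-- The derivative of `Y_l` in the direction `Y_k` is the bracket; the fields commute because the
bracket is symmetric. -/
theorem hasDerivAt_flowY_add_smul {p : ℝ} {A : Matrix (Fin 3) (Fin 3) ℝ} {a : R3} {γ : ℝ → R3}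
    (hγ : γ ∈ curveSpace p A a) (k l : ℕ) (s : ℝ) :
    HasDerivAt (fun t : ℝ => flowY (fun u => γ u + t • flowY γ k u) l s)
      (flowBracket (fun n => flowY γ n s) k l) 0 := by
  obtain ⟨Γ, hdef⟩ : ∃ Γ : ℝ → ℝ → R3, Γ = fun t u => γ u + t • flowY γ k u := ⟨_, rfl⟩
  have hΓ := immersedFamily_add_smul hγ k
  rw [← hdef] at hΓ
  have h0 : Γ 0 = γ := by simp [hdef]
  have hU : ∀ s, ((0 : ℝ), s) ∈
      {q : ℝ × ℝ | deriv (fun u => γ u + q.1 • flowY γ k u) q.2 ≠ 0} := fun s => by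
    simpa using hγ.2.1 s
  have hk : ∀ s, dT Γ 0 s = flowY (Γ 0) k s := fun s => by
    have : HasDerivAt (fun t : ℝ => γ s + t • flowY γ k s) ((1 : ℝ) • flowY γ k s) 0 :=
      ((hasDerivAt_id (0 : ℝ)).smul_const _).const_add _
    rw [h0, ← one_smul ℝ (flowY γ k s), ← this.deriv, dT, hdef]
  have h := hΓ.dT_flowY hU k hk l s
  have h' := (hΓ.flowY l).hasDerivAt_t hΓ.isOpen (hU s)
  rw [h, h0, hdef] at h'
  exact h'

end Commutation

/-! ### Coefficientwise calculus with power series -/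

section SeriesCalculus
open Finset PowerSeries

/-- Coefficientwise derivative of a function with values in the formal power series. -/
def HasCoeffDerivAt (f : ℝ → PowerSeries ℝ) (f' : PowerSeries ℝ) (x : ℝ) : Prop :=
  ∀ n, HasDerivAt (fun y => coeff n (f y)) (coeff n f') x

variable {f g : ℝ → PowerSeries ℝ} {f' g' : PowerSeries ℝ} {x : ℝ}

theorem HasCoeffDerivAt.add (hf : HasCoeffDerivAt f f' x) (hg : HasCoeffDerivAt g g' x) :
    HasCoeffDerivAt (fun y => f y + g y) (f' + g') x := fun n => by
  simpa only [map_add] using (hf n).fun_add (hg n)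

theorem HasCoeffDerivAt.sub (hf : HasCoeffDerivAt f f' x) (hg : HasCoeffDerivAt g g' x) :
    HasCoeffDerivAt (fun y => f y - g y) (f' - g') x := fun n => by
  simpa only [map_sub] using (hf n).fun_sub (hg n)

theorem HasCoeffDerivAt.neg (hf : HasCoeffDerivAt f f' x) :
    HasCoeffDerivAt (fun y => -f y) (-f') x := fun n => by
  simpa only [map_neg] using (hf n).fun_neg

theorem HasCoeffDerivAt.mul (hf : HasCoeffDerivAt f f' x) (hg : HasCoeffDerivAt g g' x) :
    HasCoeffDerivAt (fun y => f y * g y) (f' * g x + f x * g') x := fun n => by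
  simp only [coeff_mul, map_add, ← sum_add_distrib]
  exact HasDerivAt.fun_sum fun q _ => (hf q.1).mul (hg q.2)

theorem HasCoeffDerivAt.const (c : PowerSeries ℝ) : HasCoeffDerivAt (fun _ => c) 0 x :=
  fun n => by simpa using hasDerivAt_const x (coeff n c)

theorem HasCoeffDerivAt.C {h : ℝ → ℝ} {h' : ℝ} (hh : HasDerivAt h h' x) :
    HasCoeffDerivAt (fun y => PowerSeries.C (h y)) (PowerSeries.C h') x := fun n => by
  cases n with
  | zero => simpa using hh
  | succ n => simpa [coeff_C] using hasDerivAt_const x (0 : ℝ)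

theorem HasCoeffDerivAt.unique (hf : HasCoeffDerivAt f f' x) (hg : HasCoeffDerivAt f g' x) :
    f' = g' := by
  ext n
  exact (hf n).unique (hg n)

theorem HasCoeffDerivAt.congr_deriv (hf : HasCoeffDerivAt f f' x) (h : f' = g') :
    HasCoeffDerivAt f g' x := h ▸ hf

theorem HasCoeffDerivAt.congr_of_eventuallyEq (hf : HasCoeffDerivAt f f' x)
    (h : ∀ᶠ y in nhds x, g y = f y) : HasCoeffDerivAt g f' x := fun n =>
  (hf n).congr_of_eventuallyEq (h.mono fun y hy => by simp only [hy])

/-- Coefficientwise derivative of a function whose values are vectors of formal power series. -/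
def HasVecDerivAt (f : ℝ → Fin 3 → PowerSeries ℝ) (f' : Fin 3 → PowerSeries ℝ) (x : ℝ) : Prop :=
  ∀ i, HasCoeffDerivAt (fun y => f y i) (f' i) x

variable {v w : ℝ → Fin 3 → PowerSeries ℝ} {v' w' : Fin 3 → PowerSeries ℝ}

theorem HasVecDerivAt.add (hv : HasVecDerivAt v v' x) (hw : HasVecDerivAt w w' x) :
    HasVecDerivAt (fun y => v y + w y) (v' + w') x := fun i => (hv i).add (hw i)

theorem HasVecDerivAt.dot (hv : HasVecDerivAt v v' x) (hw : HasVecDerivAt w w' x) :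
    HasCoeffDerivAt (fun y => v y ⬝ᵥ w y) (v' ⬝ᵥ w x + v x ⬝ᵥ w') x := by
  simp only [dot_eq]
  convert (((hv 0).mul (hw 0)).add ((hv 1).mul (hw 1))).add ((hv 2).mul (hw 2)) using 1
  ring

theorem HasVecDerivAt.cross (hv : HasVecDerivAt v v' x) (hw : HasVecDerivAt w w' x) :
    HasVecDerivAt (fun y => v y ⨯₃ w y) (v' ⨯₃ w x + v x ⨯₃ w') x := by
  intro i
  fin_cases i
  · refine HasCoeffDerivAt.congr_deriv (((hv 1).mul (hw 2)).sub ((hv 2).mul (hw 1))) ?_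
    simp only [Fin.zero_eta, Pi.add_apply, cross_zero]; ring
  · refine HasCoeffDerivAt.congr_deriv (((hv 2).mul (hw 0)).sub ((hv 0).mul (hw 2))) ?_
    simp only [Fin.mk_one, Pi.add_apply, cross_one]; ring
  · refine HasCoeffDerivAt.congr_deriv (((hv 0).mul (hw 1)).sub ((hv 1).mul (hw 0))) ?_
    simp only [Fin.reduceFinMk, Pi.add_apply, cross_two]; ring

theorem hasVecDerivAt_vecSeries {Y : ℕ → ℝ → R3} {Y' : ℕ → R3}
    (h : ∀ n, HasDerivAt (Y n) (Y' n) x) :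
    HasVecDerivAt (fun y => vecSeries fun n => Y n y) (vecSeries Y') x := fun i n => by
  simpa [vecSeries] using hasDerivAt_pi.1 (h n) i

/-- A vector as a vector of constant power series. -/
def constVec (v : R3) : Fin 3 → PowerSeries ℝ := fun i => PowerSeries.C (v i)

theorem hasVecDerivAt_constVec {Y : ℝ → R3} {Y' : R3} (h : HasDerivAt Y Y' x) :
    HasVecDerivAt (fun y => constVec (Y y)) (constVec Y') x := fun i =>
  HasCoeffDerivAt.C (hasDerivAt_pi.1 h i)

theorem constVec_dot_constVec (v w : R3) :
    constVec v ⬝ᵥ constVec w = PowerSeries.C (v ⬝ᵥ w) := by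
  simp [dot_eq, constVec]

theorem constVec_cross_constVec (v w : R3) : constVec v ⨯₃ constVec w = constVec (v ⨯₃ w) := by
  funext i
  fin_cases i <;> simp [constVec, cross_zero, cross_one, cross_two]

theorem C_smul_constVec (c : ℝ) (v : R3) : PowerSeries.C c • constVec v = constVec (c • v) := by
  funext i
  simp [constVec]

theorem C_smul_vecSeries (c : ℝ) (Y : ℕ → R3) :
    PowerSeries.C c • vecSeries Y = vecSeries fun n => c • Y n := by
  funext i
  ext n
  simp [vecSeries]

theorem coeff_constVec_dot_vecSeries (v : R3) (Y : ℕ → R3) (n : ℕ) :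
    coeff n (constVec v ⬝ᵥ vecSeries Y) = v ⬝ᵥ Y n := by
  simp [dot_eq, constVec, vecSeries]

theorem constVec_cross_vecSeries (v : R3) (Y : ℕ → R3) :
    constVec v ⨯₃ vecSeries Y = vecSeries fun n => v ⨯₃ Y n := by
  funext i
  ext n
  fin_cases i <;> simp [constVec, vecSeries, cross_zero, cross_one, cross_two]

end SeriesCalculus

/-! ### The geometric series and inverses -/

section Geometric
open Finset PowerSeries

theorem coeff_pow_eq_zero {g : PowerSeries ℝ} (hg : constantCoeff g = 0) {j n : ℕ}
    (h : n < j) : coeff n (g ^ j) = 0 :=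
  X_pow_dvd_iff.1 (pow_dvd_pow_of_dvd (X_dvd_iff.2 hg) j) n h

/-- The geometric series is the inverse of `1 + g`; for each coefficient a finite partial sum
suffices. -/
theorem one_add_mul_geomSeries {g : PowerSeries ℝ} (hg : constantCoeff g = 0) :
    (1 + g) * geomSeries g = 1 := by
  ext n
  have h1 : ∀ m ≤ n, coeff m (geomSeries g) = coeff m (∑ j ∈ range (n + 1), (-g) ^ j) := by
    intro m hm
    rw [geomSeries, coeff_mk, map_sum, ← sum_subset (range_mono (Nat.succ_le_succ hm))]
    · refine sum_congr rfl fun j _ => ?_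
      rw [neg_pow g, show (-1 : PowerSeries ℝ) = PowerSeries.C (-1) by simp, ← map_pow,
        coeff_C_mul]
    · intro j _ hj
      have hj : m < j := by simpa [Nat.lt_succ_iff] using hj
      exact coeff_pow_eq_zero (by rw [map_neg, hg, neg_zero]) hj
  have h2 : coeff n ((1 + g) * geomSeries g)
      = coeff n ((1 + g) * ∑ j ∈ range (n + 1), (-g) ^ j) := by
    rw [coeff_mul, coeff_mul]
    exact sum_congr rfl fun q hq => by
      rw [h1 q.2 (by have := mem_antidiagonal.1 hq; omega)]
  have h3 : (1 + g) * ∑ j ∈ range (n + 1), (-g) ^ j = 1 - (-g) ^ (n + 1) := by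
    have := mul_neg_geom_sum (-g) (n + 1)
    rwa [sub_neg_eq_add] at this
  rw [h2, h3, map_sub, coeff_pow_eq_zero (by rw [map_neg, hg, neg_zero]) (Nat.lt_succ_self n),
    sub_zero]

/-- Joint smoothness of all coefficients of a function with values in the power series. -/
def JointSmoothSeriesOn (U : Set (ℝ × ℝ)) (f : ℝ → ℝ → PowerSeries ℝ) : Prop :=
  ∀ n, JointSmoothOn U fun t s => coeff n (f t s)

variable {U : Set (ℝ × ℝ)} {f g : ℝ → ℝ → PowerSeries ℝ}

theorem JointSmoothSeriesOn.mul (hf : JointSmoothSeriesOn U f) (hg : JointSmoothSeriesOn U g) :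
    JointSmoothSeriesOn U fun t s => f t s * g t s := fun n => by
  simp only [coeff_mul]
  exact ContDiffOn.sum fun q _ => ContDiffOn.mul (hf q.1) (hg q.2)

theorem JointSmoothSeriesOn.neg (hf : JointSmoothSeriesOn U f) :
    JointSmoothSeriesOn U fun t s => -f t s := fun n => by
  simp only [map_neg]
  exact ContDiffOn.neg (hf n)

theorem JointSmoothSeriesOn.const (c : PowerSeries ℝ) :
    JointSmoothSeriesOn U fun _ _ => c := fun _ => contDiffOn_const

theorem JointSmoothSeriesOn.pow (hf : JointSmoothSeriesOn U f) (j : ℕ) :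
    JointSmoothSeriesOn U fun t s => f t s ^ j := by
  induction j with
  | zero => simpa using JointSmoothSeriesOn.const 1
  | succ j ih => simpa only [pow_succ] using ih.mul hf

theorem JointSmoothSeriesOn.geomSeries (hf : JointSmoothSeriesOn U f) :
    JointSmoothSeriesOn U fun t s => SpaceCurve.geomSeries (f t s) := fun n => by
  simp only [SpaceCurve.geomSeries, coeff_mk]
  exact ContDiffOn.sum fun j _ => contDiffOn_const.mul (hf.pow j n)

theorem JointSmoothSeriesOn.hasCoeffDerivAt_t (hf : JointSmoothSeriesOn U f) (hU : IsOpen U)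
    {t s : ℝ} (h : (t, s) ∈ U) :
    HasCoeffDerivAt (fun r => f r s)
      (PowerSeries.mk fun n => dT (fun t s => coeff n (f t s)) t s) t := fun n => by
  rw [coeff_mk]
  exact (hf n).hasDerivAt_t hU h

theorem JointSmoothSeriesOn.hasCoeffDerivAt_s (hf : JointSmoothSeriesOn U f) (hU : IsOpen U)
    {t s : ℝ} (h : (t, s) ∈ U) :
    HasCoeffDerivAt (f t)
      (PowerSeries.mk fun n => dS (fun t s => coeff n (f t s)) t s) s := fun n => by
  rw [coeff_mk]
  exact (hf n).hasDerivAt_s hU h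

theorem JointSmoothSeriesOn.dot_vecSeries {Y Z : ℕ → ℝ → ℝ → R3}
    (hY : ∀ n, JointSmoothOn U (Y n)) (hZ : ∀ n, JointSmoothOn U (Z n)) :
    JointSmoothSeriesOn U fun t s =>
      vecSeries (fun n => Y n t s) ⬝ᵥ vecSeries (fun n => Z n t s) := fun n => by
  simp only [coeff_dot_vecSeries]
  exact ContDiffOn.sum fun q _ => (hY q.1).dot (hZ q.2)

/-- The derivative of an inverse. Differentiability is a hypothesis here; for `inverseSeries` it is
known beforehand, as the coefficients are polynomials in smooth functions. -/
theorem HasCoeffDerivAt.of_mul_eq_one {q c : ℝ → PowerSeries ℝ} {q' c' : PowerSeries ℝ} {x : ℝ}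
    (hq : HasCoeffDerivAt q q' x) (hc : HasCoeffDerivAt c c' x)
    (h : ∀ᶠ y in nhds x, q y * c y = 1) : HasCoeffDerivAt q (-(q x ^ 2 * c')) x := by
  have h1 := (hq.mul hc).unique ((HasCoeffDerivAt.const 1).congr_of_eventuallyEq h)
  have h2 := h.self_of_nhds
  have h3 : q' = -(q x ^ 2 * c') := by
    linear_combination (q x) * h1 - q' * h2
  exact h3 ▸ hq

end Geometric

/-! ### The energy density and the formal area form -/

section Density
open Finset PowerSeries

/-- The formal unit vector field `Y = ∑ Y_n X^n` at the parameter `s`, where `X = λ⁻¹`. -/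
def hierarchySeries (γ : ℝ → R3) (s : ℝ) : Fin 3 → PowerSeries ℝ :=
  vecSeries fun n => flowY γ n s

/-- The series `∑_{l ≥ 2} ½ (T, Y_l) X^l`. -/
def normalizerSeries (γ : ℝ → R3) (s : ℝ) : PowerSeries ℝ :=
  PowerSeries.mk fun l => if 2 ≤ l then (1 / 2 : ℝ) * (tangent γ s ⬝ᵥ flowY γ l s) else 0

/-- The inverse of `1 + (T, Y)`. -/
def inverseSeries (γ : ℝ → R3) (s : ℝ) : PowerSeries ℝ :=
  PowerSeries.C (1 / 2 : ℝ) * geomSeries (normalizerSeries γ s)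

variable {γ : ℝ → R3} {s : ℝ}

theorem tangent_dot_flowY_one (h : deriv γ s ≠ 0) : tangent γ s ⬝ᵥ flowY γ 1 s = 0 := by
  rw [tangent_dot_flowY_succ h]; simp

theorem one_add_tangent_dot_hierarchySeries (h : deriv γ s ≠ 0) :
    1 + constVec (tangent γ s) ⬝ᵥ hierarchySeries γ s
      = PowerSeries.C (2 : ℝ) * (1 + normalizerSeries γ s) := by
  ext n
  rw [map_add, hierarchySeries, coeff_constVec_dot_vecSeries, coeff_C_mul, map_add,
    normalizerSeries, coeff_mk]
  match n with
  | 0 => simp [flowY_zero, tangent_dot_self h]; norm_num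
  | 1 => simp [tangent_dot_flowY_one h, coeff_one]
  | n + 2 => simp [coeff_one]

theorem inverseSeries_mul (h : deriv γ s ≠ 0) :
    inverseSeries γ s * (1 + constVec (tangent γ s) ⬝ᵥ hierarchySeries γ s) = 1 := by
  rw [one_add_tangent_dot_hierarchySeries h, inverseSeries, mul_mul_mul_comm, ← map_mul,
    mul_comm (geomSeries _), one_add_mul_geomSeries]
  · simp
  · simp [normalizerSeries]

theorem densitySeries_eq (h : deriv γ s ≠ 0) :
    densitySeries γ s = (constVec (flowY γ 1 s) ⬝ᵥ hierarchySeries γ s)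
      * geomSeries (normalizerSeries γ s) := by
  rw [densitySeries, normalizerSeries]
  congr 1
  ext n
  rw [coeff_mk, hierarchySeries, coeff_constVec_dot_vecSeries]
  cases n with
  | zero => simp [flowY_zero, dotProduct_comm (flowY γ 1 s), tangent_dot_flowY_one h]
  | succ n => simp [dotProduct_comm]

theorem half_densitySeries_eq (h : deriv γ s ≠ 0) :
    PowerSeries.C (1 / 2 : ℝ) * densitySeries γ s
      = inverseSeries γ s * (constVec (flowY γ 1 s) ⬝ᵥ hierarchySeries γ s) := by
  rw [densitySeries_eq h, inverseSeries]; ring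

theorem hierarchySeries_dot_self (h : deriv γ s ≠ 0) :
    hierarchySeries γ s ⬝ᵥ hierarchySeries γ s = 1 := by
  ext n
  rw [hierarchySeries, coeff_dot_vecSeries, coeff_one]
  exact sum_flowY_dot_flowY h n

theorem constVec_tangent_dot_self (h : deriv γ s ≠ 0) :
    constVec (tangent γ s) ⬝ᵥ constVec (tangent γ s) = 1 := by
  rw [constVec_dot_constVec, tangent_dot_self h, map_one]

/-- The one-form `-(T × Y, dT + dY) / (1 + (T, Y))`, evaluated on a direction in which `T` and the
`Y_n` have the derivatives `a` and `Y' n`. -/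
def areaForm (γ : ℝ → R3) (s : ℝ) (a : R3) (Y' : ℕ → R3) : PowerSeries ℝ :=
  -(inverseSeries γ s * ((constVec (tangent γ s) ⨯₃ hierarchySeries γ s)
    ⬝ᵥ (constVec a + vecSeries Y')))

end Density

/-! ### First variation of the energy density -/

section Hamiltonian
open Finset PowerSeries
variable {U : Set (ℝ × ℝ)} {Γ : ℝ → ℝ → R3} {t s : ℝ}

/-- The relation `X Y˙ = - |γ̇| T × Y`. -/
theorem ImmersedFamily.X_smul_dS_hierarchy (hΓ : ImmersedFamily U Γ) (h : (t, s) ∈ U) :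
    (X : PowerSeries ℝ) • vecSeries (fun n => dS (fun t s => SpaceCurve.flowY (Γ t) n s) t s)
      = -(PowerSeries.C (SpaceCurve.speed (Γ t) s) •
        (constVec (SpaceCurve.tangent (Γ t) s) ⨯₃ hierarchySeries (Γ t) s)) := by
  rw [hierarchySeries, constVec_cross_vecSeries, C_smul_vecSeries]
  funext i
  ext n
  cases n with
  | zero => simp [vecSeries, flowY_zero]
  | succ n =>
    simp only [Pi.smul_apply, smul_eq_mul, coeff_succ_X_mul, vecSeries, coeff_mk, Pi.neg_apply,
      map_neg]
    rw [dS, hΓ.deriv_flowY n h, Pi.neg_apply, Pi.smul_apply, smul_eq_mul]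

theorem ImmersedFamily.speed_smul_flowY_one (hΓ : ImmersedFamily U Γ) (h : (t, s) ∈ U) :
    SpaceCurve.speed (Γ t) s • SpaceCurve.flowY (Γ t) 1 s
      = SpaceCurve.tangent (Γ t) s ⨯₃ dS (fun t s => SpaceCurve.tangent (Γ t) s) t s := by
  have h1 := hΓ.deriv_flowY 0 h
  rw [flowY_zero] at h1
  have h2 : SpaceCurve.flowY (Γ t) 1 s
      = SpaceCurve.tangent (Γ t) s ⨯₃ SpaceCurve.arcDeriv (Γ t) (SpaceCurve.tangent (Γ t)) s := by
    rw [flowY_succ, flowY_zero]; simp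
  rw [h2, ← map_smul, speed_smul_arcDeriv (hΓ.immersed t s h)]
  rfl

theorem ImmersedFamily.tangent_dot_dS (hΓ : ImmersedFamily U Γ) (h : (t, s) ∈ U) :
    SpaceCurve.tangent (Γ t) s ⬝ᵥ dS (fun t s => SpaceCurve.tangent (Γ t) s) t s = 0 := by
  have := hΓ.sum_deriv_flowY_dot 0 h
  simpa [flowY_zero, dotProduct_comm, dS] using this

theorem ImmersedFamily.eventually_t (hΓ : ImmersedFamily U Γ) (h : (t, s) ∈ U) :
    ∀ᶠ r in nhds t, (r, s) ∈ U :=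
  (Continuous.tendsto (f := fun r : ℝ => (r, s)) (by fun_prop) t).eventually
    (hΓ.isOpen.mem_nhds h)

theorem ImmersedFamily.eventually_s (hΓ : ImmersedFamily U Γ) (h : (t, s) ∈ U) :
    ∀ᶠ r in nhds s, (t, r) ∈ U :=
  (Continuous.tendsto (f := fun r : ℝ => (t, r)) (by fun_prop) s).eventually
    (hΓ.isOpen.mem_nhds h)

theorem ImmersedFamily.tangent_dot_dT (hΓ : ImmersedFamily U Γ) (h : (t, s) ∈ U) :
    SpaceCurve.tangent (Γ t) s ⬝ᵥ dT (fun t s => SpaceCurve.tangent (Γ t) s) t s = 0 := by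
  have h1 := hΓ.tangent.hasDerivAt_t hΓ.isOpen h
  have h2 := HasDerivAt.dot h1 h1
  have h3 := h2.unique ((hasDerivAt_const t (1 : ℝ)).congr_of_eventuallyEq
    ((hΓ.eventually_t h).mono fun r hr => tangent_dot_self (hΓ.immersed r s hr)))
  rw [dotProduct_comm] at h3
  linarith

/-- The energy density, multiplied by the length element, in terms of the area form: this is the
point where the length, the formal monodromy angle and the spherical area between `T` and `Y`
combine. -/
theorem ImmersedFamily.X_mul_density (hΓ : ImmersedFamily U Γ) (h : (t, s) ∈ U) :
    X * (PowerSeries.C (SpaceCurve.speed (Γ t) s)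
        * (PowerSeries.C (1 / 2 : ℝ) * densitySeries (Γ t) s))
      = X * areaForm (Γ t) s (dS (fun t s => SpaceCurve.tangent (Γ t) s) t s)
          (fun n => dS (fun t s => SpaceCurve.flowY (Γ t) n s) t s)
        + constVec (dS Γ t s) ⬝ᵥ hierarchySeries (Γ t) s
        - PowerSeries.C (SpaceCurve.speed (Γ t) s) := by
  have him := hΓ.immersed t s h
  have h1 := hΓ.X_smul_dS_hierarchy h
  have h2 : PowerSeries.C (SpaceCurve.speed (Γ t) s) • constVec (SpaceCurve.flowY (Γ t) 1 s)
      = constVec (SpaceCurve.tangent (Γ t) s)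
        ⨯₃ constVec (dS (fun t s => SpaceCurve.tangent (Γ t) s) t s) := by
    rw [C_smul_constVec, hΓ.speed_smul_flowY_one h, constVec_cross_constVec]
  have h3 : constVec (dS Γ t s) = PowerSeries.C (SpaceCurve.speed (Γ t) s) •
      constVec (SpaceCurve.tangent (Γ t) s) := by
    rw [C_smul_constVec, speed_smul_tangent him]; rfl
  have hq := inverseSeries_mul him
  have hu := hierarchySeries_dot_self him
  have hT := constVec_tangent_dot_self him
  rw [half_densitySeries_eq him, areaForm, h3]
  set v := PowerSeries.C (SpaceCurve.speed (Γ t) s)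
  set T := constVec (SpaceCurve.tangent (Γ t) s)
  set u := hierarchySeries (Γ t) s
  set q := inverseSeries (Γ t) s
  set a := constVec (dS (fun t s => SpaceCurve.tangent (Γ t) s) t s)
  set m := vecSeries fun n => dS (fun t s => SpaceCurve.flowY (Γ t) n s) t s
  have e1 : v * (constVec (SpaceCurve.flowY (Γ t) 1 s) ⬝ᵥ u) = (T ⨯₃ a) ⬝ᵥ u := by
    rw [← h2, smul_dotProduct, smul_eq_mul]
  have e2 : X * ((T ⨯₃ u) ⬝ᵥ m) = -(v * ((T ⨯₃ u) ⬝ᵥ (T ⨯₃ u))) := by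
    rw [← smul_eq_mul, ← dotProduct_smul, h1, dotProduct_neg, dotProduct_smul, smul_eq_mul]
  have e3 : (T ⨯₃ u) ⬝ᵥ (T ⨯₃ u) = 1 - (T ⬝ᵥ u) ^ 2 := by
    rw [cross_dot_cross, hT, hu, dotProduct_comm u T]; ring
  have e4 : (T ⨯₃ u) ⬝ᵥ a = -((T ⨯₃ a) ⬝ᵥ u) := by
    simp only [dot_eq, cross_zero, cross_one, cross_two]; ring
  rw [dotProduct_add, smul_dotProduct, smul_eq_mul]
  rw [e3] at e2
  linear_combination X * q * e1 + q * e2 + X * q * e4 - v * (1 - T ⬝ᵥ u) * hq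

theorem ImmersedFamily.jointSmooth_inverseSeries (hΓ : ImmersedFamily U Γ) :
    JointSmoothSeriesOn U fun t s => inverseSeries (Γ t) s := by
  refine (JointSmoothSeriesOn.const _).mul (JointSmoothSeriesOn.geomSeries fun n => ?_)
  simp only [normalizerSeries, coeff_mk]
  split_ifs
  · exact contDiffOn_const.mul (hΓ.tangent.dot (hΓ.flowY n))
  · exact contDiffOn_const

theorem ImmersedFamily.hasVecDerivAt_hierarchySeries_t (hΓ : ImmersedFamily U Γ)
    (h : (t, s) ∈ U) : HasVecDerivAt (fun r => hierarchySeries (Γ r) s)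
      (vecSeries fun n => dT (fun t s => SpaceCurve.flowY (Γ t) n s) t s) t :=
  hasVecDerivAt_vecSeries fun n => (hΓ.flowY n).hasDerivAt_t hΓ.isOpen h

theorem ImmersedFamily.hasVecDerivAt_hierarchySeries_s (hΓ : ImmersedFamily U Γ)
    (h : (t, s) ∈ U) : HasVecDerivAt (fun r => hierarchySeries (Γ t) r)
      (vecSeries fun n => dS (fun t s => SpaceCurve.flowY (Γ t) n s) t s) s :=
  hasVecDerivAt_vecSeries fun n => (hΓ.flowY n).hasDerivAt_s hΓ.isOpen h

theorem ImmersedFamily.hasCoeffDerivAt_inverseSeries_t (hΓ : ImmersedFamily U Γ)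
    (h : (t, s) ∈ U) : HasCoeffDerivAt (fun r => inverseSeries (Γ r) s)
      (-(inverseSeries (Γ t) s ^ 2 *
        (constVec (dT (fun t s => SpaceCurve.tangent (Γ t) s) t s) ⬝ᵥ hierarchySeries (Γ t) s
          + constVec (SpaceCurve.tangent (Γ t) s)
            ⬝ᵥ vecSeries fun n => dT (fun t s => SpaceCurve.flowY (Γ t) n s) t s))) t := by
  have h1 := (HasCoeffDerivAt.const (x := t) 1).add
    ((hasVecDerivAt_constVec (hΓ.tangent.hasDerivAt_t hΓ.isOpen h)).dot
      (hΓ.hasVecDerivAt_hierarchySeries_t h))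
  rw [zero_add] at h1
  exact HasCoeffDerivAt.of_mul_eq_one
    (hΓ.jointSmooth_inverseSeries.hasCoeffDerivAt_t hΓ.isOpen h) h1
    ((hΓ.eventually_t h).mono fun r hr => inverseSeries_mul (hΓ.immersed r s hr))

theorem ImmersedFamily.hasCoeffDerivAt_inverseSeries_s (hΓ : ImmersedFamily U Γ)
    (h : (t, s) ∈ U) : HasCoeffDerivAt (fun r => inverseSeries (Γ t) r)
      (-(inverseSeries (Γ t) s ^ 2 *
        (constVec (dS (fun t s => SpaceCurve.tangent (Γ t) s) t s) ⬝ᵥ hierarchySeries (Γ t) s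
          + constVec (SpaceCurve.tangent (Γ t) s)
            ⬝ᵥ vecSeries fun n => dS (fun t s => SpaceCurve.flowY (Γ t) n s) t s))) s := by
  have h1 := (HasCoeffDerivAt.const (x := s) 1).add
    ((hasVecDerivAt_constVec (hΓ.tangent.hasDerivAt_s hΓ.isOpen h)).dot
      (hΓ.hasVecDerivAt_hierarchySeries_s h))
  rw [zero_add] at h1
  exact HasCoeffDerivAt.of_mul_eq_one
    (hΓ.jointSmooth_inverseSeries.hasCoeffDerivAt_s hΓ.isOpen h) h1
    ((hΓ.eventually_s h).mono fun r hr => inverseSeries_mul (hΓ.immersed t r hr))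

/-- The area form in the direction of the variation. -/
def variationForm (Γ : ℝ → ℝ → R3) (t s : ℝ) : PowerSeries ℝ :=
  areaForm (Γ t) s (dT (fun t s => tangent (Γ t) s) t s)
    (fun n => dT (fun t s => flowY (Γ t) n s) t s)

theorem ImmersedFamily.hasCoeffDerivAt_variationForm (hΓ : ImmersedFamily U Γ)
    (h : (t, s) ∈ U) : HasCoeffDerivAt (fun r => variationForm Γ t r)
      (PowerSeries.mk fun n => dS (fun t s => coeff n (variationForm Γ t s)) t s) s := by
  have hs : JointSmoothSeriesOn U (variationForm Γ) := by
    have h1 : ∀ n, JointSmoothOn U fun t s =>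
        SpaceCurve.tangent (Γ t) s ⨯₃ SpaceCurve.flowY (Γ t) n s :=
      fun n => hΓ.tangent.cross (hΓ.flowY n)
    have h2 : ∀ n, JointSmoothOn U fun t s => (if n = 0 then
        dT (fun t s => SpaceCurve.tangent (Γ t) s) t s else 0)
        + dT (fun t s => SpaceCurve.flowY (Γ t) n s) t s := fun n => by
      refine ContDiffOn.add ?_ ((hΓ.flowY n).dT hΓ.isOpen)
      split_ifs
      · exact hΓ.tangent.dT hΓ.isOpen
      · exact contDiffOn_const
    have h3 := (hΓ.jointSmooth_inverseSeries.mul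
      (JointSmoothSeriesOn.dot_vecSeries h1 h2)).neg
    convert h3 using 5 with t s
    rw [variationForm, areaForm, hierarchySeries, constVec_cross_vecSeries]
    congr 3
    funext i
    ext n
    by_cases hn : n = 0 <;> simp [constVec, vecSeries, coeff_C, hn]
  exact hs.hasCoeffDerivAt_s hΓ.isOpen h

/-- The variation of the energy density: up to the derivative of a periodic function it is the
pairing of `Y_{n+1}` with the variation of the velocity. One differentiates
`ImmersedFamily.X_mul_density` and exchanges the two partial derivatives of the area form by means
of `area_form_identity`. For `n = 0` there would be a further term, the area form of `T`. -/
theorem ImmersedFamily.dT_coeff_density (hΓ : ImmersedFamily U Γ) (h : (t, s) ∈ U) {n : ℕ}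
    (hn : n ≠ 0) :
    dT (fun t s => coeff n (PowerSeries.C (SpaceCurve.speed (Γ t) s)
        * (PowerSeries.C (1 / 2 : ℝ) * densitySeries (Γ t) s))) t s
      = dT (dS Γ) t s ⬝ᵥ SpaceCurve.flowY (Γ t) (n + 1) s
        + dS (fun t s => coeff n (variationForm Γ t s)) t s := by
  have him := hΓ.immersed t s h
  have hX := hΓ.X_smul_dS_hierarchy h
  have hq := inverseSeries_mul him
  have hu := hierarchySeries_dot_self him
  have hTT := constVec_tangent_dot_self him
  have hta : constVec (SpaceCurve.tangent (Γ t) s)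
      ⬝ᵥ constVec (dS (fun t s => SpaceCurve.tangent (Γ t) s) t s) = 0 := by
    rw [constVec_dot_constVec, hΓ.tangent_dot_dS h, map_zero]
  have htb : constVec (SpaceCurve.tangent (Γ t) s)
      ⬝ᵥ constVec (dT (fun t s => SpaceCurve.tangent (Γ t) s) t s) = 0 := by
    rw [constVec_dot_constVec, hΓ.tangent_dot_dT h, map_zero]
  have hum : hierarchySeries (Γ t) s
      ⬝ᵥ vecSeries (fun n => dS (fun t s => SpaceCurve.flowY (Γ t) n s) t s) = 0 := by
    ext k
    have := hΓ.sum_deriv_flowY_dot k h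
    rw [dotProduct_comm, hierarchySeries, coeff_dot_vecSeries, map_zero]
    exact this
  have hun : hierarchySeries (Γ t) s
      ⬝ᵥ vecSeries (fun n => dT (fun t s => SpaceCurve.flowY (Γ t) n s) t s) = 0 := by
    have h1 := (hΓ.hasVecDerivAt_hierarchySeries_t h).dot (hΓ.hasVecDerivAt_hierarchySeries_t h)
    have h2 := h1.unique ((HasCoeffDerivAt.const 1).congr_of_eventuallyEq
      ((hΓ.eventually_t h).mono fun r hr => hierarchySeries_dot_self (hΓ.immersed r s hr)))
    rw [dotProduct_comm (vecSeries _), ← two_mul] at h2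
    have h3 : (PowerSeries.C (2 : ℝ)) * (hierarchySeries (Γ t) s
      ⬝ᵥ vecSeries (fun n => dT (fun t s => SpaceCurve.flowY (Γ t) n s) t s)) = 0 := by
      rw [← h2]; congr 1
    ext k
    have h4 := congrArg (coeff k) h3
    rw [coeff_C_mul, map_zero] at h4
    simpa using h4
  -- second derivatives
  have dTt := hΓ.tangent.hasDerivAt_dS_t hΓ.isOpen h
  have dTs := (hΓ.tangent.dT hΓ.isOpen).hasDerivAt_s hΓ.isOpen h
  rw [← hΓ.tangent.dT_dS hΓ.isOpen h] at dTs
  have dYt := fun n => (hΓ.flowY n).hasDerivAt_dS_t hΓ.isOpen h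
  have dYs := fun n => ((hΓ.flowY n).dT hΓ.isOpen).hasDerivAt_s hΓ.isOpen h
  simp only [← fun n => (hΓ.flowY n).dT_dS hΓ.isOpen h] at dYs
  -- the two derivatives of the area form
  have f1 := ((hΓ.hasCoeffDerivAt_inverseSeries_t h).mul
    (((hasVecDerivAt_constVec (hΓ.tangent.hasDerivAt_t hΓ.isOpen h)).cross
      (hΓ.hasVecDerivAt_hierarchySeries_t h)).dot
      ((hasVecDerivAt_constVec dTt).add (hasVecDerivAt_vecSeries dYt)))).neg
  have f2 := ((hΓ.hasCoeffDerivAt_inverseSeries_s h).mul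
    (((hasVecDerivAt_constVec (hΓ.tangent.hasDerivAt_s hΓ.isOpen h)).cross
      (hΓ.hasVecDerivAt_hierarchySeries_s h)).dot
      ((hasVecDerivAt_constVec dTs).add (hasVecDerivAt_vecSeries dYs)))).neg
  have f2' := f2.unique (hΓ.hasCoeffDerivAt_variationForm h)
  have f3 := (((HasCoeffDerivAt.const X).mul f1).add
    ((hasVecDerivAt_constVec (hΓ.smooth.hasDerivAt_dS_t hΓ.isOpen h)).dot
      (hΓ.hasVecDerivAt_hierarchySeries_t h))).sub
    (HasCoeffDerivAt.C (hΓ.speed.hasDerivAt_t hΓ.isOpen h))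
  have f4 := f3.congr_of_eventuallyEq
    ((hΓ.eventually_t h).mono fun r hr => hΓ.X_mul_density hr)
  have f5 := f4 (n + 1)
  simp only [coeff_succ_X_mul] at f5
  have f6 := f5.deriv
  rw [dT, f6]
  have h3 : constVec (dS Γ t s) = PowerSeries.C (SpaceCurve.speed (Γ t) s) •
      constVec (SpaceCurve.tangent (Γ t) s) := by
    rw [C_smul_constVec, speed_smul_tangent him]; rfl
  have key := area_form_identity (constVec (SpaceCurve.tangent (Γ t) s)) (hierarchySeries (Γ t) s)
    (constVec (dS (fun t s => SpaceCurve.tangent (Γ t) s) t s))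
    (constVec (dT (fun t s => SpaceCurve.tangent (Γ t) s) t s))
    (vecSeries fun n => dS (fun t s => SpaceCurve.flowY (Γ t) n s) t s)
    (vecSeries fun n => dT (fun t s => SpaceCurve.flowY (Γ t) n s) t s)
    (inverseSeries (Γ t) s) hq hTT hu hta htb hum hun
  have hD : coeff n (PowerSeries.mk fun n => dS (fun t s => coeff n (variationForm Γ t s)) t s)
      = dS (fun t s => coeff n (variationForm Γ t s)) t s := coeff_mk _ _
  rw [← hD, ← f2']
  clear f1 f2 f3 f4 f5 f6 hD f2' dTs dYs
  have hG : coeff (n + 1) (constVec (dT (dS Γ) t s) ⬝ᵥ hierarchySeries (Γ t) s)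
      = dT (dS Γ) t s ⬝ᵥ SpaceCurve.flowY (Γ t) (n + 1) s := by
    rw [hierarchySeries, coeff_constVec_dot_vecSeries]
  -- the variations of the length element and the area form of `T` are constant series and do not
  -- contribute to the coefficients in question
  have hv0 : coeff (n + 1)
      (PowerSeries.C (dT (fun t s => SpaceCurve.speed (Γ t) s) t s)) = 0 := by
    simp
  have hab0 : coeff n (constVec (SpaceCurve.tangent (Γ t) s)
      ⬝ᵥ (constVec (dS (fun t s => SpaceCurve.tangent (Γ t) s) t s)
        ⨯₃ constVec (dT (fun t s => SpaceCurve.tangent (Γ t) s) t s))) = 0 := by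
    rw [constVec_cross_constVec, constVec_dot_constVec, coeff_C, if_neg hn]
  rw [← hG, ← sub_zero (_ + _ : ℝ), ← hab0, ← sub_zero (_ - _ : ℝ), ← hv0, ← coeff_succ_X_mul n,
    ← coeff_succ_X_mul n (_ ⬝ᵥ _), ← map_add, ← map_sub, ← map_sub]
  congr 1
  rw [h3]
  set v := PowerSeries.C (SpaceCurve.speed (Γ t) s)
  set T := constVec (SpaceCurve.tangent (Γ t) s)
  set u := hierarchySeries (Γ t) s
  set m := vecSeries fun n => dS (fun t s => SpaceCurve.flowY (Γ t) n s) t s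
  set k := vecSeries fun n => dT (fun t s => SpaceCurve.flowY (Γ t) n s) t s
  -- the area form of `Y`, evaluated by means of the equation for its derivative along the curve
  have e : (X : PowerSeries ℝ) * (u ⬝ᵥ (m ⨯₃ k)) = -(v * (T ⬝ᵥ k)) := by
    have e1 : u ⬝ᵥ (((X : PowerSeries ℝ) • m) ⨯₃ k) = X * (u ⬝ᵥ (m ⨯₃ k)) := by
      rw [map_smul, LinearMap.smul_apply, dotProduct_smul, smul_eq_mul]
    rw [← e1, hX, map_neg, map_smul, LinearMap.neg_apply, LinearMap.smul_apply,
      cross_cross_eq_smul_sub_smul, hun, zero_smul, sub_zero, dotProduct_neg, dotProduct_smul,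
      dotProduct_smul, hu]
    simp
  rw [smul_dotProduct, smul_eq_mul]
  linear_combination X * key + e

end Hamiltonian

/-! ### The first Hamiltonians -/

section Values
open PowerSeries

variable (x₀ p : ℝ) (γ : ℝ → R3) (e₂ : ℝ)

theorem hamiltonian_zero : hamiltonian x₀ p γ e₂ 0 = 0 := by
  simp [hamiltonian, hamiltonianSeries, coeff_zero_eq_constantCoeff]

theorem hamiltonian_one : hamiltonian x₀ p γ e₂ 1 = arcIntegral x₀ p γ fun _ => 1 := by
  simp [hamiltonian, hamiltonianSeries, coeff_X_pow_mul', coeff_X_pow, coeff_C_mul]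

theorem hamiltonian_add_two (n : ℕ) : hamiltonian x₀ p γ e₂ (n + 2)
    = (if n = 0 then e₂ else 0)
      + (1 / 2 : ℝ) * arcIntegral x₀ p γ fun s => coeff n (densitySeries γ s) := by
  simp only [hamiltonian, hamiltonianSeries, map_add, coeff_C_mul, coeff_X, coeff_X_pow,
    coeff_X_pow_mul, coeff_mk]
  by_cases hn : n = 0 <;> simp [hn]

variable {γ}

theorem coeff_zero_densitySeries (s : ℝ) :
    coeff 0 (densitySeries γ s) = 0 := by
  simp [densitySeries]

theorem hamiltonian_two : hamiltonian x₀ p γ e₂ 2 = e₂ := by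
  rw [hamiltonian_add_two x₀ p γ e₂ 0]
  simp only [coeff_zero_densitySeries, arcIntegral]
  simp

theorem hamiltonian_eq_integral {n : ℕ} (hn : n ≠ 0) : hamiltonian x₀ p γ e₂ (n + 2)
    = ∫ s in x₀..(x₀ + p), coeff n (PowerSeries.C (speed γ s)
        * (PowerSeries.C (1 / 2 : ℝ) * densitySeries γ s)) := by
  rw [hamiltonian_add_two, if_neg hn, zero_add, arcIntegral,
    ← intervalIntegral.integral_const_mul]
  refine intervalIntegral.integral_congr fun s _ => ?_
  simp only [coeff_C_mul]
  ring

end Values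

/-! ### The Marsden–Weinstein form -/

section Symplectic
variable {p : ℝ} {A : Matrix (Fin 3) (Fin 3) ℝ} {a : R3} {γ : ℝ → R3}

theorem integral_deriv_eq_zero {f f' : ℝ → ℝ} (x₀ : ℝ) (hf : ∀ s, HasDerivAt f (f' s) s)
    (hc : Continuous f') (hp : f (x₀ + p) = f x₀) : ∫ s in x₀..(x₀ + p), f' s = 0 := by
  rw [intervalIntegral.integral_eq_sub_of_hasDerivAt (fun s _ => hf s)
    (hc.intervalIntegrable _ _), hp, sub_self]

/-- Integration by parts: the form `σ(Y_{k+1}, ξ)` is the pairing of `Y_k` with `ξ'`. -/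
theorem sigma_flowY_succ (hA : A ∈ Matrix.specialOrthogonalGroup (Fin 3) ℝ)
    (hγ : γ ∈ curveSpace p A a) (x₀ : ℝ) (k : ℕ) {ξ : ℝ → R3} (hξ : ξ ∈ tangentSpace p A) :
    sigma x₀ p γ (flowY γ (k + 1)) ξ
      = ∫ s in x₀..(x₀ + p), flowY γ k s ⬝ᵥ deriv ξ s := by
  have hY := contDiff_flowY hγ k
  have hdY : ContDiff ℝ ∞ (deriv (flowY γ k)) := (contDiff_infty_iff_deriv.1 hY).2
  have hdξ : ContDiff ℝ ∞ (deriv ξ) := (contDiff_infty_iff_deriv.1 hξ.1).2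
  have h1 : ∀ s, HasDerivAt (fun r => flowY γ k r ⬝ᵥ ξ r)
      (deriv (flowY γ k) s ⬝ᵥ ξ s + flowY γ k s ⬝ᵥ deriv ξ s) s := fun s =>
    HasDerivAt.dot ((hY.differentiable (by simp)) s).hasDerivAt
      ((hξ.1.differentiable (by simp)) s).hasDerivAt
  have c1 : Continuous fun s => deriv (flowY γ k) s ⬝ᵥ ξ s := (ContDiff.dot hdY hξ.1).continuous
  have c2 : Continuous fun s => flowY γ k s ⬝ᵥ deriv ξ s := (ContDiff.dot hY hdξ).continuous
  have h2 := integral_deriv_eq_zero x₀ h1 (c1.add c2)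
    (by rw [flowY_equivariant hA hγ, hξ.2, mulVec_dot_mulVec hA])
  rw [intervalIntegral.integral_add (c1.intervalIntegrable _ _) (c2.intervalIntegrable _ _)] at h2
  have h3 : sigma x₀ p γ (flowY γ (k + 1)) ξ
      = -∫ s in x₀..(x₀ + p), deriv (flowY γ k) s ⬝ᵥ ξ s := by
    rw [sigma, ← intervalIntegral.integral_neg]
    refine intervalIntegral.integral_congr fun s _ => ?_
    simp only [det3_eq]
    rw [(hasDerivAt_flowY hγ k s).deriv, ← speed_smul_tangent (hγ.2.1 s), neg_dotProduct, neg_neg,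
      ← cross_dot_eq, map_smul, LinearMap.smul_apply]
  rw [h3]
  linarith

theorem sigma_flowY_zero (hγ : γ ∈ curveSpace p A a) (x₀ : ℝ) (ξ : ℝ → R3) :
    sigma x₀ p γ (flowY γ 0) ξ = 0 := by
  have : ∀ s, det3 (deriv γ s) (flowY γ 0 s) (ξ s) = 0 := fun s => by
    rw [det3_eq, ← speed_smul_tangent (hγ.2.1 s), flowY_zero, ← cross_dot_eq, map_smul,
      LinearMap.smul_apply, cross_self]
    simp
  simp [sigma, this]

end Symplectic

/-! ### Equivariant variations and the higher Hamiltonians -/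

section Variations
open PowerSeries
variable {p ε : ℝ} {A : Matrix (Fin 3) (Fin 3) ℝ} {a : R3} {γ : ℝ → R3} {Γ : ℝ → ℝ → R3}

theorem IsVariation.immersedFamily (h : IsVariation p A a γ ε Γ) :
    ImmersedFamily (strip ε) Γ :=
  ⟨isOpen_strip ε, h.smooth, fun t s hts => (h.mem t (mem_strip.1 hts)).2.1 s⟩

theorem IsVariation.zero_mem (h : IsVariation p A a γ ε Γ) (s : ℝ) : ((0 : ℝ), s) ∈ strip ε :=
  mem_strip.2 ⟨by linarith [h.eps_pos], h.eps_pos⟩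

theorem IsVariation.eventually_mem (h : IsVariation p A a γ ε Γ) :
    ∀ᶠ t in nhds (0 : ℝ), t ∈ Set.Ioo (-ε) ε :=
  Ioo_mem_nhds (by linarith [h.eps_pos]) h.eps_pos

/-- Variational derivatives inherit the equivariance under the monodromy. -/
theorem IsVariation.dT_equivariant (h : IsVariation p A a γ ε Γ) {f : ℝ → ℝ → R3} (c : R3)
    (hf : JointSmoothOn (strip ε) f)
    (hp : ∀ t ∈ Set.Ioo (-ε) ε, ∀ s, f t (s + p) = A *ᵥ f t s + c) (s : ℝ) :
    dT f 0 (s + p) = A *ᵥ dT f 0 s := by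
  have h1 := hf.hasDerivAt_t (isOpen_strip ε) (h.zero_mem (s + p))
  have h2 := (HasDerivAt.mulVec A (hf.hasDerivAt_t (isOpen_strip ε) (h.zero_mem s))).add_const c
  exact h1.unique (h2.congr_of_eventuallyEq (h.eventually_mem.mono fun t ht => hp t ht s))

theorem IsVariation.velocity_mem (h : IsVariation p A a γ ε Γ) :
    velocity Γ ∈ tangentSpace p A :=
  ⟨(h.immersedFamily.smooth.dT (isOpen_strip ε)).contDiff_s h.zero_mem,
    h.dT_equivariant a h.immersedFamily.smooth fun t ht => (h.mem t ht).2.2⟩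

theorem IsVariation.dT_dS_eq_deriv (h : IsVariation p A a γ ε Γ) (s : ℝ) :
    dT (dS Γ) 0 s = deriv (velocity Γ) s :=
  h.immersedFamily.smooth.dT_dS (isOpen_strip ε) (h.zero_mem s)

theorem inverseSeries_periodic (hA : A ∈ Matrix.specialOrthogonalGroup (Fin 3) ℝ)
    (hγ : γ ∈ curveSpace p A a) (s : ℝ) : inverseSeries γ (s + p) = inverseSeries γ s := by
  simp only [inverseSeries, normalizerSeries, tangent_equivariant hA hγ,
    flowY_equivariant hA hγ, mulVec_dot_mulVec hA]

theorem IsVariation.variationForm_periodic (hA : A ∈ Matrix.specialOrthogonalGroup (Fin 3) ℝ)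
    (h : IsVariation p A a γ ε Γ) (s : ℝ) :
    variationForm Γ 0 (s + p) = variationForm Γ 0 s := by
  have hγ : Γ 0 ∈ curveSpace p A a := h.mem 0 (mem_strip.1 (h.zero_mem 0))
  have e1 := h.dT_equivariant 0 h.immersedFamily.tangent fun t ht s => by
    rw [tangent_equivariant hA (h.mem t ht), add_zero]
  have e2 := fun n => h.dT_equivariant 0 (h.immersedFamily.flowY n) fun t ht s => by
    rw [flowY_equivariant hA (h.mem t ht), add_zero]
  simp only [variationForm, areaForm, inverseSeries_periodic hA hγ, hierarchySeries,
    constVec_cross_vecSeries, dotProduct_add]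
  congr 3
  · ext n
    rw [dotProduct_comm, dotProduct_comm _ (constVec _), coeff_constVec_dot_vecSeries,
      coeff_constVec_dot_vecSeries, e1, tangent_equivariant hA hγ, flowY_equivariant hA hγ,
      mulVec_cross_mulVec hA, mulVec_dot_mulVec hA]
  · ext n
    rw [coeff_dot_vecSeries, coeff_dot_vecSeries]
    refine Finset.sum_congr rfl fun q _ => ?_
    rw [e2, tangent_equivariant hA hγ, flowY_equivariant hA hγ,
      mulVec_cross_mulVec hA, mulVec_dot_mulVec hA]

theorem JointSmoothOn.coeff_density {U : Set (ℝ × ℝ)} (hΓ : ImmersedFamily U Γ) (n : ℕ) :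
    JointSmoothOn U fun t s => coeff n (PowerSeries.C (speed (Γ t) s)
        * (PowerSeries.C (1 / 2 : ℝ) * densitySeries (Γ t) s)) := by
  have h1 : JointSmoothSeriesOn U fun t s =>
      inverseSeries (Γ t) s * (constVec (flowY (Γ t) 1 s) ⬝ᵥ hierarchySeries (Γ t) s) :=
    hΓ.jointSmooth_inverseSeries.mul fun n => by
      simp only [hierarchySeries, coeff_constVec_dot_vecSeries]
      exact (hΓ.flowY 1).dot (hΓ.flowY n)
  simp only [fun t s =>
    coeff_C_mul n (PowerSeries.C (1 / 2 : ℝ) * densitySeries (Γ t) s) (speed (Γ t) s)]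
  refine hΓ.speed.mul ((h1 n).congr fun q hq => ?_)
  simp only [half_densitySeries_eq (hΓ.immersed q.1 q.2 hq)]

/-- The higher `E_k` are Hamiltonians: in the variation of the density the exact term integrates to
zero by periodicity, and the remaining one is the symplectic form by `sigma_flowY_succ`. -/
theorem IsVariation.hasDerivAt_hamiltonian_add_two
    (hA : A ∈ Matrix.specialOrthogonalGroup (Fin 3) ℝ) (h : IsVariation p A a γ ε Γ) (x₀ : ℝ)
    (α : ℝ → ℝ) {n : ℕ} (hn : n ≠ 0) :
    HasDerivAt (fun t => hamiltonian x₀ p (Γ t) (α t) (n + 2))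
      (sigma x₀ p γ (flowY γ (n + 2)) (velocity Γ)) 0 := by
  have hγ : γ ∈ curveSpace p A a := h.start ▸ h.mem 0 (mem_strip.1 (h.zero_mem 0))
  have hF := h.immersedFamily
  have h1 := (JointSmoothOn.coeff_density hF n).hasDerivAt_integral h.eps_pos x₀ (x₀ + p)
  simp only [hamiltonian_eq_integral x₀ p _ hn]
  refine h1.congr_deriv ?_
  have h2 : ∀ s, _ := fun s => hF.dT_coeff_density (h.zero_mem s) hn
  simp only [h2]
  have hV : ∀ s, HasDerivAt (fun r => coeff n (variationForm Γ 0 r))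
      (dS (fun t s => coeff n (variationForm Γ t s)) 0 s) s := fun s => by
    have := hF.hasCoeffDerivAt_variationForm (h.zero_mem s) n
    rwa [coeff_mk] at this
  have c1 : Continuous fun s => dT (dS Γ) 0 s ⬝ᵥ flowY (Γ 0) (n + 1) s :=
    (((hF.smooth.dS hF.isOpen).dT hF.isOpen).dot (hF.flowY (n + 1))).continuous_s h.zero_mem
  -- the exact term is a difference of two functions known to be continuous
  have c2 : Continuous fun s => dS (fun t s => coeff n (variationForm Γ t s)) 0 s := by
    have := ((JointSmoothOn.coeff_density hF n).dT hF.isOpen).continuous_s h.zero_mem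
    have e : (fun s => dS (fun t s => coeff n (variationForm Γ t s)) 0 s) = fun s =>
        dT (fun t s => coeff n (PowerSeries.C (speed (Γ t) s)
          * (PowerSeries.C (1 / 2 : ℝ) * densitySeries (Γ t) s))) 0 s
        - dT (dS Γ) 0 s ⬝ᵥ flowY (Γ 0) (n + 1) s := by
      funext s; rw [h2]; ring
    rw [e]
    exact this.sub c1
  rw [intervalIntegral.integral_add (c1.intervalIntegrable _ _) (c2.intervalIntegrable _ _),
    integral_deriv_eq_zero x₀ hV c2 (by rw [h.variationForm_periodic hA]), add_zero,
    sigma_flowY_succ hA hγ x₀ (n + 1) h.velocity_mem]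
  refine intervalIntegral.integral_congr fun s _ => ?_
  simp only [h.dT_dS_eq_deriv, h.start]
  exact dotProduct_comm _ _

theorem IsVariation.hasDerivAt_hamiltonian_one
    (hA : A ∈ Matrix.specialOrthogonalGroup (Fin 3) ℝ) (h : IsVariation p A a γ ε Γ) (x₀ : ℝ)
    (α : ℝ → ℝ) :
    HasDerivAt (fun t => hamiltonian x₀ p (Γ t) (α t) 1)
      (sigma x₀ p γ (flowY γ 1) (velocity Γ)) 0 := by
  have hγ : γ ∈ curveSpace p A a := h.start ▸ h.mem 0 (mem_strip.1 (h.zero_mem 0))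
  have hF := h.immersedFamily
  simp only [hamiltonian_one, arcIntegral, one_mul]
  refine (hF.speed.hasDerivAt_integral h.eps_pos x₀ (x₀ + p)).congr_deriv ?_
  rw [sigma_flowY_succ hA hγ x₀ 0 h.velocity_mem]
  refine intervalIntegral.integral_congr fun s _ => ?_
  simp only [hF.speed_mul_dT_speed (h.zero_mem s), h.dT_dS_eq_deriv, h.start, flowY_zero]

theorem IsVariation.hasDerivAt_hamiltonian_zero (h : IsVariation p A a γ ε Γ) (x₀ : ℝ)
    (α : ℝ → ℝ) :
    HasDerivAt (fun t => hamiltonian x₀ p (Γ t) (α t) 0)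
      (sigma x₀ p γ (flowY γ 0) (velocity Γ)) 0 := by
  have hγ : γ ∈ curveSpace p A a := h.start ▸ h.mem 0 (mem_strip.1 (h.zero_mem 0))
  rw [sigma_flowY_zero hγ]
  simpa only [hamiltonian_zero] using hasDerivAt_const (0 : ℝ) (0 : ℝ)

end Variations

/-! ### Orthonormal frames and spherical transport -/

section FrameAlgebra
variable {R : Type*} [CommRing R]

theorem triple_smul (a b c w : Fin 3 → R) :
    (a ⬝ᵥ (b ⨯₃ c)) • w = (w ⬝ᵥ a) • (b ⨯₃ c) + (w ⬝ᵥ b) • (c ⨯₃ a)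
      + (w ⬝ᵥ c) • (a ⨯₃ b) := by
  funext i
  fin_cases i <;>
  simp [dot_eq, cross_zero, cross_one, cross_two] <;> ring

/-- Expansion in an orthonormal frame `u, η, u × η`. -/
theorem frame_expansion {u η : Fin 3 → R} (hu : u ⬝ᵥ u = 1) (hη : η ⬝ᵥ η = 1) (h : u ⬝ᵥ η = 0)
    (w : Fin 3 → R) :
    w = (w ⬝ᵥ u) • u + (w ⬝ᵥ η) • η + (w ⬝ᵥ (u ⨯₃ η)) • (u ⨯₃ η) := by
  have h' : η ⬝ᵥ u = 0 := by rw [dotProduct_comm, h]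
  have h1 := triple_smul u η (u ⨯₃ η) w
  have h2 : η ⨯₃ (u ⨯₃ η) = u := by
    rw [cross_cross_eq_smul_sub_smul', hη, h]; simp
  have h3 : (u ⨯₃ η) ⨯₃ u = η := by
    rw [cross_cross_eq_smul_sub_smul, hu, h']; simp
  rw [h2, h3, hu, one_smul] at h1
  exact h1

theorem cross_cross_self_of_perp {u η : Fin 3 → R} (hu : u ⬝ᵥ u = 1) (h : u ⬝ᵥ η = 0) :
    u ⨯₃ (u ⨯₃ η) = -η := by
  rw [cross_cross_eq_smul_sub_smul', hu, h]; simp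

theorem cross_dot_cross_self {u η : Fin 3 → R} (hu : u ⬝ᵥ u = 1) (hη : η ⬝ᵥ η = 1)
    (h : u ⬝ᵥ η = 0) : (u ⨯₃ η) ⬝ᵥ (u ⨯₃ η) = 1 := by
  rw [cross_dot_cross, hu, hη, h]; simp

end FrameAlgebra

/-! ### Derivative of the spherical transport -/

section Transport

/-- The image of a vector orthogonal to the unit vector `T` under the rotation which takes `T` to
the unit vector `u ≠ -T` and fixes `T × u`. -/
def transport (T u ξ : R3) : R3 := ξ - ((u ⬝ᵥ ξ) * (1 + T ⬝ᵥ u)⁻¹) • (T + u)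

variable {T u ξ : R3}

theorem dot_transport (hu : u ⬝ᵥ u = 1) (h : 1 + T ⬝ᵥ u ≠ 0) : u ⬝ᵥ transport T u ξ = 0 := by
  simp only [transport, dotProduct_sub, dotProduct_smul, dotProduct_add, hu, smul_eq_mul,
    dotProduct_comm u T]
  field_simp
  ring

theorem transport_dot_self (hT : T ⬝ᵥ T = 1) (hu : u ⬝ᵥ u = 1) (hξ : T ⬝ᵥ ξ = 0)
    (h : 1 + T ⬝ᵥ u ≠ 0) : transport T u ξ ⬝ᵥ transport T u ξ = ξ ⬝ᵥ ξ := by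
  simp only [transport, dotProduct_sub, sub_dotProduct, dotProduct_smul, smul_dotProduct,
    dotProduct_add, add_dotProduct, hu, hT, smul_eq_mul, dotProduct_comm u T,
    dotProduct_comm ξ T, dotProduct_comm ξ u, hξ]
  field_simp
  ring

theorem cross_transport (hT : T ⬝ᵥ T = 1) (hu : u ⬝ᵥ u = 1) (hξ : T ⬝ᵥ ξ = 0)
    (h : 1 + T ⬝ᵥ u ≠ 0) : u ⨯₃ transport T u ξ = transport T u (T ⨯₃ ξ) := by
  have h1 := triple_smul u T ξ (T + u)
  simp only [add_dotProduct, hT, hu, dotProduct_comm u T, hξ, zero_add] at h1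
  have h2 : (u ⬝ᵥ (T ⨯₃ ξ) * (1 + T ⬝ᵥ u)⁻¹) • (T + u)
      = (1 + T ⬝ᵥ u)⁻¹ • ((u ⬝ᵥ (T ⨯₃ ξ)) • (T + u)) := by
    rw [smul_smul, mul_comm]
  have h3 : u ⨯₃ (T + u) = u ⨯₃ T := by simp
  rw [transport, transport, h2, h1, map_sub, map_smul, h3, add_comm (T ⬝ᵥ u) 1]
  simp only [smul_add, smul_smul, inv_mul_cancel₀ h, one_smul]
  rw [← cross_anticomm ξ u, mul_comm (u ⬝ᵥ ξ)]
  abel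

theorem transport_add (v w : R3) : transport T u (v + w) = transport T u v + transport T u w := by
  simp only [transport, dotProduct_add, add_mul, add_smul]; abel

theorem transport_smul (c : ℝ) (v : R3) : transport T u (c • v) = c • transport T u v := by
  simp only [transport, dotProduct_smul, smul_eq_mul, smul_sub, smul_smul, mul_assoc]

theorem mulVec_transport {A : Matrix (Fin 3) (Fin 3) ℝ}
    (hA : A ∈ Matrix.specialOrthogonalGroup (Fin 3) ℝ) :
    A *ᵥ transport T u ξ = transport (A *ᵥ T) (A *ᵥ u) (A *ᵥ ξ) := by
  simp only [transport, mulVec_dot_mulVec hA, Matrix.mulVec_sub, Matrix.mulVec_smul,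
    Matrix.mulVec_add]

end Transport

/-! ### Normal fields of unit vector fields and their monodromy angles -/

section RotatingNormals

/-- A smooth field of unit vectors. -/
structure IsUnitField (T : ℝ → R3) : Prop where
  smooth : ContDiff ℝ ∞ T
  unit : ∀ s, T s ⬝ᵥ T s = 1

/-- A unit normal field `ξ` of the unit vector field `T` which rotates with angular velocity `ν`
with respect to the normal connection. -/
structure IsRotatingNormal (T : ℝ → R3) (ν : ℝ → ℝ) (ξ : ℝ → R3) : Prop where
  smooth : ContDiff ℝ ∞ ξ
  normal : ∀ s, T s ⬝ᵥ ξ s = 0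
  unit : ∀ s, ξ s ⬝ᵥ ξ s = 1
  deriv_eq : ∀ s, deriv ξ s = -(ξ s ⬝ᵥ deriv T s) • T s + ν s • (T s ⨯₃ ξ s)

/-- The angle, in the normal plane at the end point oriented by `T ×`, from the end value of a
normal field to the image of its initial value under the monodromy. -/
def HasMonodromyAngle (x₀ p : ℝ) (A : Matrix (Fin 3) (Fin 3) ℝ) (T ξ : ℝ → R3) (α : ℝ) : Prop :=
  A *ᵥ ξ x₀ = Real.cos α • ξ (x₀ + p) + Real.sin α • (T (x₀ + p) ⨯₃ ξ (x₀ + p))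

theorem hasDerivAt_of_smooth {E : Type*} [NormedAddCommGroup E] [NormedSpace ℝ E] {f : ℝ → E}
    (hf : ContDiff ℝ ∞ f) (s : ℝ) : HasDerivAt f (deriv f s) s :=
  (hf.differentiable (by simp) s).hasDerivAt

variable {T u ξ : ℝ → R3} {ν : ℝ → ℝ}

theorem IsUnitField.dot_deriv (hT : IsUnitField T) (s : ℝ) : T s ⬝ᵥ deriv T s = 0 := by
  have h1 := hasDerivAt_of_smooth hT.smooth s
  have h2 := (HasDerivAt.dot h1 h1).unique
    ((hasDerivAt_const s (1 : ℝ)).congr_of_eventuallyEq (Filter.Eventually.of_forall hT.unit))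
  rw [dotProduct_comm] at h2
  linarith

theorem IsRotatingNormal.of_rate (hT : IsUnitField T) (hs : ContDiff ℝ ∞ ξ)
    (hn : ∀ s, T s ⬝ᵥ ξ s = 0) (hu : ∀ s, ξ s ⬝ᵥ ξ s = 1)
    (h : ∀ s, deriv ξ s ⬝ᵥ (T s ⨯₃ ξ s) = ν s) : IsRotatingNormal T ν ξ := by
  refine ⟨hs, hn, hu, fun s => ?_⟩
  have h1 := hasDerivAt_of_smooth hs s
  have h2 := IsUnitField.dot_deriv ⟨hs, hu⟩ s
  have h3 := (HasDerivAt.dot (hasDerivAt_of_smooth hT.smooth s) h1).unique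
    ((hasDerivAt_const s (0 : ℝ)).congr_of_eventuallyEq (Filter.Eventually.of_forall hn))
  have h4 := frame_expansion (hT.unit s) (hu s) (hn s) (deriv ξ s)
  rw [h, dotProduct_comm _ (ξ s), h2, zero_smul, add_zero, dotProduct_comm _ (T s)] at h4
  rw [h4]
  congr 2
  rw [dotProduct_comm (ξ s)]
  linarith

theorem IsRotatingNormal.hasDerivAt (h : IsRotatingNormal T ν ξ) (s : ℝ) :
    HasDerivAt ξ (-(ξ s ⬝ᵥ deriv T s) • T s + ν s • (T s ⨯₃ ξ s)) s :=
  h.deriv_eq s ▸ hasDerivAt_of_smooth h.smooth s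

/-- Turning a normal field by the angle `φ` adds `φ'` to the angular velocity. -/
theorem IsRotatingNormal.rotate (hT : IsUnitField T) (h : IsRotatingNormal T ν ξ) {φ : ℝ → ℝ}
    (hφ : ContDiff ℝ ∞ φ) :
    IsRotatingNormal T (fun s => ν s + deriv φ s)
      fun s => Real.cos (φ s) • ξ s + Real.sin (φ s) • (T s ⨯₃ ξ s) := by
  have hc : ContDiff ℝ ∞ fun s => Real.cos (φ s) := Real.contDiff_cos.comp hφ
  have hs : ContDiff ℝ ∞ fun s => Real.sin (φ s) := Real.contDiff_sin.comp hφ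
  have hJ := fun s => cross_cross_self_of_perp (hT.unit s) (h.normal s)
  refine IsRotatingNormal.of_rate hT
    ((hc.smul h.smooth).add (hs.smul (ContDiff.cross hT.smooth h.smooth))) (fun s => ?_)
    (fun s => ?_) fun s => ?_
  · simp only [dotProduct_add, dotProduct_smul, h.normal, dot_self_cross]; simp
  · simp only [dotProduct_add, add_dotProduct, dotProduct_smul, smul_dotProduct, h.unit,
      dot_cross_self, cross_dot_cross_self (hT.unit s) (h.unit s) (h.normal s),
      dotProduct_comm (T s ⨯₃ ξ s) (ξ s), smul_eq_mul]
    linear_combination Real.sin_sq_add_cos_sq (φ s)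
  · have hd := hasDerivAt_of_smooth hφ s
    have h1 := (hd.cos.fun_smul (h.hasDerivAt s)).fun_add
      (hd.sin.fun_smul (HasDerivAt.cross (hasDerivAt_of_smooth hT.smooth s) (h.hasDerivAt s)))
    rw [h1.deriv]
    have e1 : (deriv T s ⨯₃ ξ s) ⬝ᵥ ξ s = 0 := by rw [dotProduct_comm, dot_cross_self]
    have e2 : (deriv T s ⨯₃ ξ s) ⬝ᵥ (T s ⨯₃ ξ s) = 0 := by
      rw [cross_dot_cross, h.unit, dotProduct_comm _ (T s), hT.dot_deriv,
        dotProduct_comm (ξ s) (T s), h.normal]; ring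
    simp only [map_add, map_smul, hJ, cross_self, smul_zero, zero_add, dotProduct_add,
      add_dotProduct, dotProduct_smul, smul_dotProduct, smul_neg, neg_dotProduct, dotProduct_neg,
      h.unit, h.normal, e1, e2, dot_self_cross, dot_cross_self,
      cross_dot_cross_self (hT.unit s) (h.unit s) (h.normal s),
      dotProduct_comm (T s ⨯₃ ξ s) (ξ s), smul_eq_mul]
    linear_combination (ν s + deriv φ s) * Real.sin_sq_add_cos_sq (φ s)

theorem HasMonodromyAngle.rotate {x₀ p α : ℝ} {A : Matrix (Fin 3) (Fin 3) ℝ}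
    (hA : A ∈ Matrix.specialOrthogonalGroup (Fin 3) ℝ) (hT : IsUnitField T)
    (hTA : T (x₀ + p) = A *ᵥ T x₀) (h : IsRotatingNormal T ν ξ)
    (hα : HasMonodromyAngle x₀ p A T ξ α) (φ : ℝ → ℝ) :
    HasMonodromyAngle x₀ p A T
      (fun s => Real.cos (φ s) • ξ s + Real.sin (φ s) • (T s ⨯₃ ξ s))
      (α + φ x₀ - φ (x₀ + p)) := by
  have hJ := cross_cross_self_of_perp (hT.unit (x₀ + p)) (h.normal (x₀ + p))
  have e : α + φ x₀ = (α + φ x₀ - φ (x₀ + p)) + φ (x₀ + p) := by ring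
  have c1 : Real.cos α * Real.cos (φ x₀) - Real.sin α * Real.sin (φ x₀)
      = Real.cos (α + φ x₀ - φ (x₀ + p)) * Real.cos (φ (x₀ + p))
        - Real.sin (α + φ x₀ - φ (x₀ + p)) * Real.sin (φ (x₀ + p)) := by
    rw [← Real.cos_add, ← Real.cos_add, ← e]
  have c2 : Real.sin α * Real.cos (φ x₀) + Real.cos α * Real.sin (φ x₀)
      = Real.sin (α + φ x₀ - φ (x₀ + p)) * Real.cos (φ (x₀ + p))
        + Real.cos (α + φ x₀ - φ (x₀ + p)) * Real.sin (φ (x₀ + p)) := by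
    rw [← Real.sin_add, ← Real.sin_add, ← e]
  unfold HasMonodromyAngle at hα ⊢
  rw [Matrix.mulVec_add, Matrix.mulVec_smul, Matrix.mulVec_smul, ← mulVec_cross_mulVec hA, ← hTA,
    hα]
  simp only [map_add, map_smul, hJ]
  set x := ξ (x₀ + p)
  set y := T (x₀ + p) ⨯₃ ξ (x₀ + p)
  have l : Real.cos (φ x₀) • (Real.cos α • x + Real.sin α • y)
      + Real.sin (φ x₀) • (Real.cos α • y + Real.sin α • -x)
      = (Real.cos α * Real.cos (φ x₀) - Real.sin α * Real.sin (φ x₀)) • x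
        + (Real.sin α * Real.cos (φ x₀) + Real.cos α * Real.sin (φ x₀)) • y := by module
  rw [l, c1, c2]
  module

/-- The angular velocity of a transported normal field: up to sign the rate of the area swept out
between `T` and `u` on the sphere. -/
def areaRate (T u : ℝ → R3) (s : ℝ) : ℝ :=
  -((T s ⨯₃ u s) ⬝ᵥ (deriv T s + deriv u s)) * (1 + T s ⬝ᵥ u s)⁻¹

theorem contDiff_transport (hT : IsUnitField T) (hu : IsUnitField u)
    (h : ∀ s, 1 + T s ⬝ᵥ u s ≠ 0) (hξ : ContDiff ℝ ∞ ξ) :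
    ContDiff ℝ ∞ fun s => transport (T s) (u s) (ξ s) :=
  hξ.sub (((ContDiff.dot hu.smooth hξ).mul
    ((contDiff_const.add (ContDiff.dot hT.smooth hu.smooth)).inv h)).smul
      (hT.smooth.add hu.smooth))

/-- Transport along the minimal rotations from `T` to `u`. -/
theorem IsRotatingNormal.transport (hT : IsUnitField T) (hu : IsUnitField u)
    (h : ∀ s, 1 + T s ⬝ᵥ u s ≠ 0) (hξ : IsRotatingNormal T ν ξ) :
    IsRotatingNormal u (fun s => ν s + areaRate T u s)
      fun s => SpaceCurve.transport (T s) (u s) (ξ s) := by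
  refine IsRotatingNormal.of_rate hu (contDiff_transport hT hu h hξ.smooth)
    (fun s => dot_transport (hu.unit s) (h s))
    (fun s => by rw [transport_dot_self (hT.unit s) (hu.unit s) (hξ.normal s) (h s), hξ.unit])
    fun s => ?_
  have dT := hasDerivAt_of_smooth hT.smooth s
  have du := hasDerivAt_of_smooth hu.smooth s
  have dξ := hξ.hasDerivAt s
  have dc := ((HasDerivAt.dot dT du).const_add 1).fun_inv (h s)
  have hd := dξ.fun_sub ((((HasDerivAt.dot du dξ).fun_mul dc)).fun_smul (dT.fun_add du))
  rw [show (fun s => SpaceCurve.transport (T s) (u s) (ξ s)) = _ from rfl]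
  have hd' := hd.deriv
  simp only [SpaceCurve.transport] at hd' ⊢
  rw [hd']
  have hJ := cross_transport (hT.unit s) (hu.unit s) (hξ.normal s) (h s)
  simp only [SpaceCurve.transport] at hJ
  rw [hJ]
  have hx := triple_smul (u s) (T s) (ξ s) (ξ s)
  rw [hξ.unit, one_smul, dotProduct_comm (ξ s) (T s), hξ.normal, zero_smul, add_zero,
    dotProduct_comm (ξ s) (u s)] at hx
  have hx2 : T s ⨯₃ u s = (u s ⬝ᵥ ξ s) • (T s ⨯₃ ξ s) - (u s ⬝ᵥ (T s ⨯₃ ξ s)) • ξ s := by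
    rw [hx, ← cross_anticomm (T s) (u s)]; abel
  have hB := cross_dot_cross_self (hT.unit s) (hξ.unit s) (hξ.normal s)
  rw [areaRate, hx2]
  have hq := h s
  simp only [dotProduct_add, add_dotProduct, dotProduct_sub, sub_dotProduct, dotProduct_smul,
    smul_dotProduct, smul_eq_mul, hT.unit, hu.unit, hB, dot_self_cross, neg_dotProduct,
    dotProduct_neg, neg_smul, dotProduct_comm (u s) (T s), dotProduct_comm (deriv T s) (T s),
    dotProduct_comm (deriv u s) (u s), hT.dot_deriv, hu.dot_deriv,
    dotProduct_comm (T s ⨯₃ ξ s) (u s), dotProduct_comm (T s ⨯₃ ξ s) (T s),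
    dotProduct_comm (ξ s) (deriv T s), dotProduct_comm (ξ s) (deriv u s),
    dotProduct_comm (T s ⨯₃ ξ s) (deriv u s), dotProduct_comm (T s ⨯₃ ξ s) (deriv T s),
    dotProduct_comm (T s) (deriv u s)]
  field_simp
  ring

theorem HasMonodromyAngle.transport {x₀ p α : ℝ} {A : Matrix (Fin 3) (Fin 3) ℝ}
    (hA : A ∈ Matrix.specialOrthogonalGroup (Fin 3) ℝ) (hT : IsUnitField T) (hu : IsUnitField u)
    (h : ∀ s, 1 + T s ⬝ᵥ u s ≠ 0) (hTA : T (x₀ + p) = A *ᵥ T x₀)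
    (huA : u (x₀ + p) = A *ᵥ u x₀) (hξ : IsRotatingNormal T ν ξ)
    (hα : HasMonodromyAngle x₀ p A T ξ α) :
    HasMonodromyAngle x₀ p A u (fun s => SpaceCurve.transport (T s) (u s) (ξ s)) α := by
  unfold HasMonodromyAngle at hα ⊢
  rw [mulVec_transport hA, ← hTA, ← huA, hα, transport_add, transport_smul, transport_smul,
    cross_transport (hT.unit _) (hu.unit _) (hξ.normal _) (h _)]

theorem contDiff_areaRate (hT : IsUnitField T) (hu : IsUnitField u)
    (h : ∀ s, 1 + T s ⬝ᵥ u s ≠ 0) : ContDiff ℝ ∞ (areaRate T u) :=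
  (ContDiff.dot (ContDiff.cross hT.smooth hu.smooth)
    ((contDiff_infty_iff_deriv.1 hT.smooth).2.add
      (contDiff_infty_iff_deriv.1 hu.smooth).2)).neg.mul
    ((contDiff_const.add (ContDiff.dot hT.smooth hu.smooth)).inv h)

theorem hasDerivAt_primitive {ρ : ℝ → ℝ} (hρ : Continuous ρ) (x₀ s : ℝ) :
    HasDerivAt (fun s => ∫ r in x₀..s, ρ r) (ρ s) s :=
  intervalIntegral.integral_hasDerivAt_right (hρ.intervalIntegrable _ _)
    (hρ.stronglyMeasurableAtFilter _ _) hρ.continuousAt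

theorem contDiff_primitive {ρ : ℝ → ℝ} (hρ : ContDiff ℝ ∞ ρ) (x₀ : ℝ) :
    ContDiff ℝ ∞ fun s => ∫ r in x₀..s, ρ r := by
  have h := hasDerivAt_primitive hρ.continuous x₀
  refine contDiff_infty_iff_deriv.2 ⟨fun s => (h s).differentiableAt, ?_⟩
  rwa [show deriv (fun s => ∫ r in x₀..s, ρ r) = ρ from funext fun s => (h s).deriv]

/-- Comparison of the torsion of two unit vector fields: out of a parallel normal field of `T`
one obtains a normal field of `u` with prescribed angular velocity `-ν`, and the monodromy angles
differ by the spherical area between `T` and `u` and the integral of `ν`. -/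
theorem exists_rotatingNormal {x₀ p e : ℝ} {A : Matrix (Fin 3) (Fin 3) ℝ}
    (hA : A ∈ Matrix.specialOrthogonalGroup (Fin 3) ℝ) (hT : IsUnitField T) (hu : IsUnitField u)
    (h : ∀ s, 1 + T s ⬝ᵥ u s ≠ 0) (hTA : T (x₀ + p) = A *ᵥ T x₀)
    (huA : u (x₀ + p) = A *ᵥ u x₀) (hξ : IsRotatingNormal T (fun _ => 0) ξ)
    (hα : HasMonodromyAngle x₀ p A T ξ e) (hν : ContDiff ℝ ∞ ν) :
    ∃ η, IsRotatingNormal u (fun s => -ν s) η ∧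
      HasMonodromyAngle x₀ p A u η (e + ∫ s in x₀..(x₀ + p), (areaRate T u s + ν s)) := by
  have hρ : ContDiff ℝ ∞ fun s => -(areaRate T u s + ν s) :=
    ((contDiff_areaRate hT hu h).add hν).neg
  have h1 := (hξ.transport hT hu h).rotate hu (contDiff_primitive hρ x₀)
  have h2 := (hα.transport hA hT hu h hTA huA hξ).rotate hA hu huA (hξ.transport hT hu h)
    fun s => ∫ r in x₀..s, -(areaRate T u r + ν r)
  have e1 : ∀ s, 0 + areaRate T u s
      + deriv (fun s => ∫ r in x₀..s, -(areaRate T u r + ν r)) s = -ν s := fun s => by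
    rw [(hasDerivAt_primitive hρ.continuous x₀ s).deriv]; ring
  rw [intervalIntegral.integral_same, add_zero, intervalIntegral.integral_neg,
    sub_neg_eq_add] at h2
  simp only [e1] at h1
  exact ⟨_, h1, h2⟩

end RotatingNormals

/-! ### Existence and first variation of the total torsion -/

section TotalTorsion

/-- A smooth curve on the sphere misses some pair of antipodal points, hence has a smooth unit
normal field. -/
theorem IsUnitField.exists_normal {T : ℝ → R3} (hT : IsUnitField T) :
    ∃ N : ℝ → R3, ContDiff ℝ ∞ N ∧ (∀ s, T s ⬝ᵥ N s = 0) ∧ ∀ s, N s ⬝ᵥ N s = 1 := by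
  have hc : ContDiff ℝ ∞ fun q : ℝ × ℝ => q.2 • T q.1 :=
    contDiff_snd.smul (hT.smooth.comp contDiff_fst)
  have hd := (hc.of_le (m := 1) (by exact_mod_cast le_top)).dense_compl_range_of_finrank_lt_finrank
    (by simp)
  -- a vector `c` outside the cone over the curve, which is the smooth image of a plane
  obtain ⟨c, hcr⟩ := hd.nonempty
  have hcT : ∀ s, c ⨯₃ T s ≠ 0 := fun s h0 => hcr ⟨(s, T s ⬝ᵥ c), by
    have h1 := cross_cross_eq_smul_sub_smul' (T s) c (T s)
    rw [h0, map_zero, hT.unit, one_smul, dotProduct_comm c] at h1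
    exact (sub_eq_zero.1 h1.symm).symm⟩
  have hN : ContDiff ℝ ∞ fun s => c ⨯₃ T s := ContDiff.cross contDiff_const hT.smooth
  have hpos : ∀ s, 0 < (c ⨯₃ T s) ⬝ᵥ (c ⨯₃ T s) := fun s => dot_self_pos (hcT s)
  refine ⟨fun s => (Real.sqrt ((c ⨯₃ T s) ⬝ᵥ (c ⨯₃ T s)))⁻¹ • (c ⨯₃ T s),
    (((ContDiff.dot hN hN).sqrt fun s => (hpos s).ne').inv
      fun s => (Real.sqrt_pos.2 (hpos s)).ne').smul hN, fun s => ?_, fun s => ?_⟩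
  · rw [dotProduct_smul, dot_cross_self, smul_zero]
  · have h1 := Real.mul_self_sqrt (hpos s).le
    have h2 := (Real.sqrt_pos.2 (hpos s)).ne'
    simp only [dotProduct_smul, smul_dotProduct, smul_eq_mul]
    field_simp
    linarith

/-- Any normal field becomes parallel when it is turned back by the integral of its angular
velocity. -/
theorem IsUnitField.exists_parallel {T : ℝ → R3} (hT : IsUnitField T) :
    ∃ ξ, IsRotatingNormal T (fun _ => 0) ξ := by
  obtain ⟨N, hN, hn, hu⟩ := hT.exists_normal
  have h1 := IsRotatingNormal.of_rate hT hN hn hu (ν := fun s => deriv N s ⬝ᵥ (T s ⨯₃ N s))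
    fun s => rfl
  have hρ : ContDiff ℝ ∞ fun s => -(deriv N s ⬝ᵥ (T s ⨯₃ N s)) :=
    (ContDiff.dot (contDiff_infty_iff_deriv.1 hN).2 (ContDiff.cross hT.smooth hN)).neg
  have h2 := h1.rotate hT (contDiff_primitive hρ 0)
  simp only [(hasDerivAt_primitive hρ.continuous 0 _).deriv, add_neg_cancel] at h2
  exact ⟨_, h2⟩

theorem exists_cos_sin {x y : ℝ} (h : x ^ 2 + y ^ 2 = 1) :
    ∃ α : ℝ, x = Real.cos α ∧ y = Real.sin α := by
  refine ⟨Complex.arg ⟨x, y⟩, ?_⟩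
  have h0 : ‖(⟨x, y⟩ : ℂ)‖ = 1 := by
    rw [Complex.norm_def, Complex.normSq_mk, ← pow_two, ← pow_two, h, Real.sqrt_one]
  have hne : (⟨x, y⟩ : ℂ) ≠ 0 := by
    intro h1; rw [h1] at h0; simp at h0
  rw [Complex.cos_arg hne, Complex.sin_arg, h0]
  simp

theorem exists_monodromyAngle {x₀ p : ℝ} {A : Matrix (Fin 3) (Fin 3) ℝ} {T ξ : ℝ → R3}
    {ν : ℝ → ℝ} (hA : A ∈ Matrix.specialOrthogonalGroup (Fin 3) ℝ) (hT : IsUnitField T)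
    (hTA : T (x₀ + p) = A *ᵥ T x₀) (h : IsRotatingNormal T ν ξ) :
    ∃ α, HasMonodromyAngle x₀ p A T ξ α := by
  have h1 := frame_expansion (hT.unit (x₀ + p)) (h.unit _) (h.normal _) (A *ᵥ ξ x₀)
  have h2 : (A *ᵥ ξ x₀) ⬝ᵥ T (x₀ + p) = 0 := by
    rw [hTA, mulVec_dot_mulVec hA, dotProduct_comm, h.normal]
  rw [h2, zero_smul, zero_add] at h1
  have h3 : (A *ᵥ ξ x₀) ⬝ᵥ (A *ᵥ ξ x₀) = 1 := by rw [mulVec_dot_mulVec hA, h.unit]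
  have h4 : ((A *ᵥ ξ x₀) ⬝ᵥ ξ (x₀ + p)) ^ 2
      + ((A *ᵥ ξ x₀) ⬝ᵥ (T (x₀ + p) ⨯₃ ξ (x₀ + p))) ^ 2 = 1 := by
    nth_rewrite 1 [h1] at h3
    rw [add_dotProduct, smul_dotProduct, smul_dotProduct, smul_eq_mul, smul_eq_mul,
      dotProduct_comm (ξ _), dotProduct_comm (_ ⨯₃ _)] at h3
    linarith
  obtain ⟨α, e1, e2⟩ := exists_cos_sin h4
  exact ⟨α, by rw [HasMonodromyAngle, ← e1, ← e2]; exact h1⟩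

variable {x₀ p : ℝ} {A : Matrix (Fin 3) (Fin 3) ℝ} {a : R3} {γ : ℝ → R3}

theorem isUnitField_tangent (hγ : γ ∈ curveSpace p A a) : IsUnitField (tangent γ) :=
  ⟨contDiff_tangent hγ, fun s => tangent_dot_self (hγ.2.1 s)⟩

theorem isParallelUnitNormal_iff (hγ : γ ∈ curveSpace p A a) {ξ : ℝ → R3} :
    IsParallelUnitNormal γ ξ ↔ IsRotatingNormal (tangent γ) (fun _ => 0) ξ := by
  have hT := isUnitField_tangent hγ
  have key : ContDiff ℝ ∞ ξ → (∀ s, tangent γ s ⬝ᵥ ξ s = 0) → ∀ s,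
      deriv ξ s ⬝ᵥ tangent γ s = -(ξ s ⬝ᵥ deriv (tangent γ) s) := fun hs hn s => by
    have h3 := (HasDerivAt.dot (hasDerivAt_of_smooth hT.smooth s)
      (hasDerivAt_of_smooth hs s)).unique
      ((hasDerivAt_const s (0 : ℝ)).congr_of_eventuallyEq (Filter.Eventually.of_forall hn))
    rw [dotProduct_comm, dotProduct_comm (ξ s)]
    linarith
  have e : ∀ s, deriv ξ s - (deriv ξ s ⬝ᵥ tangent γ s) • tangent γ s
      = speed γ s • (arcDeriv γ ξ s - (arcDeriv γ ξ s ⬝ᵥ tangent γ s) • tangent γ s) :=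
    fun s => by
      rw [← speed_smul_arcDeriv (hγ.2.1 s) ξ, smul_sub, smul_dotProduct, smul_eq_mul, smul_smul]
  constructor
  · intro h
    have hn : ∀ s, tangent γ s ⬝ᵥ ξ s = 0 := fun s => by rw [dotProduct_comm, h.normal]
    refine ⟨h.smooth, hn, h.unit, fun s => ?_⟩
    have h1 := e s
    rw [h.parallel, smul_zero, sub_eq_zero, key h.smooth hn] at h1
    rw [h1]
    simp
  · intro h
    refine ⟨h.smooth, fun s => by rw [dotProduct_comm, h.normal], h.unit, fun s => ?_⟩
    have h1 := e s
    rw [key h.smooth h.normal, h.deriv_eq, zero_smul, add_zero, sub_self] at h1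
    exact (smul_eq_zero.1 h1.symm).resolve_left (speed_pos (hγ.2.1 s)).ne'

theorem isTotalTorsion_iff (hγ : γ ∈ curveSpace p A a) {α : ℝ} :
    IsTotalTorsion x₀ p A γ α ↔ ∃ ξ, IsRotatingNormal (tangent γ) (fun _ => 0) ξ ∧
      HasMonodromyAngle x₀ p A (tangent γ) ξ α := by
  simp only [IsTotalTorsion, isParallelUnitNormal_iff hγ, HasMonodromyAngle]

/-- In a variation the tangents stay away from the antipodes of the initial ones; by
equivariance it is enough to look at one period. -/
theorem IsVariation.exists_strip {ε : ℝ} {Γ : ℝ → ℝ → R3} (hp : 0 < p)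
    (hA : A ∈ Matrix.specialOrthogonalGroup (Fin 3) ℝ) (h : IsVariation p A a γ ε Γ) :
    ∃ δ, 0 < δ ∧ δ ≤ ε ∧ ∀ t s, (t, s) ∈ strip δ →
      1 + tangent γ s ⬝ᵥ tangent (Γ t) s ≠ 0 := by
  have hγ : γ ∈ curveSpace p A a := h.start ▸ h.mem 0 (mem_strip.1 (h.zero_mem 0))
  have hF := h.immersedFamily
  have hcont : ContinuousOn (fun q : ℝ × ℝ => 1 + tangent γ q.2 ⬝ᵥ tangent (Γ q.1) q.2)
      (strip ε) :=
    (contDiffOn_const.add (ContDiffOn.dot ((contDiff_tangent hγ).comp contDiff_snd).contDiffOn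
      hF.tangent)).continuousOn (n := ∞)
  have h1 : ∀ s ∈ Set.Icc 0 p, ∀ᶠ q : ℝ × ℝ in nhds (0, s),
      1 + tangent γ q.2 ⬝ᵥ tangent (Γ q.1) q.2 ≠ 0 := fun s _ => by
    have hc := hcont.continuousAt (hF.isOpen.mem_nhds (h.zero_mem s))
    refine hc.eventually_ne ?_
    simp only [h.start, tangent_dot_self (hγ.2.1 s)]
    norm_num
  have h2 : ∀ᶠ t in nhds (0 : ℝ), ∀ s ∈ Set.Icc 0 p,
      1 + tangent γ s ⬝ᵥ tangent (Γ t) s ≠ 0 :=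
    isCompact_Icc.eventually_forall_of_forall_eventually h1
  obtain ⟨δ, hδ, hδ2⟩ := Metric.eventually_nhds_iff.1 h2
  refine ⟨min δ ε, lt_min hδ h.eps_pos, min_le_right _ _, fun t s hts => ?_⟩
  have ht := mem_strip.1 hts
  have hmem : t ∈ Set.Ioo (-ε) ε :=
    ⟨by linarith [ht.1, min_le_right δ ε], lt_of_lt_of_le ht.2 (min_le_right _ _)⟩
  have hper : Function.Periodic (fun s => 1 + tangent γ s ⬝ᵥ tangent (Γ t) s) p := fun s => by
    simp only [tangent_equivariant hA hγ, tangent_equivariant hA (h.mem t hmem),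
      mulVec_dot_mulVec hA]
  obtain ⟨r, hr, he⟩ := hper.exists_mem_Ico₀ hp s
  rw [he]
  refine hδ2 ?_ r ⟨hr.1, hr.2.le⟩
  rw [Real.dist_eq, sub_zero, abs_lt]
  exact ⟨by linarith [ht.1, min_le_left δ ε], lt_of_lt_of_le ht.2 (min_le_left _ _)⟩

/-- A lift of the total torsion along a variation, and its derivative. The lift is the initial value
plus the spherical area between the tangents of `γ` and of `Γ t`. -/
theorem IsVariation.exists_totalTorsion {ε : ℝ} {Γ : ℝ → ℝ → R3} (hp : 0 < p)
    (hA : A ∈ Matrix.specialOrthogonalGroup (Fin 3) ℝ) (h : IsVariation p A a γ ε Γ) (x₀ : ℝ) :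
    ∃ α : ℝ → ℝ, (∀ᶠ t in nhds 0, IsTotalTorsion x₀ p A (Γ t) (α t)) ∧
      HasDerivAt α (sigma x₀ p γ (flowY γ 2) (velocity Γ)) 0 := by
  have hγ : γ ∈ curveSpace p A a := h.start ▸ h.mem 0 (mem_strip.1 (h.zero_mem 0))
  have hF := h.immersedFamily
  have hT := isUnitField_tangent hγ
  obtain ⟨ξ, hξ⟩ := hT.exists_parallel
  obtain ⟨e, he⟩ := exists_monodromyAngle hA hT (tangent_equivariant hA hγ x₀) hξ
  obtain ⟨δ, hδ, hδε, hne⟩ := h.exists_strip hp hA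
  have hsub : strip δ ⊆ strip ε := fun q hq => by
    have := mem_strip.1 (show (q.1, q.2) ∈ strip δ from hq)
    exact mem_strip.2 ⟨by linarith [this.1], by linarith [this.2]⟩
  have hγ2 : JointSmoothOn (strip δ) fun _ s => tangent γ s :=
    ((contDiff_tangent hγ).comp contDiff_snd).contDiffOn
  have hdγ2 : JointSmoothOn (strip δ) fun _ s => deriv (tangent γ) s :=
    ((contDiff_infty_iff_deriv.1 (contDiff_tangent hγ)).2.comp contDiff_snd).contDiffOn
  have hΓ2 : JointSmoothOn (strip δ) fun t s => tangent (Γ t) s := hF.tangent.mono hsub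
  have hdΓ2 : JointSmoothOn (strip δ) (dS fun t s => tangent (Γ t) s) :=
    hΓ2.dS (isOpen_strip δ)
  have hsum : JointSmoothOn (strip δ) fun t s =>
      deriv (tangent γ) s + dS (fun t s => tangent (Γ t) s) t s := ContDiffOn.add hdγ2 hdΓ2
  have hs : JointSmoothOn (strip δ) fun t s => areaRate (tangent γ) (tangent (Γ t)) s :=
    ((hγ2.cross hΓ2).dot hsum).neg.mul
      ((contDiffOn_const.add (hγ2.dot hΓ2)).inv fun q hq => hne q.1 q.2 hq)
  refine ⟨fun t => e + ∫ s in x₀..(x₀ + p), areaRate (tangent γ) (tangent (Γ t)) s, ?_, ?_⟩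
  · filter_upwards [Ioo_mem_nhds (neg_lt_zero.2 hδ) hδ] with t ht
    have hm : ∀ s, (t, s) ∈ strip δ := fun s => mem_strip.2 ht
    have hγt : Γ t ∈ curveSpace p A a := h.mem t (mem_strip.1 (hsub (hm 0)))
    obtain ⟨η, h1, h2⟩ := exists_rotatingNormal hA hT (isUnitField_tangent hγt)
      (fun s => hne t s (hm s)) (tangent_equivariant hA hγ x₀) (tangent_equivariant hA hγt x₀)
      hξ he (contDiff_const (c := (0 : ℝ)))
    simp only [neg_zero, add_zero] at h1 h2
    exact (isTotalTorsion_iff hγt).2 ⟨η, h1, h2⟩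
  · refine ((hs.hasDerivAt_integral hδ x₀ (x₀ + p)).const_add e).congr_deriv ?_
    rw [sigma_flowY_succ hA hγ x₀ 1 h.velocity_mem]
    refine intervalIntegral.integral_congr fun s _ => ?_
    have hm : (0, s) ∈ strip δ := mem_strip.2 ⟨by linarith, hδ⟩
    have d1 := (hΓ2.hasDerivAt_t (isOpen_strip δ) hm)
    have d2 := (hdΓ2.hasDerivAt_t (isOpen_strip δ) hm)
    have d0 := hasDerivAt_const (0 : ℝ) (tangent γ s)
    have dc := ((HasDerivAt.dot d0 d1).const_add 1).fun_inv (hne 0 s hm)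
    have d := (HasDerivAt.dot (HasDerivAt.cross d0 d1)
      (d2.const_add (deriv (tangent γ) s))).fun_neg.fun_mul dc
    have d' : dT (fun t s => areaRate (tangent γ) (tangent (Γ t)) s) 0 s = _ := d.deriv
    -- at `t = 0` the two unit fields coincide, so only the derivatives of the cross product and of
    -- the sum remain, and these combine to `(Y₁, γ̇')`
    have e0 : dS (fun t s => tangent (Γ t) s) 0 s = deriv (tangent γ) s := by
      rw [dS, h.start]
    have hv := hF.speed_smul_flowY_one (h.zero_mem s)
    have hst := hF.dT_dS_eq (h.zero_mem s)
    rw [e0, h.start] at hv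
    rw [h.start, h.dT_dS_eq_deriv] at hst
    have hR : flowY γ 1 s ⬝ᵥ deriv (velocity Γ) s = (tangent γ s ⨯₃ deriv (tangent γ) s)
        ⬝ᵥ dT (fun t s => tangent (Γ t) s) 0 s := by
      rw [hst, dotProduct_add, dotProduct_smul, dotProduct_comm _ (tangent γ s),
        tangent_dot_flowY_one (hγ.2.1 s), smul_zero, zero_add, dotProduct_smul,
        ← smul_dotProduct, hv]
    simp only [d', hR, e0]
    rw [h.start, cross_self, tangent_dot_self (hγ.2.1 s)]
    simp only [dot_eq, cross_zero, cross_one, cross_two, Pi.add_apply, Pi.zero_apply]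
    ring

end TotalTorsion

/-! ### Rotation angles and the trace -/

section RotationAngles
variable {R : Matrix (Fin 3) (Fin 3) ℝ}

/-- The trace in an orthonormal frame `y, n, y × n`. -/
theorem trace_eq_frame {y n : R3} (hy : y ⬝ᵥ y = 1) (hn : n ⬝ᵥ n = 1) (h : y ⬝ᵥ n = 0)
    (R : Matrix (Fin 3) (Fin 3) ℝ) :
    R.trace = (R *ᵥ y) ⬝ᵥ y + (R *ᵥ n) ⬝ᵥ n + (R *ᵥ (y ⨯₃ n)) ⬝ᵥ (y ⨯₃ n) := by
  have hz := cross_dot_cross_self hy hn h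
  have h' : n ⬝ᵥ y = 0 := by rw [dotProduct_comm, h]
  have hP : Matrix.of ![y, n, y ⨯₃ n] * (Matrix.of ![y, n, y ⨯₃ n])ᵀ = 1 := by
    ext i j
    have : (Matrix.of ![y, n, y ⨯₃ n] * (Matrix.of ![y, n, y ⨯₃ n])ᵀ) i j
        = (![y, n, y ⨯₃ n] i) ⬝ᵥ (![y, n, y ⨯₃ n] j) := rfl
    rw [this]
    fin_cases i <;> fin_cases j <;>
    simp [hy, hn, h, h', hz, dotProduct_comm (y ⨯₃ n) y, dotProduct_comm (y ⨯₃ n) n]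
  have h2 : R.trace = (Matrix.of ![y, n, y ⨯₃ n] * R * (Matrix.of ![y, n, y ⨯₃ n])ᵀ).trace := by
    rw [Matrix.trace_mul_comm, ← mul_assoc, mul_eq_one_comm.1 hP, one_mul]
  rw [h2]
  have h3 : ∀ i, (Matrix.of ![y, n, y ⨯₃ n] * R * (Matrix.of ![y, n, y ⨯₃ n])ᵀ) i i
      = (R *ᵥ (![y, n, y ⨯₃ n] i)) ⬝ᵥ (![y, n, y ⨯₃ n] i) := fun i => by
    rw [mul_assoc, Matrix.mul_apply', dotProduct_comm]
    rfl
  rw [Matrix.trace_fin_three, h3, h3, h3]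
  rfl

theorem exists_unit_normal {y : R3} (hy : y ⬝ᵥ y = 1) : ∃ n : R3, y ⬝ᵥ n = 0 ∧ n ⬝ᵥ n = 1 := by
  obtain ⟨N, -, h1, h2⟩ := IsUnitField.exists_normal (T := fun _ => y)
    ⟨contDiff_const, fun _ => hy⟩
  exact ⟨N 0, h1 0, h2 0⟩

/-- A rotation in dimension three has the eigenvalue `1`: as `R - 1 = R (1 - R)ᵀ`, the determinant
of `R - 1` is its own negative. -/
theorem exists_axis (hR : R ∈ Matrix.specialOrthogonalGroup (Fin 3) ℝ) :
    ∃ y : R3, y ⬝ᵥ y = 1 ∧ R *ᵥ y = y := by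
  have hdet : (R - 1).det = 0 := by
    have h1 : R - 1 = R * (1 - R)ᵀ := by
      rw [Matrix.transpose_sub, Matrix.transpose_one, mul_sub, mul_one, mul_transpose_self hR]
    have h2 : (R - 1).det = (1 - R).det := by
      conv_lhs => rw [h1]
      rw [Matrix.det_mul, Matrix.det_transpose, (Matrix.mem_specialOrthogonalGroup_iff.1 hR).2,
        one_mul]
    have h3 : (1 - R).det = (-1) ^ Fintype.card (Fin 3) * (R - 1).det := by
      rw [← Matrix.det_neg, neg_sub]
    rw [Fintype.card_fin] at h3
    linarith
  obtain ⟨v, hv, h0⟩ := Matrix.exists_mulVec_eq_zero_iff.2 hdet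
  have hRv : R *ᵥ v = v := by
    rw [Matrix.sub_mulVec, Matrix.one_mulVec, sub_eq_zero] at h0; exact h0
  have hpos := dot_self_pos hv
  have h1 := Real.mul_self_sqrt hpos.le
  have h2 := (Real.sqrt_pos.2 hpos).ne'
  refine ⟨(Real.sqrt (v ⬝ᵥ v))⁻¹ • v, ?_, by rw [Matrix.mulVec_smul, hRv]⟩
  simp only [dotProduct_smul, smul_dotProduct, smul_eq_mul]
  field_simp
  linarith

/-- Euler's rotation theorem; the angle is determined up to sign and multiples of `2π` by the
trace, and every such value occurs, for a suitable orientation of the axis. -/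
theorem exists_rotation_cos (hR : R ∈ Matrix.specialOrthogonalGroup (Fin 3) ℝ) :
    ∃ c, |c| ≤ 1 ∧ R.trace = 1 + 2 * c ∧ ∀ θ, Real.cos θ = c → IsRotationAngle R θ := by
  obtain ⟨y, hy, hRy⟩ := exists_axis hR
  obtain ⟨n, hyn, hn⟩ := exists_unit_normal hy
  have hny : n ⬝ᵥ y = 0 := by rw [dotProduct_comm, hyn]
  have hz := cross_dot_cross_self hy hn hyn
  set c := (R *ᵥ n) ⬝ᵥ n with hc
  set s := (R *ᵥ n) ⬝ᵥ (y ⨯₃ n) with hs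
  have h1 : R *ᵥ n = c • n + s • (y ⨯₃ n) := by
    have := frame_expansion hy hn hyn (R *ᵥ n)
    have h0 : (R *ᵥ n) ⬝ᵥ y = 0 := by
      have := mulVec_dot_mulVec hR n y
      rwa [hRy, hny] at this
    rwa [h0, zero_smul, zero_add] at this
  have h2 : R *ᵥ (y ⨯₃ n) = c • (y ⨯₃ n) - s • n := by
    rw [← mulVec_cross_mulVec hR, hRy, h1, map_add, map_smul, map_smul,
      cross_cross_self_of_perp hy hyn, smul_neg, sub_eq_add_neg]
  have hcs : c ^ 2 + s ^ 2 = 1 := by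
    have h := mulVec_dot_mulVec hR n n
    rw [h1, hn] at h
    simp only [add_dotProduct, dotProduct_add, smul_dotProduct, dotProduct_smul, hn, hz,
      dot_cross_self, dotProduct_comm (y ⨯₃ n) n, smul_eq_mul] at h
    linarith
  have htr : R.trace = 1 + 2 * c := by
    rw [trace_eq_frame hy hn hyn R, hRy, hy, ← hc, h2]
    simp only [sub_dotProduct, smul_dotProduct, hz, dot_cross_self, smul_eq_mul]
    ring
  refine ⟨c, abs_le_one_iff_mul_self_le_one.2 (by nlinarith [sq_nonneg s]), htr, fun θ hθ => ?_⟩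
  have key : ∀ v : R3, R *ᵥ v = c • v + s • (y ⨯₃ v) + ((1 - c) * (y ⬝ᵥ v)) • y := fun v => by
    have hv := frame_expansion hy hn hyn v
    set α := v ⬝ᵥ y with hα
    set β := v ⬝ᵥ n
    set δ := v ⬝ᵥ (y ⨯₃ n)
    have e1 : R *ᵥ v = α • y + β • (c • n + s • (y ⨯₃ n)) + δ • (c • (y ⨯₃ n) - s • n) := by
      rw [hv, Matrix.mulVec_add, Matrix.mulVec_add, Matrix.mulVec_smul, Matrix.mulVec_smul,
        Matrix.mulVec_smul, hRy, h1, h2]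
    have e2 : y ⨯₃ v = β • (y ⨯₃ n) - δ • n := by
      rw [hv, map_add, map_add, map_smul, map_smul, map_smul, cross_self,
        cross_cross_self_of_perp hy hyn]
      module
    have e3 : c • v = c • (α • y + β • n + δ • (y ⨯₃ n)) := by rw [← hv]
    rw [dotProduct_comm y v, ← hα, e1, e2, e3]
    module
  have hsin : s = Real.sin θ ∨ s = -Real.sin θ := by
    rw [← sq_eq_sq_iff_eq_or_eq_neg, Real.sin_sq, hθ]; linarith
  -- the sign of the sine can be adjusted by reversing the axis
  rcases hsin with h | h
  · exact ⟨y, hy, fun v => by rw [hθ, ← h]; exact key v⟩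
  · refine ⟨-y, by simpa using hy, fun v => ?_⟩
    have h' : Real.sin θ = -s := by rw [h, neg_neg]
    rw [hθ, h', key v, map_neg, LinearMap.neg_apply, neg_dotProduct]
    module

/-- The cosine is at least quadratically sensitive: an angle whose cosine is prescribed can be
found near `Θ`, within the square root of the error. -/
theorem exists_cos_eq_near {c : ℝ} (hc : |c| ≤ 1) (Θ : ℝ) :
    ∃ θ, Real.cos θ = c ∧ (θ - Θ) ^ 2 ≤ Real.pi ^ 2 / 2 * |c - Real.cos Θ| := by
  -- the case in which both angles are in `[0, π]`
  have base : ∀ x y : ℝ, 0 ≤ x → x ≤ y → y ≤ Real.pi →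
      (y - x) ^ 2 ≤ Real.pi ^ 2 / 2 * (Real.cos x - Real.cos y) := by
    intro x y hx hxy hy
    have hpi := Real.pi_pos
    have h1 : Real.cos x - Real.cos y
        = 2 * Real.sin ((x + y) / 2) * Real.sin ((y - x) / 2) := by
      rw [Real.cos_sub_cos, show (x - y) / 2 = -((y - x) / 2) by ring, Real.sin_neg]; ring
    have h2 : 2 / Real.pi * ((y - x) / 2) ≤ Real.sin ((y - x) / 2) :=
      Real.mul_le_sin (by linarith) (by linarith)
    have h3 : Real.sin ((y - x) / 2) ≤ Real.sin ((x + y) / 2) := by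
      rcases le_total ((x + y) / 2) (Real.pi / 2) with h | h
      · exact Real.sin_le_sin_of_le_of_le_pi_div_two (by linarith) h (by linarith)
      · rw [← Real.sin_pi_sub ((x + y) / 2)]
        exact Real.sin_le_sin_of_le_of_le_pi_div_two (by linarith) (by linarith) (by linarith)
    have h4 : 0 ≤ 2 / Real.pi * ((y - x) / 2) := by
      have : 0 ≤ y - x := by linarith
      positivity
    have h5 : (2 / Real.pi * ((y - x) / 2)) * (2 / Real.pi * ((y - x) / 2))
        ≤ Real.sin ((x + y) / 2) * Real.sin ((y - x) / 2) :=
      mul_le_mul (h2.trans h3) h2 h4 (h4.trans (h2.trans h3))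
    have h6 : (y - x) ^ 2 = Real.pi ^ 2
        * ((2 / Real.pi * ((y - x) / 2)) * (2 / Real.pi * ((y - x) / 2))) := by
      field_simp
    rw [h6, h1]
    nlinarith [sq_nonneg Real.pi]
  have base' : ∀ x y : ℝ, 0 ≤ x → x ≤ Real.pi → 0 ≤ y → y ≤ Real.pi →
      (y - x) ^ 2 ≤ Real.pi ^ 2 / 2 * |Real.cos y - Real.cos x| := by
    intro x y hx hx' hy hy'
    have hpi := Real.pi_pos
    rcases le_total x y with h | h
    · refine (base x y hx h hy').trans ?_
      rw [abs_sub_comm]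
      gcongr
      exact le_abs_self _
    · have := base y x hy h hx'
      rw [← neg_sq, neg_sub]
      refine this.trans ?_
      gcongr
      exact le_abs_self _
  have hα := Real.cos_arccos (neg_le_of_abs_le hc) (le_of_abs_le hc)
  set α := Real.arccos c
  -- reduce `Θ` to `[-π, π)` and then, by the sign, to `[0, π]`
  set β := toIocMod Real.two_pi_pos (-Real.pi) Θ with hβ
  have hmem := toIocMod_mem_Ioc Real.two_pi_pos (-Real.pi) Θ
  have hΘ : Θ = β + toIocDiv Real.two_pi_pos (-Real.pi) Θ * (2 * Real.pi) := by
    have := toIocMod_add_toIocDiv_zsmul Real.two_pi_pos (-Real.pi) Θ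
    rw [zsmul_eq_mul] at this
    exact this.symm
  set n := toIocDiv Real.two_pi_pos (-Real.pi) Θ
  have hcosΘ : Real.cos Θ = Real.cos β := by rw [hΘ, Real.cos_add_int_mul_two_pi]
  rw [← hβ] at hmem
  have hb2 : β ≤ Real.pi := by linarith [hmem.2]
  rcases le_total 0 β with h | h
  · refine ⟨α + n * (2 * Real.pi), by rw [Real.cos_add_int_mul_two_pi, hα], ?_⟩
    have := base' β α h hb2 (Real.arccos_nonneg _) (Real.arccos_le_pi _)
    rw [hα] at this
    rw [hcosΘ]
    convert this using 2
    rw [hΘ]; ring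
  · refine ⟨-α + n * (2 * Real.pi), by rw [Real.cos_add_int_mul_two_pi, Real.cos_neg, hα], ?_⟩
    have := base' (-β) α (by linarith) (by linarith [hmem.1]) (Real.arccos_nonneg _)
      (Real.arccos_le_pi _)
    rw [hα, Real.cos_neg] at this
    rw [hcosΘ, ← neg_sq]
    convert this using 2
    rw [hΘ]; ring

theorem exists_rotationAngle_near (hR : R ∈ Matrix.specialOrthogonalGroup (Fin 3) ℝ) (Θ : ℝ) :
    ∃ θ, IsRotationAngle R θ ∧
      (θ - Θ) ^ 2 ≤ Real.pi ^ 2 / 4 * |R.trace - (1 + 2 * Real.cos Θ)| := by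
  obtain ⟨c, hc, htr, h⟩ := exists_rotation_cos hR
  obtain ⟨θ, h1, h2⟩ := exists_cos_eq_near hc Θ
  refine ⟨θ, h θ h1, h2.trans (le_of_eq ?_)⟩
  rw [htr, show 1 + 2 * c - (1 + 2 * Real.cos Θ) = 2 * (c - Real.cos Θ) by ring, abs_mul, abs_two]
  ring

end RotationAngles

/-! ### The extended frame is a rotation -/

section Frames
variable {x₀ : ℝ} {γ : ℝ → R3} {F : ℝ → ℝ → Matrix (Fin 3) (Fin 3) ℝ}

theorem IsExtendedFrame.hasDerivAt_row (hF : IsExtendedFrame x₀ γ F) (l s : ℝ) (i : Fin 3) :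
    HasDerivAt (fun r => (F l r i : R3)) ((l * speed γ s) • ((F l s i : R3) ⨯₃ tangent γ s)) s := by
  refine hasDerivAt_pi.2 fun j => ?_
  have h1 := hasDerivAt_pi.1 (hF.ode l s (Pi.single j 1)) i
  have h2 : ∀ r, (F l r *ᵥ Pi.single j 1) i = F l r i j := fun r => by simp
  simp only [h2] at h1
  refine h1.congr_deriv ?_
  simp only [Pi.smul_apply, smul_eq_mul]
  congr 1
  rw [show (F l s *ᵥ (tangent γ s ⨯₃ Pi.single j 1)) i
    = F l s i ⬝ᵥ (tangent γ s ⨯₃ Pi.single j 1) from rfl]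
  fin_cases j <;>
  simp [dot_eq, cross_zero, cross_one, cross_two] <;> ring

/-- The scalar products and the determinant of the rows of the frame are constant. -/
theorem IsExtendedFrame.mem_specialOrthogonalGroup (hF : IsExtendedFrame x₀ γ F) (l s : ℝ) :
    F l s ∈ Matrix.specialOrthogonalGroup (Fin 3) ℝ := by
  have hr := hF.hasDerivAt_row l
  have hdot : ∀ i j, (F l s i : R3) ⬝ᵥ (F l s j : R3) = (F l x₀ i : R3) ⬝ᵥ (F l x₀ j : R3) := by
    intro i j
    have hd : ∀ s, HasDerivAt (fun r => (F l r i : R3) ⬝ᵥ (F l r j : R3)) 0 s := fun s => by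
      refine (HasDerivAt.dot (hr s i) (hr s j)).congr_deriv ?_
      rw [smul_dotProduct, dotProduct_smul]
      simp only [dot_eq, cross_zero, cross_one, cross_two, smul_eq_mul]
      ring
    exact is_const_of_deriv_eq_zero (fun s => (hd s).differentiableAt)
      (fun s => (hd s).deriv) s x₀
  have htri : (F l s 0 : R3) ⬝ᵥ ((F l s 1 : R3) ⨯₃ (F l s 2 : R3))
      = (F l x₀ 0 : R3) ⬝ᵥ ((F l x₀ 1 : R3) ⨯₃ (F l x₀ 2 : R3)) := by
    have hd : ∀ s, HasDerivAt
        (fun r => (F l r 0 : R3) ⬝ᵥ ((F l r 1 : R3) ⨯₃ (F l r 2 : R3))) 0 s := fun s => by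
      refine (HasDerivAt.dot (hr s 0) (HasDerivAt.cross (hr s 1) (hr s 2))).congr_deriv ?_
      simp only [dot_eq, cross_zero, cross_one, cross_two, smul_eq_mul, Pi.smul_apply, Pi.add_apply]
      ring
    exact is_const_of_deriv_eq_zero (fun s => (hd s).differentiableAt)
      (fun s => (hd s).deriv) s x₀
  refine Matrix.mem_specialOrthogonalGroup_iff.2
    ⟨(Matrix.mem_orthogonalGroup_iff _ _).2 ?_, ?_⟩
  · ext i j
    have h1 : (F l s * (F l s)ᵀ) i j = (F l s i : R3) ⬝ᵥ (F l s j : R3) := rfl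
    have h2 : (F l x₀ * (F l x₀)ᵀ) i j = (F l x₀ i : R3) ⬝ᵥ (F l x₀ j : R3) := rfl
    rw [h1, hdot, ← h2, hF.initial]
    simp
  · have e : ∀ M : Matrix (Fin 3) (Fin 3) ℝ, M.det = (M 0 : R3) ⬝ᵥ ((M 1 : R3) ⨯₃ (M 2 : R3)) :=
      fun M => by
        rw [Matrix.det_fin_three]
        simp only [dot_eq, cross_zero, cross_one, cross_two]
        ring
    rw [e, htri, ← e, hF.initial, Matrix.det_one]

/-- The derivative of `F ξ` for a vector field `ξ` along the curve. -/
theorem IsExtendedFrame.hasDerivAt_mulVec (hF : IsExtendedFrame x₀ γ F) (l s : ℝ) {ξ : ℝ → R3}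
    {ξ' : R3} (hξ : HasDerivAt ξ ξ' s) :
    HasDerivAt (fun r => F l r *ᵥ ξ r)
      (F l s *ᵥ ((l * speed γ s) • (tangent γ s ⨯₃ ξ s) + ξ')) s := by
  refine hasDerivAt_pi.2 fun i => ?_
  refine (HasDerivAt.dot (hF.hasDerivAt_row l s i) hξ).congr_deriv ?_
  rw [show (F l s *ᵥ ((l * speed γ s) • (tangent γ s ⨯₃ ξ s) + ξ')) i
    = F l s i ⬝ᵥ ((l * speed γ s) • (tangent γ s ⨯₃ ξ s) + ξ') from rfl, dotProduct_add,
    smul_dotProduct, dotProduct_smul, cross_dot_eq]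

end Frames

/-! ### Estimates for vectors and frames -/

section Estimates

theorem dot_sq_le (x y : R3) : (x ⬝ᵥ y) ^ 2 ≤ (x ⬝ᵥ x) * (y ⬝ᵥ y) := by
  have h := dot_self_nonneg (x ⨯₃ y)
  rw [cross_dot_cross, dotProduct_comm y x] at h
  linarith

theorem abs_dot_le {x y : R3} {a b : ℝ} (ha : 0 ≤ a) (hb : 0 ≤ b) (hx : x ⬝ᵥ x ≤ a ^ 2)
    (hy : y ⬝ᵥ y ≤ b ^ 2) : |x ⬝ᵥ y| ≤ a * b := by
  refine abs_le_of_sq_le_sq ((dot_sq_le x y).trans ?_) (mul_nonneg ha hb)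
  rw [mul_pow]
  exact mul_le_mul hx hy (dot_self_nonneg y) (sq_nonneg a)

theorem cross_dot_self_le (x y : R3) : (x ⨯₃ y) ⬝ᵥ (x ⨯₃ y) ≤ (x ⬝ᵥ x) * (y ⬝ᵥ y) := by
  rw [cross_dot_cross, dotProduct_comm y x]
  nlinarith [sq_nonneg (x ⬝ᵥ y)]

theorem abs_apply_le {x : R3} {a : ℝ} (ha : 0 ≤ a) (hx : x ⬝ᵥ x ≤ a ^ 2) (i : Fin 3) :
    |x i| ≤ a := by
  refine abs_le_of_sq_le_sq (le_trans ?_ hx) ha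
  rw [dot_eq]
  have h0 := mul_self_nonneg (x 0)
  have h1 := mul_self_nonneg (x 1)
  have h2 := mul_self_nonneg (x 2)
  fin_cases i <;> simp <;> nlinarith

theorem norm_le_of_dot_self_le {x : R3} {a : ℝ} (ha : 0 ≤ a) (hx : x ⬝ᵥ x ≤ a ^ 2) : ‖x‖ ≤ a :=
  (pi_norm_le_iff_of_nonneg ha).2 fun i => abs_apply_le ha hx i

theorem dot_self_le_of_norm_le {x : R3} {a : ℝ} (hx : ‖x‖ ≤ a) :
    x ⬝ᵥ x ≤ (2 * a) ^ 2 := by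
  have h : ∀ i, x i * x i ≤ a ^ 2 := fun i => by
    rw [← pow_two, sq_le_sq]
    exact ((norm_le_pi_norm x i).trans hx).trans (le_abs_self a)
  rw [dot_eq]
  nlinarith [h 0, h 1, h 2, sq_nonneg a]

/-- A vector function on an interval of length `p` whose derivative has length at most `κ`. -/
theorem dot_self_sub_le {x₀ p κ : ℝ} (hp : 0 ≤ p) (hκ : 0 ≤ κ) {f f' : ℝ → R3}
    (hf : ∀ s, HasDerivAt f (f' s) s)
    (hb : ∀ s ∈ Set.Icc x₀ (x₀ + p), f' s ⬝ᵥ f' s ≤ κ ^ 2) :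
    (f (x₀ + p) - f x₀) ⬝ᵥ (f (x₀ + p) - f x₀) ≤ (2 * (κ * p)) ^ 2 := by
  refine dot_self_le_of_norm_le ?_
  have := norm_image_sub_le_of_norm_deriv_le_segment' (f := f) (f' := f') (C := κ) (a := x₀)
    (b := x₀ + p) (fun s _ => (hf s).hasDerivWithinAt)
    (fun s hs => norm_le_of_dot_self_le hκ (hb s ⟨hs.1, hs.2.le⟩)) (x₀ + p)
    ⟨by linarith, le_rfl⟩
  rwa [add_sub_cancel_left] at this

/-- If the orthonormal frames `f₀, g₀, f₀ × g₀` and `f₁, g₁, f₁ × g₁` are close, then a rotation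
which takes the first to the second turned by `Θ` about `f₁` has almost the trace of a rotation by
the angle `Θ`. -/
theorem abs_trace_sub_le {R : Matrix (Fin 3) (Fin 3) ℝ}
    (hR : R ∈ Matrix.specialOrthogonalGroup (Fin 3) ℝ) {f₀ f₁ g₀ g₁ : R3} {Θ D : ℝ} (hD : 0 ≤ D)
    (hf0 : f₀ ⬝ᵥ f₀ = 1) (hg0 : g₀ ⬝ᵥ g₀ = 1) (h0 : f₀ ⬝ᵥ g₀ = 0)
    (hf1 : f₁ ⬝ᵥ f₁ = 1) (hg1 : g₁ ⬝ᵥ g₁ = 1) (h1 : f₁ ⬝ᵥ g₁ = 0)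
    (hf : (f₁ - f₀) ⬝ᵥ (f₁ - f₀) ≤ D ^ 2) (hg : (g₁ - g₀) ⬝ᵥ (g₁ - g₀) ≤ D ^ 2)
    (hRf : R *ᵥ f₀ = f₁) (hRg : R *ᵥ g₀ = Real.cos Θ • g₁ + Real.sin Θ • (f₁ ⨯₃ g₁)) :
    |R.trace - (1 + 2 * Real.cos Θ)| ≤ 7 * D := by
  have hk0 := cross_dot_cross_self hf0 hg0 h0
  have hRh : R *ᵥ (f₀ ⨯₃ g₀) = Real.cos Θ • (f₁ ⨯₃ g₁) - Real.sin Θ • g₁ := by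
    rw [← mulVec_cross_mulVec hR, hRf, hRg, map_add, map_smul, map_smul,
      cross_cross_self_of_perp hf1 h1, smul_neg, sub_eq_add_neg]
  have hb : ∀ {d y : R3}, d ⬝ᵥ d ≤ D ^ 2 → y ⬝ᵥ y ≤ 1 → |d ⬝ᵥ y| ≤ D := fun {d y} hd hy => by
    simpa using abs_dot_le hD zero_le_one hd (by simpa using hy)
  have hcr : ∀ {y z : R3}, y ⬝ᵥ y = 1 → z ⬝ᵥ z = 1 → (y ⨯₃ z) ⬝ᵥ (y ⨯₃ z) ≤ 1 :=
    fun {y z} hy hz => by simpa [hy, hz] using cross_dot_self_le y z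
  have hprod : ∀ {y : R3}, y ⬝ᵥ y = 1 → |(f₁ ⨯₃ g₁ - f₀ ⨯₃ g₀) ⬝ᵥ y| ≤ 2 * D := fun {y} hy => by
    have e : (f₁ ⨯₃ g₁ - f₀ ⨯₃ g₀) ⬝ᵥ y
        = (f₁ - f₀) ⬝ᵥ (g₁ ⨯₃ y) + (g₁ - g₀) ⬝ᵥ (y ⨯₃ f₀) := by
      simp only [dot_eq, cross_zero, cross_one, cross_two, Pi.sub_apply]; ring
    rw [e, two_mul]
    exact (abs_add_le _ _).trans (add_le_add (hb hf (hcr hg1 hy)) (hb hg (hcr hy hf0)))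
  have e : R.trace - (1 + 2 * Real.cos Θ) = (f₁ - f₀) ⬝ᵥ f₀
      + Real.cos Θ * ((g₁ - g₀) ⬝ᵥ g₀ + (f₁ ⨯₃ g₁ - f₀ ⨯₃ g₀) ⬝ᵥ (f₀ ⨯₃ g₀))
      + Real.sin Θ * ((f₁ ⨯₃ g₁ - f₀ ⨯₃ g₀) ⬝ᵥ g₀ - (g₁ - g₀) ⬝ᵥ (f₀ ⨯₃ g₀)) := by
    rw [trace_eq_frame hf0 hg0 h0 R, hRf, hRg, hRh]
    simp only [sub_dotProduct, add_dotProduct, smul_dotProduct, hf0, hg0, hk0, smul_eq_mul,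
      dot_cross_self, dotProduct_comm (f₀ ⨯₃ g₀) g₀]
    ring
  have b1 := hb hf hf0.le
  have b2 : |Real.cos Θ * ((g₁ - g₀) ⬝ᵥ g₀ + (f₁ ⨯₃ g₁ - f₀ ⨯₃ g₀) ⬝ᵥ (f₀ ⨯₃ g₀))|
      ≤ 1 * (D + 2 * D) := by
    rw [abs_mul]
    exact mul_le_mul (Real.abs_cos_le_one Θ)
      ((abs_add_le _ _).trans (add_le_add (hb hg hg0.le) (hprod hk0))) (abs_nonneg _) zero_le_one
  have b3 : |Real.sin Θ * ((f₁ ⨯₃ g₁ - f₀ ⨯₃ g₀) ⬝ᵥ g₀ - (g₁ - g₀) ⬝ᵥ (f₀ ⨯₃ g₀))|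
      ≤ 1 * (2 * D + D) := by
    rw [abs_mul]
    exact mul_le_mul (Real.abs_sin_le_one Θ)
      ((abs_sub _ _).trans (add_le_add (hprod hg0) (hb hg hk0.le))) (abs_nonneg _) zero_le_one
  rw [e]
  refine (abs_add_le _ _).trans ((add_le_add ((abs_add_le _ _).trans (add_le_add b1 b2)) b3).trans
    (le_of_eq (by ring)))

end Estimates

/-! ### Almost parallel fields and the trace of the monodromy -/

section FrameComparison
variable {x₀ p : ℝ} {A : Matrix (Fin 3) (Fin 3) ℝ} {γ : ℝ → R3}
  {F : ℝ → ℝ → Matrix (Fin 3) (Fin 3) ℝ}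

/-- The vector `λ |γ̇| T × u + u˙`, which `F` takes to the derivative of `F u`. It measures how far
the field `u` is from being fixed by the extended frame. -/
def frameDefect (γ : ℝ → R3) (l : ℝ) (u : ℝ → R3) (s : ℝ) : R3 :=
  (l * speed γ s) • (tangent γ s ⨯₃ u s) + deriv u s

/-- If `F u` is nearly constant, then so is `F η`, where the normal field `η` of `u` turns against
the frame; hence the monodromy angle of `η` is close to a rotation angle of `F A`. -/
theorem IsExtendedFrame.abs_trace_sub_le (hF : IsExtendedFrame x₀ γ F) (hp : 0 ≤ p)
    (hA : A ∈ Matrix.specialOrthogonalGroup (Fin 3) ℝ) (l : ℝ) {u η : ℝ → R3} (hu : IsUnitField u)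
    (huA : u (x₀ + p) = A *ᵥ u x₀)
    (hη : IsRotatingNormal u (fun s => -(l * speed γ s * (tangent γ s ⬝ᵥ u s))) η) {Θ κ : ℝ}
    (hΘ : HasMonodromyAngle x₀ p A u η Θ) (hκ : 0 ≤ κ)
    (hb : ∀ s, frameDefect γ l u s ⬝ᵥ frameDefect γ l u s ≤ κ ^ 2) :
    |(F l (x₀ + p) * A).trace - (1 + 2 * Real.cos Θ)| ≤ 14 * (κ * p) := by
  have hO := hF.mem_specialOrthogonalGroup l
  have hf : ∀ s, HasDerivAt (fun r => F l r *ᵥ u r) (F l s *ᵥ frameDefect γ l u s) s := fun s =>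
    hF.hasDerivAt_mulVec l s (hasDerivAt_of_smooth hu.smooth s)
  -- the angular velocity of `η` cancels the normal part of the derivative of `F η`; what remains
  -- points along `F u`
  have hg : ∀ s, HasDerivAt (fun r => F l r *ᵥ η r)
      (F l s *ᵥ (-(frameDefect γ l u s ⬝ᵥ η s) • u s)) s := fun s => by
    convert hF.hasDerivAt_mulVec l s (hη.hasDerivAt s) using 2
    have h1 := frame_expansion (hu.unit s) (hη.unit s) (hη.normal s) (tangent γ s ⨯₃ η s)
    have h2 : (tangent γ s ⨯₃ η s) ⬝ᵥ η s = 0 := by rw [dotProduct_comm, dot_cross_self]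
    have h3 : (tangent γ s ⨯₃ η s) ⬝ᵥ (u s ⨯₃ η s) = tangent γ s ⬝ᵥ u s := by
      rw [cross_dot_cross, hη.unit, dotProduct_comm (η s) (u s), hη.normal]; ring
    have h4 : (tangent γ s ⨯₃ η s) ⬝ᵥ u s = -((tangent γ s ⨯₃ u s) ⬝ᵥ η s) := by
      simp only [dot_eq, cross_zero, cross_one, cross_two]; ring
    rw [h1, h2, h3, h4, frameDefect, add_dotProduct, smul_dotProduct,
      dotProduct_comm (deriv u s), smul_eq_mul]
    module
  have hb1 : ∀ s, (F l s *ᵥ frameDefect γ l u s) ⬝ᵥ (F l s *ᵥ frameDefect γ l u s) ≤ κ ^ 2 :=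
    fun s => by rw [mulVec_dot_mulVec (hO s)]; exact hb s
  have hb2 : ∀ s, (F l s *ᵥ (-(frameDefect γ l u s ⬝ᵥ η s) • u s))
      ⬝ᵥ (F l s *ᵥ (-(frameDefect γ l u s ⬝ᵥ η s) • u s)) ≤ κ ^ 2 := fun s => by
    have h := (dot_sq_le (frameDefect γ l u s) (η s)).trans
      (mul_le_mul (hb s) (hη.unit s).le (dot_self_nonneg _) (sq_nonneg κ))
    rw [mulVec_dot_mulVec (hO s), smul_dotProduct, dotProduct_smul, hu.unit]
    simp only [smul_eq_mul]
    linarith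
  have h1 : ∀ v : R3, F l x₀ *ᵥ v = v := fun v => by rw [hF.initial, Matrix.one_mulVec]
  have k1 := dot_self_sub_le (x₀ := x₀) hp hκ hf fun s _ => hb1 s
  have k2 := dot_self_sub_le (x₀ := x₀) hp hκ hg fun s _ => hb2 s
  simp only [h1] at k1 k2
  have hR : F l (x₀ + p) * A ∈ Matrix.specialOrthogonalGroup (Fin 3) ℝ := mul_mem (hO _) hA
  have := SpaceCurve.abs_trace_sub_le hR (f₀ := u x₀) (g₀ := η x₀) (Θ := Θ)
    (D := 2 * (κ * p)) (by positivity) (hu.unit _) (hη.unit _) (hη.normal _)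
    (by rw [mulVec_dot_mulVec (hO _)]; exact hu.unit _)
    (by rw [mulVec_dot_mulVec (hO _)]; exact hη.unit _)
    (by rw [mulVec_dot_mulVec (hO _)]; exact hη.normal _) k1 k2
    (by rw [← Matrix.mulVec_mulVec, ← huA])
    (by rw [← Matrix.mulVec_mulVec, hΘ, Matrix.mulVec_add, Matrix.mulVec_smul, Matrix.mulVec_smul,
          mulVec_cross_mulVec (hO _)])
  linarith

/-- The difference of the torsion rates of `T` and `u`, in terms of the defect of `u`. -/
theorem areaRate_add_eq {p : ℝ} {a : R3} (hγ : γ ∈ curveSpace p A a) (l : ℝ) {u : ℝ → R3} {s : ℝ}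
    (hu : u s ⬝ᵥ u s = 1) (h : 1 + tangent γ s ⬝ᵥ u s ≠ 0) :
    areaRate (tangent γ) u s + l * speed γ s * (tangent γ s ⬝ᵥ u s)
      = l * speed γ s
        + speed γ s * ((flowY γ 1 s ⬝ᵥ u s) * (1 + tangent γ s ⬝ᵥ u s)⁻¹)
        - ((tangent γ s ⨯₃ u s) ⬝ᵥ frameDefect γ l u s) * (1 + tangent γ s ⬝ᵥ u s)⁻¹ := by
  have hT := tangent_dot_self (hγ.2.1 s)
  have h1 := tangent_dot_flowY_one (hγ.2.1 s)
  have dT : deriv (tangent γ) s = -(speed γ s • (tangent γ s ⨯₃ flowY γ 1 s)) := by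
    have := (hasDerivAt_flowY hγ 0 s).deriv
    rwa [flowY_zero] at this
  have e1 : (tangent γ s ⨯₃ u s) ⬝ᵥ deriv (tangent γ) s = -(speed γ s * (flowY γ 1 s ⬝ᵥ u s)) := by
    rw [dT, dotProduct_neg, dotProduct_smul, cross_dot_cross, hT, h1, dotProduct_comm (u s)]
    simp
  have e2 : (tangent γ s ⨯₃ u s) ⬝ᵥ deriv u s = (tangent γ s ⨯₃ u s) ⬝ᵥ frameDefect γ l u s
      - l * speed γ s * (1 - (tangent γ s ⬝ᵥ u s) ^ 2) := by
    rw [frameDefect, dotProduct_add, dotProduct_smul, cross_dot_cross, hT, hu,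
      dotProduct_comm (u s) (tangent γ s), smul_eq_mul]
    ring
  rw [areaRate, dotProduct_add, e1, e2]
  field_simp
  ring

end FrameComparison

/-! ### Truncated power series -/

section TruncatedSeries
open Finset PowerSeries

/-- The value at `ε` of the truncation of a power series after the power `N`. -/
def truncEval (N : ℕ) (f : PowerSeries ℝ) (ε : ℝ) : ℝ := ∑ n ∈ range (N + 1), coeff n f * ε ^ n

/-- A bound of the truncated series on `|ε| ≤ 1`. -/
def truncNorm (N : ℕ) (f : PowerSeries ℝ) : ℝ := ∑ n ∈ range (N + 1), |coeff n f|

theorem truncNorm_nonneg (N : ℕ) (f : PowerSeries ℝ) : 0 ≤ truncNorm N f :=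
  sum_nonneg fun _ _ => abs_nonneg _

theorem abs_truncEval_le (N : ℕ) (f : PowerSeries ℝ) {ε : ℝ} (hε : |ε| ≤ 1) :
    |truncEval N f ε| ≤ truncNorm N f := by
  refine (abs_sum_le_sum_abs _ _).trans (sum_le_sum fun n _ => ?_)
  rw [abs_mul, abs_pow]
  exact mul_le_of_le_one_right (abs_nonneg _) (pow_le_one₀ (abs_nonneg _) hε)

theorem abs_truncEval_sub_le (N : ℕ) (f : PowerSeries ℝ) {ε : ℝ} (hε : |ε| ≤ 1) :
    |truncEval N f ε - coeff 0 f| ≤ truncNorm N f * |ε| := by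
  rw [truncEval, sum_range_succ', pow_zero, mul_one, add_sub_cancel_right, truncNorm,
    sum_range_succ', add_mul, sum_mul]
  refine (abs_sum_le_sum_abs _ _).trans
    ((sum_le_sum fun n _ => ?_).trans (le_add_of_nonneg_right (by positivity)))
  rw [abs_mul, abs_pow, pow_succ]
  gcongr
  exact mul_le_of_le_one_left (abs_nonneg _) (pow_le_one₀ (abs_nonneg _) hε)

/-- Truncated series multiply up to terms beyond the truncation. -/
theorem abs_truncEval_mul_sub_le (N : ℕ) (f g : PowerSeries ℝ) {ε : ℝ} (hε : |ε| ≤ 1) :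
    |truncEval N f ε * truncEval N g ε - truncEval N (f * g) ε|
      ≤ truncNorm N f * truncNorm N g * |ε| ^ (N + 1) := by
  let G : ℕ × ℕ → ℝ := fun q => coeff q.1 f * coeff q.2 g * ε ^ (q.1 + q.2)
  have h1 : truncEval N f ε * truncEval N g ε = ∑ q ∈ range (N + 1) ×ˢ range (N + 1), G q := by
    rw [truncEval, truncEval, sum_mul_sum, sum_product]
    refine sum_congr rfl fun i _ => sum_congr rfl fun j _ => ?_
    simp only [G, pow_add]; ring
  have h2 : truncEval N (f * g) ε
      = ∑ q ∈ (range (N + 1) ×ˢ range (N + 1)).filter (fun q => q.1 + q.2 < N + 1), G q := by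
    rw [← sum_fiberwise_of_maps_to (t := range (N + 1)) (g := fun q : ℕ × ℕ => q.1 + q.2)
      (fun q hq => mem_range.2 (mem_filter.1 hq).2)]
    refine sum_congr rfl fun n hn => ?_
    have e : ((range (N + 1) ×ˢ range (N + 1)).filter (fun q => q.1 + q.2 < N + 1)).filter
        (fun q => q.1 + q.2 = n) = antidiagonal n := by
      ext q
      simp only [mem_filter, mem_product, mem_range, HasAntidiagonal.mem_antidiagonal] at hn ⊢
      omega
    rw [e, coeff_mul, sum_mul]
    exact sum_congr rfl fun q hq => by simp only [G, HasAntidiagonal.mem_antidiagonal.1 hq]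
  have h3 : truncEval N f ε * truncEval N g ε - truncEval N (f * g) ε
      = ∑ q ∈ (range (N + 1) ×ˢ range (N + 1)).filter (fun q => ¬ q.1 + q.2 < N + 1), G q := by
    rw [h1, h2, ← sum_filter_add_sum_filter_not _ (fun q : ℕ × ℕ => q.1 + q.2 < N + 1) G,
      add_sub_cancel_left]
  rw [h3]
  have h4 : truncNorm N f * truncNorm N g * |ε| ^ (N + 1)
      = ∑ q ∈ range (N + 1) ×ˢ range (N + 1),
        |coeff q.1 f| * |coeff q.2 g| * |ε| ^ (N + 1) := by
    rw [truncNorm, truncNorm, sum_mul_sum, sum_product, sum_mul]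
    exact sum_congr rfl fun i _ => by rw [sum_mul]
  rw [h4]
  refine (abs_sum_le_sum_abs _ _).trans ((sum_le_sum fun q hq => ?_).trans
    (sum_le_sum_of_subset_of_nonneg (filter_subset _ _) fun _ _ _ => by positivity))
  simp only [G, abs_mul, abs_pow]
  have : N + 1 ≤ q.1 + q.2 := not_lt.1 (mem_filter.1 hq).2
  exact mul_le_mul_of_nonneg_left (pow_le_pow_of_le_one (abs_nonneg _) hε this) (by positivity)

theorem truncEval_add (N : ℕ) (f g : PowerSeries ℝ) (ε : ℝ) :
    truncEval N (f + g) ε = truncEval N f ε + truncEval N g ε := by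
  simp only [truncEval, map_add, add_mul, sum_add_distrib]

theorem truncEval_one (N : ℕ) (ε : ℝ) : truncEval N 1 ε = 1 := by
  simp [truncEval, coeff_one, ite_mul]

end TruncatedSeries

/-! ### Partial sums of the formal unit field -/

section TruncatedField
open Finset PowerSeries
variable {p : ℝ} {A : Matrix (Fin 3) (Fin 3) ℝ} {a : R3} {γ : ℝ → R3}

/-- The partial sum `∑_{k ≤ N} ε^k Y_k` of the formal unit field. -/
def truncField (γ : ℝ → R3) (N : ℕ) (ε s : ℝ) : R3 := ∑ k ∈ range (N + 1), ε ^ k • flowY γ k s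

/-- The length of the partial sum, which is close to `1` for small `ε`. -/
def truncLength (γ : ℝ → R3) (N : ℕ) (ε s : ℝ) : ℝ :=
  Real.sqrt (truncField γ N ε s ⬝ᵥ truncField γ N ε s)

/-- The normalized partial sum. -/
def unitTruncField (γ : ℝ → R3) (N : ℕ) (ε s : ℝ) : R3 :=
  (truncLength γ N ε s)⁻¹ • truncField γ N ε s

theorem contDiff_truncField (hγ : γ ∈ curveSpace p A a) (N : ℕ) (ε : ℝ) :
    ContDiff ℝ ∞ (truncField γ N ε) :=
  ContDiff.sum fun k _ => (contDiff_flowY hγ k).const_smul (ε ^ k)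

theorem truncField_equivariant (hA : A ∈ Matrix.specialOrthogonalGroup (Fin 3) ℝ)
    (hγ : γ ∈ curveSpace p A a) (N : ℕ) (ε s : ℝ) :
    truncField γ N ε (s + p) = A *ᵥ truncField γ N ε s := by
  simp only [truncField, flowY_equivariant hA hγ, Matrix.mulVec_sum, Matrix.mulVec_smul]

theorem unitTruncField_equivariant (hA : A ∈ Matrix.specialOrthogonalGroup (Fin 3) ℝ)
    (hγ : γ ∈ curveSpace p A a) (N : ℕ) (ε s : ℝ) :
    unitTruncField γ N ε (s + p) = A *ᵥ unitTruncField γ N ε s := by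
  simp only [unitTruncField, truncLength, truncField_equivariant hA hγ, mulVec_dot_mulVec hA,
    Matrix.mulVec_smul]

/-- The partial sum satisfies the equation of the formal solution up to its last term: the sum
telescopes. -/
theorem frameDefect_truncField (hγ : γ ∈ curveSpace p A a) (N : ℕ) {l : ℝ} (hl : l ≠ 0) (s : ℝ) :
    frameDefect γ l (truncField γ N l⁻¹) s
      = -((speed γ s * l⁻¹ ^ N) • (tangent γ s ⨯₃ flowY γ (N + 1) s)) := by
  have h1 : deriv (truncField γ N l⁻¹) s
      = ∑ k ∈ range (N + 1), l⁻¹ ^ k • -(speed γ s • (tangent γ s ⨯₃ flowY γ (k + 1) s)) :=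
    (HasDerivAt.fun_sum fun k _ => (hasDerivAt_flowY hγ k s).const_smul (l⁻¹ ^ k)).deriv
  rw [frameDefect, h1, truncField, map_sum]
  simp only [map_smul]
  rw [sum_range_succ', flowY_zero, cross_self, smul_zero, add_zero, sum_range_succ, smul_sum,
    ← add_assoc, ← sum_add_distrib, sum_eq_zero, zero_add, smul_neg, smul_smul, mul_comm]
  intro k _
  have : l * l⁻¹ ^ (k + 1) = l⁻¹ ^ k := by rw [pow_succ]; field_simp
  rw [smul_smul, mul_right_comm, this, smul_neg, smul_smul, add_neg_cancel]

/-- Normalization removes from the defect its component along the field. -/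
theorem frameDefect_unitTruncField (hγ : γ ∈ curveSpace p A a) (N : ℕ) (ε l : ℝ) {s : ℝ}
    (h : truncField γ N ε s ⬝ᵥ truncField γ N ε s ≠ 0) :
    frameDefect γ l (unitTruncField γ N ε) s ⬝ᵥ frameDefect γ l (unitTruncField γ N ε) s
      ≤ (truncField γ N ε s ⬝ᵥ truncField γ N ε s)⁻¹
        * (frameDefect γ l (truncField γ N ε) s ⬝ᵥ frameDefect γ l (truncField γ N ε) s) := by
  set w := truncField γ N ε with hw
  have hpos : 0 < w s ⬝ᵥ w s := lt_of_le_of_ne (dot_self_nonneg _) (Ne.symm h)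
  have hr : truncLength γ N ε s * truncLength γ N ε s = w s ⬝ᵥ w s :=
    Real.mul_self_sqrt hpos.le
  have hr0 : truncLength γ N ε s ≠ 0 := fun h0 => h (by rw [← hr, h0, zero_mul])
  have dw := hasDerivAt_of_smooth (contDiff_truncField hγ N ε) s
  have dr : HasDerivAt (truncLength γ N ε)
      ((w s ⬝ᵥ deriv w s) / truncLength γ N ε s) s := by
    refine ((HasDerivAt.dot dw dw).sqrt h).congr_deriv ?_
    rw [dotProduct_comm (deriv w s), ← two_mul, mul_div_mul_left _ _ two_ne_zero]
    rfl
  have du := (dr.inv hr0).smul dw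
  set r := truncLength γ N ε s
  -- the term `T × w` of the defect is orthogonal to `w`
  have hE : w s ⬝ᵥ deriv w s = w s ⬝ᵥ frameDefect γ l w s := by
    rw [frameDefect, dotProduct_add, dotProduct_smul, dot_cross_self]; simp
  have e : frameDefect γ l (unitTruncField γ N ε) s
      = r⁻¹ • frameDefect γ l w s - (r⁻¹ ^ 3 * (w s ⬝ᵥ frameDefect γ l w s)) • w s := by
    have : deriv (unitTruncField γ N ε) s = _ := du.deriv
    rw [frameDefect, this, ← hE, unitTruncField, map_smul, frameDefect]
    simp only [Pi.inv_apply, show truncLength γ N ε s = r from rfl]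
    match_scalars <;> field_simp
  have e2 : frameDefect γ l (unitTruncField γ N ε) s ⬝ᵥ frameDefect γ l (unitTruncField γ N ε) s
      = (w s ⬝ᵥ w s)⁻¹ * (frameDefect γ l w s ⬝ᵥ frameDefect γ l w s)
        - (r⁻¹ * r⁻¹ * (w s ⬝ᵥ frameDefect γ l w s)) ^ 2 := by
    rw [e]
    simp only [sub_dotProduct, dotProduct_sub, smul_dotProduct, dotProduct_smul, smul_eq_mul,
      dotProduct_comm (frameDefect γ l w s) (w s), ← hr]
    field_simp
    ring
  rw [e2]
  linarith [sq_nonneg (r⁻¹ * r⁻¹ * (w s ⬝ᵥ frameDefect γ l w s))]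

theorem truncField_apply (N : ℕ) (ε s : ℝ) (i : Fin 3) :
    truncField γ N ε s i = truncEval N (hierarchySeries γ s i) ε := by
  simp only [truncField, truncEval, hierarchySeries, vecSeries, coeff_mk, Finset.sum_apply,
    Pi.smul_apply, smul_eq_mul]
  exact sum_congr rfl fun k _ => mul_comm _ _

theorem dot_truncField (c : R3) (N : ℕ) (ε s : ℝ) :
    c ⬝ᵥ truncField γ N ε s = truncEval N (constVec c ⬝ᵥ hierarchySeries γ s) ε := by
  simp only [truncField, truncEval, hierarchySeries, coeff_constVec_dot_vecSeries,
    dotProduct_sum, dotProduct_smul, smul_eq_mul]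
  exact sum_congr rfl fun k _ => mul_comm _ _

end TruncatedField

/-! ### Bounds over the whole curve -/

section UniformBounds
open Finset PowerSeries
variable {p : ℝ} {A : Matrix (Fin 3) (Fin 3) ℝ} {a : R3} {γ : ℝ → R3}

theorem densitySeries_periodic (hA : A ∈ Matrix.specialOrthogonalGroup (Fin 3) ℝ)
    (hγ : γ ∈ curveSpace p A a) (s : ℝ) : densitySeries γ (s + p) = densitySeries γ s := by
  simp only [densitySeries, tangent_equivariant hA hγ, flowY_equivariant hA hγ,
    mulVec_dot_mulVec hA]

theorem continuous_coeff_densitySeries (hγ : γ ∈ curveSpace p A a) (n : ℕ) :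
    Continuous fun s => coeff n (densitySeries γ s) := by
  have h1 := ((JointSmoothOn.coeff_density (ImmersedFamily.const hγ) n).contDiff_s (t := 0)
    fun _ => Set.mem_univ _).continuous
  have h2 := (contDiff_speed hγ).continuous
  have h3 := fun s => (speed_pos (hγ.2.1 s)).ne'
  refine (h1.div h2 h3 |>.const_smul (2 : ℝ)).congr fun s => ?_
  have := h3 s
  change (2 : ℝ) * (coeff n _ / speed γ s) = _
  rw [coeff_C_mul, coeff_C_mul]
  field_simp

/-- `B` bounds the speed, the fields `Y_k`, `k ≤ N + 1`, and the truncated density. -/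
structure IsHierarchyBound (γ : ℝ → R3) (N : ℕ) (B : ℝ) (s : ℝ) : Prop where
  one_le : 1 ≤ B
  speed_le : speed γ s ≤ B
  flowY_le : ∀ k ≤ N + 1, flowY γ k s ⬝ᵥ flowY γ k s ≤ B ^ 2
  density_le : truncNorm N (PowerSeries.C (1 / 2 : ℝ) * densitySeries γ s) ≤ B

/-- By periodicity the quantities in question are bounded on the whole line. -/
theorem exists_isHierarchyBound (hp : 0 < p) (hA : A ∈ Matrix.specialOrthogonalGroup (Fin 3) ℝ)
    (hγ : γ ∈ curveSpace p A a) (N : ℕ) : ∃ B, ∀ s, IsHierarchyBound γ N B s := by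
  let G : ℝ → ℝ := fun s => 1 + speed γ s + ∑ k ∈ range (N + 2), flowY γ k s ⬝ᵥ flowY γ k s
    + truncNorm N (PowerSeries.C (1 / 2 : ℝ) * densitySeries γ s)
  have hc : Continuous G := by
    refine ((continuous_const.add (contDiff_speed hγ).continuous).add
      (continuous_finsetSum _ fun k _ => ?_)).add (continuous_finsetSum _ fun k _ => ?_)
    · exact (ContDiff.dot (contDiff_flowY hγ k) (contDiff_flowY hγ k)).continuous
    · simp only [coeff_C_mul]
      exact (continuous_const.mul (continuous_coeff_densitySeries hγ k)).abs
  have hper : Function.Periodic G p := fun s => by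
    simp only [G, speed_periodic hA hγ, flowY_equivariant hA hγ, mulVec_dot_mulVec hA,
      densitySeries_periodic hA hγ]
  obtain ⟨B, hB⟩ := (hper.isBounded_of_continuous hp.ne' hc).exists_norm_le
  refine ⟨B, fun s => ?_⟩
  have h1 : G s ≤ B := (le_abs_self _).trans (hB _ ⟨s, rfl⟩)
  have h2 := (speed_pos (hγ.2.1 s)).le
  have h3 : ∀ k ∈ range (N + 2), 0 ≤ flowY γ k s ⬝ᵥ flowY γ k s := fun k _ => dot_self_nonneg _
  have h4 := sum_nonneg h3
  have h5 := truncNorm_nonneg N (PowerSeries.C (1 / 2 : ℝ) * densitySeries γ s)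
  simp only [G] at h1
  have h6 : 1 ≤ B := by linarith
  refine ⟨h6, by linarith, fun k hk => ?_, by linarith⟩
  have := single_le_sum h3 (mem_range.2 (by omega : k < N + 2))
  nlinarith

variable {N : ℕ} {B s ε : ℝ}

theorem IsHierarchyBound.truncNorm_apply_le (h : IsHierarchyBound γ N B s) (i : Fin 3) :
    truncNorm N (hierarchySeries γ s i) ≤ (N + 1) * B := by
  refine (sum_le_card_nsmul _ _ B fun n hn => ?_).trans (by simp)
  simp only [hierarchySeries, vecSeries, coeff_mk]
  exact abs_apply_le (zero_le_one.trans h.one_le)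
    (h.flowY_le n (by have := mem_range.1 hn; omega)) i

theorem IsHierarchyBound.truncNorm_dot_le (h : IsHierarchyBound γ N B s) {c : R3}
    (hc : c ⬝ᵥ c = 1) : truncNorm N (constVec c ⬝ᵥ hierarchySeries γ s) ≤ (N + 1) * B := by
  refine (sum_le_card_nsmul _ _ B fun n hn => ?_).trans (by simp)
  rw [hierarchySeries, coeff_constVec_dot_vecSeries]
  simpa using abs_dot_le zero_le_one (zero_le_one.trans h.one_le) (by simpa using hc.le)
    (h.flowY_le n (by have := mem_range.1 hn; omega))

theorem IsHierarchyBound.abs_dot_self_sub_one_le (h : IsHierarchyBound γ N B s)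
    (hs : deriv γ s ≠ 0) (hε : |ε| ≤ 1) :
    |truncField γ N ε s ⬝ᵥ truncField γ N ε s - 1| ≤ 3 * ((N + 1) * B) ^ 2 * |ε| ^ (N + 1) := by
  have h1 : (1 : ℝ) = truncEval N (hierarchySeries γ s ⬝ᵥ hierarchySeries γ s) ε := by
    rw [hierarchySeries_dot_self hs, truncEval_one]
  have h2 : ∀ i, |truncEval N (hierarchySeries γ s i) ε * truncEval N (hierarchySeries γ s i) ε
      - truncEval N (hierarchySeries γ s i * hierarchySeries γ s i) ε|
      ≤ ((N + 1) * B) ^ 2 * |ε| ^ (N + 1) := fun i => by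
    refine (abs_truncEval_mul_sub_le N _ _ hε).trans ?_
    rw [pow_two]
    have := h.truncNorm_apply_le i
    have h0 := truncNorm_nonneg N (hierarchySeries γ s i)
    exact mul_le_mul_of_nonneg_right (mul_le_mul this this h0 (h0.trans this)) (by positivity)
  rw [dot_eq, truncEval_add, truncEval_add] at h1
  rw [dot_eq, truncField_apply, truncField_apply, truncField_apply]
  obtain ⟨e0, e0'⟩ := abs_le.1 (h2 0)
  obtain ⟨e1, e1'⟩ := abs_le.1 (h2 1)
  obtain ⟨e2, e2'⟩ := abs_le.1 (h2 2)
  rw [abs_le]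
  constructor <;> linarith

theorem IsHierarchyBound.abs_tangent_dot_sub_one_le (h : IsHierarchyBound γ N B s)
    (hs : deriv γ s ≠ 0) (hε : |ε| ≤ 1) :
    |tangent γ s ⬝ᵥ truncField γ N ε s - 1| ≤ (N + 1) * B * |ε| := by
  have h1 := abs_truncEval_sub_le N (constVec (tangent γ s) ⬝ᵥ hierarchySeries γ s) hε
  have h2 : coeff 0 (constVec (tangent γ s) ⬝ᵥ hierarchySeries γ s) = 1 := by
    rw [hierarchySeries, coeff_constVec_dot_vecSeries, flowY_zero, tangent_dot_self hs]
  rw [h2, ← dot_truncField] at h1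
  exact h1.trans (mul_le_mul_of_nonneg_right (h.truncNorm_dot_le (tangent_dot_self hs))
    (abs_nonneg _))

/-- The truncated density solves its defining equation up to terms beyond the truncation. -/
theorem IsHierarchyBound.abs_density_mul_sub_le (h : IsHierarchyBound γ N B s)
    (hs : deriv γ s ≠ 0) (hε : |ε| ≤ 1) :
    |truncEval N (PowerSeries.C (1 / 2 : ℝ) * densitySeries γ s) ε
        * (1 + tangent γ s ⬝ᵥ truncField γ N ε s) - flowY γ 1 s ⬝ᵥ truncField γ N ε s|
      ≤ B * (1 + (N + 1) * B) * |ε| ^ (N + 1) := by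
  have h1 := abs_truncEval_mul_sub_le N (PowerSeries.C (1 / 2 : ℝ) * densitySeries γ s)
    (1 + constVec (tangent γ s) ⬝ᵥ hierarchySeries γ s) hε
  have h2 : PowerSeries.C (1 / 2 : ℝ) * densitySeries γ s
      * (1 + constVec (tangent γ s) ⬝ᵥ hierarchySeries γ s)
      = constVec (flowY γ 1 s) ⬝ᵥ hierarchySeries γ s := by
    rw [half_densitySeries_eq hs, mul_right_comm, inverseSeries_mul hs, one_mul]
  have h3 : truncNorm N (1 + constVec (tangent γ s) ⬝ᵥ hierarchySeries γ s)
      ≤ 1 + (N + 1) * B := by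
    refine le_trans ?_ (add_le_add_right (h.truncNorm_dot_le (tangent_dot_self hs)) 1)
    have e : truncNorm N (1 : PowerSeries ℝ) = 1 := by
      simp [truncNorm, coeff_one, apply_ite abs]
    rw [← e, truncNorm, truncNorm, truncNorm, ← sum_add_distrib]
    exact sum_le_sum fun n _ => by rw [map_add]; exact abs_add_le _ _
  rw [h2, truncEval_add, truncEval_one, ← dot_truncField, ← dot_truncField] at h1
  refine h1.trans ?_
  have h4 := truncNorm_nonneg N (1 + constVec (tangent γ s) ⬝ᵥ hierarchySeries γ s)
  have h5 := h.density_le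
  have h6 := h.one_le
  gcongr

end UniformBounds

/-! ### The partial sums for large spectral parameter -/

section SmallParameter
open Finset PowerSeries
variable {p : ℝ} {A : Matrix (Fin 3) (Fin 3) ℝ} {a : R3} {γ : ℝ → R3} {N : ℕ} {B s ε : ℝ}

/-- For small `ε` the partial sum is almost a unit vector, and close to `T`. -/
theorem IsHierarchyBound.length_bounds (h : IsHierarchyBound γ N B s) (hs : deriv γ s ≠ 0)
    (hε : 6 * ((N + 1) * B) ^ 2 * |ε| ≤ 1) :
    |ε| ≤ 1 ∧ 1 / 2 ≤ truncField γ N ε s ⬝ᵥ truncField γ N ε s ∧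
      1 / 2 ≤ tangent γ s ⬝ᵥ truncField γ N ε s := by
  have hM : 1 ≤ (N + 1) * B := by
    have := h.one_le
    have h2 : (0 : ℝ) ≤ N := N.cast_nonneg
    nlinarith
  have h0 := abs_nonneg ε
  have hM2 : 1 ≤ ((N + 1) * B) ^ 2 := one_le_pow₀ hM
  have hε1 : |ε| ≤ 1 := by nlinarith
  have hpow : |ε| ^ (N + 1) ≤ |ε| := pow_le_of_le_one h0 hε1 (by omega)
  have h1 := (abs_le.1 (h.abs_dot_self_sub_one_le hs hε1)).1
  have h2 := (abs_le.1 (h.abs_tangent_dot_sub_one_le hs hε1)).1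
  have h3 : 3 * ((N + 1) * B) ^ 2 * |ε| ^ (N + 1) ≤ 3 * ((N + 1) * B) ^ 2 * |ε| := by gcongr
  have h4 : (N + 1) * B * |ε| ≤ ((N + 1) * B) ^ 2 * |ε| := by
    refine mul_le_mul_of_nonneg_right ?_ h0
    nlinarith
  exact ⟨hε1, by linarith, by linarith⟩

/-- The defect of the normalized partial sum is of the order of the last power. -/
theorem IsHierarchyBound.defect_le (hγ : γ ∈ curveSpace p A a) (h : IsHierarchyBound γ N B s)
    {l : ℝ} (hl : l ≠ 0) (hε : 6 * ((N + 1) * B) ^ 2 * |l⁻¹| ≤ 1) :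
    frameDefect γ l (unitTruncField γ N l⁻¹) s ⬝ᵥ frameDefect γ l (unitTruncField γ N l⁻¹) s
      ≤ (2 * B ^ 2 * |l⁻¹| ^ N) ^ 2 := by
  obtain ⟨-, h1, -⟩ := h.length_bounds (hγ.2.1 s) hε
  have hpos : 0 < truncField γ N l⁻¹ s ⬝ᵥ truncField γ N l⁻¹ s := by linarith
  refine (frameDefect_unitTruncField hγ N l⁻¹ l hpos.ne').trans ?_
  have h2 : (truncField γ N l⁻¹ s ⬝ᵥ truncField γ N l⁻¹ s)⁻¹ ≤ 2 := by
    rw [inv_le_comm₀ hpos two_pos]; linarith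
  have h3 : frameDefect γ l (truncField γ N l⁻¹) s ⬝ᵥ frameDefect γ l (truncField γ N l⁻¹) s
      ≤ (B ^ 2 * |l⁻¹| ^ N) ^ 2 := by
    rw [frameDefect_truncField hγ N hl, neg_dotProduct, dotProduct_neg, neg_neg, smul_dotProduct,
      dotProduct_smul]
    simp only [smul_eq_mul]
    have e1 := (cross_dot_self_le (tangent γ s) (flowY γ (N + 1) s)).trans
      (mul_le_mul (tangent_dot_self (hγ.2.1 s)).le (h.flowY_le (N + 1) le_rfl)
        (dot_self_nonneg _) zero_le_one)
    have e2 : speed γ s ^ 2 ≤ B ^ 2 :=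
      pow_le_pow_left₀ (speed_pos (hγ.2.1 s)).le h.speed_le 2
    have e3 : ∀ X : ℝ, speed γ s * l⁻¹ ^ N * (speed γ s * l⁻¹ ^ N * X)
        = speed γ s ^ 2 * X * (|l⁻¹| ^ N) ^ 2 := fun X => by
      rw [← pow_mul, mul_comm N 2, pow_mul, sq_abs]; ring
    rw [e3, mul_pow]
    refine mul_le_mul_of_nonneg_right ?_ (sq_nonneg _)
    calc _ ≤ B ^ 2 * (1 * B ^ 2) := mul_le_mul e2 e1 (dot_self_nonneg _) (sq_nonneg B)
      _ = _ := by ring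
  calc _ ≤ 2 * (B ^ 2 * |l⁻¹| ^ N) ^ 2 :=
        mul_le_mul h2 h3 (dot_self_nonneg _) zero_le_two
    _ ≤ _ := by nlinarith [sq_nonneg (B ^ 2 * |l⁻¹| ^ N)]

theorem IsHierarchyBound.unitTruncField_unit (h : IsHierarchyBound γ N B s) (hs : deriv γ s ≠ 0)
    (hε : 6 * ((N + 1) * B) ^ 2 * |ε| ≤ 1) :
    unitTruncField γ N ε s ⬝ᵥ unitTruncField γ N ε s = 1 := by
  obtain ⟨-, h1, -⟩ := h.length_bounds hs hε
  have hpos : 0 < truncField γ N ε s ⬝ᵥ truncField γ N ε s := by linarith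
  have h2 := Real.mul_self_sqrt hpos.le
  have h3 := (Real.sqrt_pos.2 hpos).ne'
  simp only [unitTruncField, truncLength, smul_dotProduct, dotProduct_smul, smul_eq_mul]
  field_simp
  linarith

theorem IsHierarchyBound.tangent_dot_unitTruncField (h : IsHierarchyBound γ N B s)
    (hs : deriv γ s ≠ 0) (hε : 6 * ((N + 1) * B) ^ 2 * |ε| ≤ 1) :
    0 < tangent γ s ⬝ᵥ unitTruncField γ N ε s := by
  obtain ⟨-, h1, h2⟩ := h.length_bounds hs hε
  have hpos : 0 < truncField γ N ε s ⬝ᵥ truncField γ N ε s := by linarith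
  rw [unitTruncField, dotProduct_smul]
  exact mul_pos (inv_pos.2 (Real.sqrt_pos.2 hpos)) (by linarith)

/-- The torsion rate of the normalized partial sum is, to the order of the last power, the
truncated density. -/
theorem IsHierarchyBound.abs_areaRate_sub_le (hγ : γ ∈ curveSpace p A a)
    (h : IsHierarchyBound γ N B s) {l : ℝ} (hl : l ≠ 0)
    (hε : 6 * ((N + 1) * B) ^ 2 * |l⁻¹| ≤ 1) :
    |areaRate (tangent γ) (unitTruncField γ N l⁻¹) s
        + l * speed γ s * (tangent γ s ⬝ᵥ unitTruncField γ N l⁻¹ s)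
        - (l * speed γ s + speed γ s
          * truncEval N (PowerSeries.C (1 / 2 : ℝ) * densitySeries γ s) l⁻¹)|
      ≤ 7 * B ^ 2 * ((N + 1) * B) ^ 2 * |l⁻¹| ^ N := by
  have hs := hγ.2.1 s
  obtain ⟨hε1, h1, h2⟩ := h.length_bounds hs hε
  have hu := h.unitTruncField_unit hs hε
  have hTu := h.tangent_dot_unitTruncField hs hε
  have hdef := h.defect_le hγ hl hε
  have b1 := h.abs_dot_self_sub_one_le hs hε1
  have b2 := h.abs_density_mul_sub_le hs hε1
  have b3 := (abs_truncEval_le N _ hε1).trans h.density_le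
  have hB := h.one_le
  have hM : 1 ≤ (N + 1) * B := by
    have h2 : (0 : ℝ) ≤ N := N.cast_nonneg
    nlinarith
  have hv := speed_pos hs
  have hvB := h.speed_le
  rw [areaRate_add_eq hγ l hu (by linarith)]
  -- the term containing the defect
  have c1 : |(tangent γ s ⨯₃ unitTruncField γ N l⁻¹ s)
      ⬝ᵥ frameDefect γ l (unitTruncField γ N l⁻¹) s
      * (1 + tangent γ s ⬝ᵥ unitTruncField γ N l⁻¹ s)⁻¹| ≤ 2 * B ^ 2 * |l⁻¹| ^ N := by
    rw [abs_mul, abs_inv, abs_of_pos (by linarith : (0:ℝ) < 1 + _)]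
    have e1 := abs_dot_le zero_le_one (b := 2 * B ^ 2 * |l⁻¹| ^ N) (by positivity)
      ((cross_dot_self_le (tangent γ s) (unitTruncField γ N l⁻¹ s)).trans
        (by rw [hu, tangent_dot_self hs]; norm_num)) hdef
    rw [one_mul] at e1
    exact (mul_le_of_le_one_right (abs_nonneg _) (inv_le_one_of_one_le₀ (by linarith))).trans e1
  -- the main term
  have c2 : |flowY γ 1 s ⬝ᵥ unitTruncField γ N l⁻¹ s
      * (1 + tangent γ s ⬝ᵥ unitTruncField γ N l⁻¹ s)⁻¹
      - truncEval N (PowerSeries.C (1 / 2 : ℝ) * densitySeries γ s) l⁻¹|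
      ≤ 5 * B * ((N + 1) * B) ^ 2 * |l⁻¹| ^ N := by
    have hpos : 0 < truncField γ N l⁻¹ s ⬝ᵥ truncField γ N l⁻¹ s := by linarith
    have hr : truncLength γ N l⁻¹ s * truncLength γ N l⁻¹ s
        = truncField γ N l⁻¹ s ⬝ᵥ truncField γ N l⁻¹ s := Real.mul_self_sqrt hpos.le
    have hr0 : 0 < truncLength γ N l⁻¹ s := Real.sqrt_pos.2 hpos
    rw [unitTruncField, dotProduct_smul, dotProduct_smul]
    set r := truncLength γ N l⁻¹ s
    set P := flowY γ 1 s ⬝ᵥ truncField γ N l⁻¹ s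
    set q := tangent γ s ⬝ᵥ truncField γ N l⁻¹ s
    set H := truncEval N (PowerSeries.C (1 / 2 : ℝ) * densitySeries γ s) l⁻¹
    have hr1 : 1 / 2 ≤ r := by nlinarith
    have hr2 : |r - 1| ≤ 3 * ((N + 1) * B) ^ 2 * |l⁻¹| ^ (N + 1) := by
      refine le_trans ?_ b1
      rw [← hr, show r * r - 1 = (r - 1) * (r + 1) by ring, abs_mul]
      exact le_mul_of_one_le_right (abs_nonneg _)
        (by rw [abs_of_pos (by linarith)]; linarith)
    have hq : r + q ≠ 0 := by linarith
    -- both terms of the numerator are of the order of the last power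
    have e : r⁻¹ • P * (1 + r⁻¹ • q)⁻¹ - H = -(H * (1 + q) - P + H * (r - 1)) * (r + q)⁻¹ := by
      have : 1 + r⁻¹ * q = r⁻¹ * (r + q) := by field_simp
      simp only [smul_eq_mul]
      rw [this]
      field_simp
      ring
    rw [e, abs_mul, abs_neg, abs_inv, abs_of_pos (by linarith : 0 < r + q)]
    refine (mul_le_of_le_one_right (abs_nonneg _)
      (inv_le_one_of_one_le₀ (by linarith))).trans ((abs_add_le _ _).trans ?_)
    rw [abs_mul]
    have e2 := mul_le_mul b3 hr2 (abs_nonneg _) (by linarith)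
    have e3 : |l⁻¹| ^ (N + 1) ≤ |l⁻¹| ^ N := pow_le_pow_of_le_one (abs_nonneg _) hε1 (by omega)
    have e4 : B * (1 + (N + 1) * B) + B * (3 * ((N + 1) * B) ^ 2)
        ≤ 5 * B * ((N + 1) * B) ^ 2 := by
      have : 1 + (N + 1) * B ≤ 2 * ((N + 1) * B) ^ 2 := by nlinarith
      nlinarith
    calc _ ≤ _ := add_le_add b2 e2
      _ = (B * (1 + (N + 1) * B) + B * (3 * ((N + 1) * B) ^ 2)) * |l⁻¹| ^ (N + 1) := by ring
      _ ≤ _ := mul_le_mul e4 e3 (by positivity) (by positivity)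
  have c3 := mul_le_mul hvB c2 (abs_nonneg _) (by linarith)
  nth_rewrite 1 [← abs_of_pos hv] at c3
  rw [← abs_mul] at c3
  have c4 : (1 : ℝ) ≤ ((N + 1) * B) ^ 2 := one_le_pow₀ hM
  have c5 : 2 * B ^ 2 * |l⁻¹| ^ N ≤ 2 * B ^ 2 * ((N + 1) * B) ^ 2 * |l⁻¹| ^ N := by
    refine mul_le_mul_of_nonneg_right ?_ (by positivity)
    exact le_mul_of_one_le_right (by positivity) c4
  rw [abs_le] at c1 c3 ⊢
  constructor <;> linarith [c1.1, c1.2, c3.1, c3.2]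

end SmallParameter

/-! ### Expansion of the monodromy angle to finite order -/

section Expansion
open Finset PowerSeries
variable {x₀ p e₂ : ℝ} {A : Matrix (Fin 3) (Fin 3) ℝ} {a : R3} {γ : ℝ → R3}

/-- The integrated truncated density is a partial sum of the generating function. -/
theorem integral_truncEval_density (hγ : γ ∈ curveSpace p A a) (N : ℕ) {l : ℝ} (hl : l ≠ 0) :
    e₂ + ∫ s in x₀..(x₀ + p), (l * speed γ s + speed γ s
        * truncEval N (PowerSeries.C (1 / 2 : ℝ) * densitySeries γ s) l⁻¹)
      = l ^ 2 * ∑ k ∈ range (N + 3), hamiltonian x₀ p γ e₂ k * (l ^ k)⁻¹ := by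
  have hv := (contDiff_speed hγ).continuous
  have hd := fun n => continuous_coeff_densitySeries hγ n
  have h1 : ∀ s, l * speed γ s + speed γ s
        * truncEval N (PowerSeries.C (1 / 2 : ℝ) * densitySeries γ s) l⁻¹
      = l * (1 * speed γ s) + ∑ n ∈ range (N + 1), 1 / 2 * (l ^ n)⁻¹
          * (coeff n (densitySeries γ s) * speed γ s) := fun s => by
    rw [truncEval, mul_sum, one_mul]
    congr 1
    exact sum_congr rfl fun n _ => by rw [coeff_C_mul, inv_pow]; ring
  have h2 : ∀ n, Continuous fun s =>
      1 / 2 * (l ^ n)⁻¹ * (coeff n (densitySeries γ s) * speed γ s) :=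
    fun n => continuous_const.mul ((hd n).mul hv)
  have h0 : Continuous fun s => l * (1 * speed γ s) :=
    continuous_const.mul (continuous_const.mul hv)
  simp only [h1]
  rw [intervalIntegral.integral_add (h0.intervalIntegrable _ _)
      ((continuous_finsetSum _ fun n _ => h2 n).intervalIntegrable _ _),
    intervalIntegral.integral_finsetSum fun n _ => (h2 n).intervalIntegrable _ _,
    sum_range_succ' _ (N + 2), sum_range_succ' _ (N + 1), hamiltonian_zero, hamiltonian_one]
  simp only [intervalIntegral.integral_const_mul, hamiltonian_add_two, arcIntegral, add_mul,
    sum_add_distrib, ite_mul, zero_mul, sum_ite_eq', mem_range, Nat.succ_pos, if_true]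
  have h3 : ∀ n, (1 / 2 : ℝ) * (l ^ n)⁻¹ *
        ∫ s in x₀..(x₀ + p), coeff n (densitySeries γ s) * speed γ s
      = l ^ 2 * (1 / 2 * (∫ s in x₀..(x₀ + p), coeff n (densitySeries γ s) * speed γ s)
        * (l ^ (n + 2))⁻¹) := fun n => by rw [pow_add]; field_simp
  simp only [h3, ← mul_sum]
  field_simp
  ring

/-- The truncations of the formal solution give a monodromy angle with the expansion in question,
and a trace close to the one determined by this angle. -/
theorem exists_approximate_angle (hp : 0 < p)
    (hA : A ∈ Matrix.specialOrthogonalGroup (Fin 3) ℝ) (hγ : γ ∈ curveSpace p A a)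
    (he : IsTotalTorsion x₀ p A γ e₂) (N : ℕ) :
    ∃ C L : ℝ, 0 < C ∧ 1 ≤ L ∧ ∀ l, L ≤ |l| → ∃ Θ,
      |Θ - l ^ 2 * ∑ k ∈ range (N + 3), hamiltonian x₀ p γ e₂ k * (l ^ k)⁻¹| ≤ C * |l⁻¹| ^ N ∧
      ∀ F, IsExtendedFrame x₀ γ F →
        |(F l (x₀ + p) * A).trace - (1 + 2 * Real.cos Θ)| ≤ C * |l⁻¹| ^ N := by
  obtain ⟨B, hB⟩ := exists_isHierarchyBound hp hA hγ N
  obtain ⟨ξ, hξ, hα⟩ := (isTotalTorsion_iff hγ).1 he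
  have hB1 := (hB 0).one_le
  set M := ((N : ℝ) + 1) * B with hM
  have hM1 : 1 ≤ M := by
    have h2 : (0 : ℝ) ≤ N := N.cast_nonneg
    nlinarith
  have hM2 : 1 ≤ M ^ 2 := one_le_pow₀ hM1
  refine ⟨28 * B ^ 2 * M ^ 2 * p, 6 * M ^ 2, by positivity, by linarith, fun l hl => ?_⟩
  have hlpos : 0 < |l| := by linarith
  have hl0 : l ≠ 0 := abs_pos.1 hlpos
  have hε : 6 * M ^ 2 * |l⁻¹| ≤ 1 := by
    rw [abs_inv, ← div_eq_mul_inv, div_le_one hlpos]; exact hl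
  set u := unitTruncField γ N l⁻¹ with hu
  -- the normalized partial sum stays in the open hemisphere around `T`, so the torsions can be
  -- compared
  have hU : IsUnitField u := by
    refine ⟨?_, fun s => (hB s).unitTruncField_unit (hγ.2.1 s) hε⟩
    have hw := contDiff_truncField hγ N l⁻¹
    have h0 : ∀ s, 0 < truncField γ N l⁻¹ s ⬝ᵥ truncField γ N l⁻¹ s := fun s => by
      linarith [((hB s).length_bounds (hγ.2.1 s) hε).2.1]
    exact (((ContDiff.dot hw hw).sqrt fun s => (h0 s).ne').inv
      fun s => (Real.sqrt_pos.2 (h0 s)).ne').smul hw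
  have hT := isUnitField_tangent hγ
  have hTu : ∀ s, 1 + tangent γ s ⬝ᵥ u s ≠ 0 := fun s => by
    have := (hB s).tangent_dot_unitTruncField (hγ.2.1 s) hε
    linarith
  have hν : ContDiff ℝ ∞ fun s => l * speed γ s * (tangent γ s ⬝ᵥ u s) :=
    (contDiff_const.mul (contDiff_speed hγ)).mul (ContDiff.dot hT.smooth hU.smooth)
  have huA := unitTruncField_equivariant hA hγ N l⁻¹ x₀
  -- a normal field of `u` which turns against the rotation of the frame about `T`
  obtain ⟨η, hη, hΘ⟩ := exists_rotatingNormal hA hT hU hTu (tangent_equivariant hA hγ x₀) huA hξ hα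
    hν
  refine ⟨e₂ + ∫ s in x₀..(x₀ + p), (areaRate (tangent γ) u s
    + l * speed γ s * (tangent γ s ⬝ᵥ u s)), ?_, fun F hF => ?_⟩
  rotate_left
  · refine (hF.abs_trace_sub_le hp.le hA l hU huA hη hΘ (κ := 2 * B ^ 2 * |l⁻¹| ^ N)
      (by positivity) fun s => (hB s).defect_le hγ hl0 hε).trans ?_
    have : 2 * B ^ 2 * |l⁻¹| ^ N * p ≤ 2 * B ^ 2 * |l⁻¹| ^ N * p * M ^ 2 :=
      le_mul_of_one_le_right (by positivity) hM2
    linarith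
  · rw [← integral_truncEval_density hγ N hl0, add_sub_add_left_eq_sub]
    have i1 : Continuous fun s => areaRate (tangent γ) u s
        + l * speed γ s * (tangent γ s ⬝ᵥ u s) :=
      ((contDiff_areaRate hT hU hTu).add hν).continuous
    have i2 : Continuous fun s => l * speed γ s + speed γ s
        * truncEval N (PowerSeries.C (1 / 2 : ℝ) * densitySeries γ s) l⁻¹ := by
      have hv := (contDiff_speed hγ).continuous
      refine (continuous_const.mul hv).add (hv.mul (continuous_finsetSum _ fun n _ => ?_))
      simp only [coeff_C_mul]
      exact (continuous_const.mul (continuous_coeff_densitySeries hγ n)).mul continuous_const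
    rw [← intervalIntegral.integral_sub (i1.intervalIntegrable _ _) (i2.intervalIntegrable _ _)]
    have := intervalIntegral.norm_integral_le_of_norm_le_const (a := x₀) (b := x₀ + p)
      (f := fun s => areaRate (tangent γ) u s + l * speed γ s * (tangent γ s ⬝ᵥ u s)
        - (l * speed γ s + speed γ s
          * truncEval N (PowerSeries.C (1 / 2 : ℝ) * densitySeries γ s) l⁻¹))
      (C := 7 * B ^ 2 * M ^ 2 * |l⁻¹| ^ N)
      fun s _ => (hB s).abs_areaRate_sub_le hγ hl0 hε
    rw [Real.norm_eq_abs, add_sub_cancel_left, abs_of_pos hp] at this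
    refine this.trans ?_
    have : 0 ≤ B ^ 2 * M ^ 2 * |l⁻¹| ^ N * p := by positivity
    linarith

/-- Doubling the order of the truncation compensates for the loss in passing from the cosine to
the angle. -/
theorem exists_angle_expansion (hp : 0 < p)
    (hA : A ∈ Matrix.specialOrthogonalGroup (Fin 3) ℝ) (hγ : γ ∈ curveSpace p A a)
    (he : IsTotalTorsion x₀ p A γ e₂) {F : ℝ → ℝ → Matrix (Fin 3) (Fin 3) ℝ}
    (hF : IsExtendedFrame x₀ γ F) (m : ℕ) :
    ∃ C L : ℝ, 1 ≤ L ∧ ∀ l, L ≤ |l| → ∃ θ, IsRotationAngle (F l (x₀ + p) * A) θ ∧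
      |(l ^ 2)⁻¹ * θ - ∑ k ∈ range (2 * m + 3), hamiltonian x₀ p γ e₂ k * (l ^ k)⁻¹|
        ≤ C * |l⁻¹| ^ m := by
  -- the error of the angle is the square root of the error of the cosine
  obtain ⟨C, L, hC, hL, h⟩ := exists_approximate_angle hp hA hγ he (2 * m)
  refine ⟨C + Real.sqrt (Real.pi ^ 2 / 4 * C), L, hL, fun l hl => ?_⟩
  obtain ⟨Θ, h1, h2⟩ := h l hl
  obtain ⟨θ, hθ, h3⟩ := exists_rotationAngle_near
    (mul_mem (hF.mem_specialOrthogonalGroup l (x₀ + p)) hA) Θ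
  refine ⟨θ, hθ, ?_⟩
  have hl1 : 1 ≤ |l| := hL.trans hl
  have hlpos : 0 < |l| := by linarith
  have hl0 : l ≠ 0 := abs_pos.1 hlpos
  have hε : |l⁻¹| ≤ 1 := by rw [abs_inv]; exact inv_le_one_of_one_le₀ hl1
  have h4 : |θ - Θ| ≤ Real.sqrt (Real.pi ^ 2 / 4 * C) * |l⁻¹| ^ m := by
    refine abs_le_of_sq_le_sq ?_ (by positivity)
    rw [mul_pow, Real.sq_sqrt (by positivity), ← pow_mul, mul_comm m 2]
    refine h3.trans ?_
    rw [mul_assoc (Real.pi ^ 2 / 4)]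
    gcongr
    exact h2 F hF
  have h5 : C * |l⁻¹| ^ (2 * m) ≤ C * |l⁻¹| ^ m :=
    mul_le_mul_of_nonneg_left (pow_le_pow_of_le_one (abs_nonneg _) hε (by omega)) hC.le
  set S := ∑ k ∈ range (2 * m + 3), hamiltonian x₀ p γ e₂ k * (l ^ k)⁻¹
  have e : (l ^ 2)⁻¹ * θ - S = (l ^ 2)⁻¹ * ((θ - Θ) + (Θ - l ^ 2 * S)) := by
    field_simp
    ring
  rw [e, abs_mul]
  refine (mul_le_of_le_one_left (abs_nonneg _) ?_).trans ((abs_add_le _ _).trans ?_)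
  · rw [abs_inv, abs_pow]
    exact inv_le_one_of_one_le₀ (one_le_pow₀ hl1)
  · linarith

end Expansion

/-! ### A single angle function for all orders -/

section Diagonal
open Finset Filter

/-- If for every order there are admissible values with an expansion to this order, then a single
choice of admissible values has the expansion to all orders: to the parameter `l` one assigns a
value which is good to the largest order, at most `|l|`, that is available with the constant `1`. -/
theorem exists_expansion_all_orders {V : ℝ → ℝ → Prop} (hV : ∀ l, ∃ θ, V l θ) (E : ℕ → ℝ)
    (h : ∀ m, ∃ N, m ≤ N ∧ ∃ C L : ℝ, 1 ≤ L ∧ ∀ l, L ≤ |l| → ∃ θ, V l θ ∧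
      |(l ^ 2)⁻¹ * θ - ∑ k ∈ range (N + 1), E k * (l ^ k)⁻¹| ≤ C * |l⁻¹| ^ (m + 1)) :
    ∃ θ : ℝ → ℝ, (∀ l, V l (θ l)) ∧ ∀ N : ℕ, Asymptotics.IsBigO (Bornology.cobounded ℝ)
      (fun l : ℝ => (l ^ 2)⁻¹ * θ l - ∑ k ∈ range (N + 1), E k * (l ^ k)⁻¹)
      (fun l : ℝ => (l ^ (N + 1))⁻¹) := by
  classical
  -- `P n l θ`: the value `θ` is good to all orders up to `n`, with the constant `1`
  let P : ℕ → ℝ → ℝ → Prop := fun n l θ => V l θ ∧ ∀ m ≤ n,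
    |(l ^ 2)⁻¹ * θ - ∑ k ∈ range (m + 1), E k * (l ^ k)⁻¹| ≤ |l⁻¹| ^ m
  -- for large `l` one power of `|l|` absorbs the constant and the terms beyond the order `m`
  have hP : ∀ n, ∃ L : ℝ, ∀ l, L ≤ |l| → ∃ θ, P n l θ := by
    intro n
    obtain ⟨N, hN, C, L, hL, h1⟩ := h n
    refine ⟨max L (C + ∑ k ∈ range (N + 1), |E k|), fun l hl => ?_⟩
    have hl1 : 1 ≤ |l| := hL.trans ((le_max_left _ _).trans hl)
    have hl2 := (le_max_right _ _).trans hl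
    have hε : |l⁻¹| ≤ 1 := by rw [abs_inv]; exact inv_le_one_of_one_le₀ hl1
    obtain ⟨θ, hθ, h2⟩ := h1 l ((le_max_left _ _).trans hl)
    refine ⟨θ, hθ, fun m hm => ?_⟩
    have h3 : |∑ k ∈ range (N + 1), E k * (l ^ k)⁻¹ - ∑ k ∈ range (m + 1), E k * (l ^ k)⁻¹|
        ≤ (∑ k ∈ range (N + 1), |E k|) * |l⁻¹| ^ (m + 1) := by
      rw [← sum_sdiff (range_subset_range.2 (by omega : m + 1 ≤ N + 1)), add_sub_cancel_right,
        sum_mul]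
      refine (abs_sum_le_sum_abs _ _).trans ((sum_le_sum fun k hk => ?_).trans
        (sum_le_sum_of_subset_of_nonneg sdiff_subset fun _ _ _ => by positivity))
      rw [abs_mul, ← inv_pow, abs_pow]
      have : m + 1 ≤ k := by simpa using (mem_sdiff.1 hk).2
      exact mul_le_mul_of_nonneg_left (pow_le_pow_of_le_one (abs_nonneg _) hε this) (abs_nonneg _)
    have hC : 0 ≤ C := by
      have := (abs_nonneg _).trans h2
      have h0 : 0 < |l⁻¹| ^ (n + 1) := by
        have : l ≠ 0 := abs_pos.1 (by linarith)
        positivity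
      exact nonneg_of_mul_nonneg_left this h0
    have h4 : C * |l⁻¹| ^ (n + 1) ≤ C * |l⁻¹| ^ (m + 1) :=
      mul_le_mul_of_nonneg_left (pow_le_pow_of_le_one (abs_nonneg _) hε (by omega)) hC
    calc _ = |((l ^ 2)⁻¹ * θ - ∑ k ∈ range (N + 1), E k * (l ^ k)⁻¹)
          + (∑ k ∈ range (N + 1), E k * (l ^ k)⁻¹ - ∑ k ∈ range (m + 1), E k * (l ^ k)⁻¹)| := by
          congr 1; ring
      _ ≤ _ := abs_add_le _ _
      _ ≤ (C + ∑ k ∈ range (N + 1), |E k|) * |l⁻¹| ^ (m + 1) := by linarith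
      _ ≤ |l| * |l⁻¹| ^ (m + 1) := by gcongr
      _ = |l⁻¹| ^ m := by
          have : |l| ≠ 0 := by linarith
          rw [pow_succ, abs_inv]; field_simp
  -- the greatest such `n` up to `⌊|l|⌋`; if there is none, any admissible value will do
  have hQ : ∀ l, ∃ θ, V l θ ∧ ((∃ θ, P (Nat.findGreatest (fun n => ∃ θ, P n l θ) ⌊|l|⌋₊) l θ) →
      P (Nat.findGreatest (fun n => ∃ θ, P n l θ) ⌊|l|⌋₊) l θ) := fun l => by
    by_cases hl : ∃ θ, P (Nat.findGreatest (fun n => ∃ θ, P n l θ) ⌊|l|⌋₊) l θ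
    · obtain ⟨θ, hθ⟩ := hl
      exact ⟨θ, hθ.1, fun _ => hθ⟩
    · obtain ⟨θ, hθ⟩ := hV l
      exact ⟨θ, hθ, fun h' => absurd h' hl⟩
  choose θ hθ hθ' using hQ
  refine ⟨θ, hθ, fun N => ?_⟩
  obtain ⟨L, hL⟩ := hP (N + 1)
  refine Asymptotics.IsBigO.of_bound (1 + |E (N + 1)|) ?_
  have hlarge : ∀ᶠ l : ℝ in Bornology.cobounded ℝ, max L (N + 1 : ℕ) ≤ |l| :=
    (tendsto_norm_cobounded_atTop (E := ℝ)).eventually_ge_atTop _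
  filter_upwards [hlarge] with l hl
  have h1 := hL l ((le_max_left _ _).trans hl)
  have h2 : N + 1 ≤ ⌊|l|⌋₊ := Nat.le_floor ((le_max_right _ _).trans hl)
  have h3 := (hθ' l (Nat.findGreatest_spec (P := fun n => ∃ θ, P n l θ) h2 h1)).2 (N + 1)
    (Nat.le_findGreatest h2 h1)
  -- the estimate to order `N + 1` has one more term than the one to be proved
  rw [sum_range_succ] at h3
  have e : |(l ^ (N + 1))⁻¹| = |l⁻¹| ^ (N + 1) := by rw [← inv_pow, abs_pow]
  rw [Real.norm_eq_abs, Real.norm_eq_abs, e]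
  set S := ∑ k ∈ range (N + 1), E k * (l ^ k)⁻¹
  calc _ = |((l ^ 2)⁻¹ * θ l - (S + E (N + 1) * (l ^ (N + 1))⁻¹))
        + E (N + 1) * (l ^ (N + 1))⁻¹| := by congr 1; ring
    _ ≤ _ := abs_add_le _ _
    _ ≤ |l⁻¹| ^ (N + 1) + |E (N + 1)| * |l⁻¹| ^ (N + 1) := by
        rw [abs_mul (E (N + 1)), e]
        linarith
    _ = _ := by ring

end Diagonal

/-! ### The monodromy angle of the associated family -/

section Monodromy
open Finset
variable {x₀ p e₂ : ℝ} {A : Matrix (Fin 3) (Fin 3) ℝ} {a : R3} {γ : ℝ → R3}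

theorem exists_rotationAngle {R : Matrix (Fin 3) (Fin 3) ℝ}
    (hR : R ∈ Matrix.specialOrthogonalGroup (Fin 3) ℝ) : ∃ θ, IsRotationAngle R θ :=
  let ⟨θ, h, _⟩ := exists_rotationAngle_near hR 0
  ⟨θ, h⟩

/-- Every real representative of the total torsion gives an angle function with the expansion to
all orders. -/
theorem exists_monodromy_angle_expansion (hp : 0 < p)
    (hA : A ∈ Matrix.specialOrthogonalGroup (Fin 3) ℝ) (hγ : γ ∈ curveSpace p A a)
    (he : IsTotalTorsion x₀ p A γ e₂) {F : ℝ → ℝ → Matrix (Fin 3) (Fin 3) ℝ}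
    (hF : IsExtendedFrame x₀ γ F) :
    ∃ θ : ℝ → ℝ, (∀ l, IsRotationAngle (F l (x₀ + p) * A) (θ l)) ∧
      ∀ N : ℕ, Asymptotics.IsBigO (Bornology.cobounded ℝ)
        (fun l : ℝ => (l ^ 2)⁻¹ * θ l
          - ∑ k ∈ range (N + 1), hamiltonian x₀ p γ e₂ k * (l ^ k)⁻¹)
        (fun l : ℝ => (l ^ (N + 1))⁻¹) :=
  exists_expansion_all_orders
    (fun l => exists_rotationAngle (mul_mem (hF.mem_specialOrthogonalGroup l _) hA)) _
    fun m => ⟨2 * (m + 1) + 2, by omega, exists_angle_expansion hp hA hγ he hF (m + 1)⟩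

end Monodromy

/-! ### Explicit formulas for low order -/

section Explicit
open Finset PowerSeries
variable {x₀ p e₂ : ℝ} {A : Matrix (Fin 3) (Fin 3) ℝ} {a : R3} {γ : ℝ → R3}

theorem arcD_succ (γ : ℝ → R3) (n : ℕ) : arcD γ (n + 1) = arcDeriv γ (arcD γ n) :=
  Function.iterate_succ_apply' _ _ _

theorem arcD_one (γ : ℝ → R3) : arcD γ 1 = tangent γ := rfl

theorem contDiff_arcD (hγ : γ ∈ curveSpace p A a) (n : ℕ) : ContDiff ℝ ∞ (arcD γ n) := by
  induction n with
  | zero => exact hγ.1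
  | succ n ih =>
    rw [arcD_succ]
    exact ((ImmersedFamily.const hγ).arcDeriv (f := fun _ => arcD γ n)
      (ih.comp contDiff_snd).contDiffOn).contDiff_s (t := 0) fun _ => Set.mem_univ _

theorem hasDerivAt_arcD (hγ : γ ∈ curveSpace p A a) (n : ℕ) (s : ℝ) :
    HasDerivAt (arcD γ n) (speed γ s • arcD γ (n + 1) s) s := by
  rw [arcD_succ, speed_smul_arcDeriv (hγ.2.1 s)]
  exact hasDerivAt_of_smooth (contDiff_arcD hγ n) s

theorem arcD_one_dot_two (hγ : γ ∈ curveSpace p A a) (s : ℝ) : arcD γ 1 s ⬝ᵥ arcD γ 2 s = 0 := by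
  have := IsUnitField.dot_deriv (isUnitField_tangent hγ) s
  rw [arcD_succ γ 1, arcD_one, arcDeriv, dotProduct_smul, this, smul_zero]

/-- From `(T, T') = 0` by differentiation. -/
theorem arcD_one_dot_three (hγ : γ ∈ curveSpace p A a) (s : ℝ) :
    arcD γ 1 s ⬝ᵥ arcD γ 3 s = -(arcD γ 2 s ⬝ᵥ arcD γ 2 s) := by
  have h := (HasDerivAt.dot (hasDerivAt_arcD hγ 1 s) (hasDerivAt_arcD hγ 2 s)).unique
    ((hasDerivAt_const s (0 : ℝ)).congr_of_eventuallyEq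
      (Filter.Eventually.of_forall fun r => arcD_one_dot_two hγ r))
  simp only [smul_dotProduct, dotProduct_smul, ← smul_add, smul_eq_zero,
    (speed_pos (hγ.2.1 s)).ne', false_or] at h
  linarith

theorem flowY_one (γ : ℝ → R3) (s : ℝ) : flowY γ 1 s = arcD γ 1 s ⨯₃ arcD γ 2 s := by
  rw [flowY_succ, flowY_zero]
  simp [arcD_succ γ 1, arcD_one]

theorem flowY_one_dot_self (hγ : γ ∈ curveSpace p A a) (s : ℝ) :
    flowY γ 1 s ⬝ᵥ flowY γ 1 s = arcD γ 2 s ⬝ᵥ arcD γ 2 s := by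
  have hT : arcD γ 1 s ⬝ᵥ arcD γ 1 s = 1 := tangent_dot_self (hγ.2.1 s)
  rw [flowY_one, cross_dot_cross, hT, arcD_one_dot_two hγ]
  ring

theorem tangent_dot_flowY_two (hγ : γ ∈ curveSpace p A a) (s : ℝ) :
    tangent γ s ⬝ᵥ flowY γ 2 s = -(1 / 2 * (arcD γ 2 s ⬝ᵥ arcD γ 2 s)) := by
  rw [tangent_dot_flowY_succ (hγ.2.1 s)]
  simp [flowY_one_dot_self hγ]

theorem flowY_two (hγ : γ ∈ curveSpace p A a) (s : ℝ) :
    flowY γ 2 s = -arcD γ 3 s - (3 / 2 * (arcD γ 2 s ⬝ᵥ arcD γ 2 s)) • arcD γ 1 s := by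
  have h1 : arcDeriv γ (flowY γ 1) s = arcD γ 1 s ⨯₃ arcD γ 3 s := by
    have hd := HasDerivAt.cross (hasDerivAt_arcD hγ 1 s) (hasDerivAt_arcD hγ 2 s)
    have e : flowY γ 1 = fun s => arcD γ 1 s ⨯₃ arcD γ 2 s := funext fun s => flowY_one γ s
    have hv := (speed_pos (hγ.2.1 s)).ne'
    rw [arcDeriv, e, hd.deriv]
    simp [smul_smul, inv_mul_cancel₀ hv]
  have hT : tangent γ s ⬝ᵥ tangent γ s = 1 := tangent_dot_self (hγ.2.1 s)
  have h3 := arcD_one_dot_three hγ s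
  rw [flowY_succ, h1]
  simp only [arcD_one] at h3 ⊢
  rw [cross_cross_eq_smul_sub_smul', hT, h3, sum_range_one]
  simp only [Nat.sub_zero, zero_add, flowY_one_dot_self hγ]
  module

theorem flowY_one_dot_two (hγ : γ ∈ curveSpace p A a) (s : ℝ) :
    flowY γ 1 s ⬝ᵥ flowY γ 2 s = -det3 (arcD γ 1 s) (arcD γ 2 s) (arcD γ 3 s) := by
  rw [flowY_two hγ, flowY_one, det3_eq, dotProduct_sub, dotProduct_neg, dotProduct_smul,
    cross_dot_eq, dotProduct_comm (_ ⨯₃ _) (arcD γ 1 s), dot_self_cross]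
  simp

theorem tangent_dot_flowY_three (hγ : γ ∈ curveSpace p A a) (s : ℝ) :
    tangent γ s ⬝ᵥ flowY γ 3 s = det3 (arcD γ 1 s) (arcD γ 2 s) (arcD γ 3 s) := by
  rw [tangent_dot_flowY_succ (hγ.2.1 s), sum_range_succ, sum_range_one]
  simp only [zero_add, Nat.sub_zero, Nat.add_one_sub_one, Nat.reduceAdd,
    dotProduct_comm (flowY γ 2 s), flowY_one_dot_two hγ]
  ring

theorem flowY_three (hγ : γ ∈ curveSpace p A a) (s : ℝ) :
    flowY γ 3 s = arcD γ 1 s ⨯₃ (-arcD γ 4 s - (3 / 2 * (arcD γ 2 s ⬝ᵥ arcD γ 2 s)) • arcD γ 2 s)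
      + det3 (arcD γ 1 s) (arcD γ 2 s) (arcD γ 3 s) • arcD γ 1 s := by
  have d2 := hasDerivAt_arcD hγ 2 s
  have hd := (hasDerivAt_arcD hγ 3 s).neg.sub
    (((HasDerivAt.dot d2 d2).const_mul (3 / 2)).smul (hasDerivAt_arcD hγ 1 s))
  have e : flowY γ 2 = fun s => -arcD γ 3 s
      - (3 / 2 * (arcD γ 2 s ⬝ᵥ arcD γ 2 s)) • arcD γ 1 s := funext fun s => flowY_two hγ s
  have hv := (speed_pos (hγ.2.1 s)).ne'
  have h1 : arcDeriv γ (flowY γ 2) s = -arcD γ 4 s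
      - (3 / 2 * (arcD γ 2 s ⬝ᵥ arcD γ 2 s)) • arcD γ 2 s
      - (3 * (arcD γ 2 s ⬝ᵥ arcD γ 3 s)) • arcD γ 1 s := by
    have hd' : deriv (fun s => -arcD γ 3 s
      - (3 / 2 * (arcD γ 2 s ⬝ᵥ arcD γ 2 s)) • arcD γ 1 s) s = _ := hd.deriv
    rw [arcDeriv, e, hd']
    simp only [smul_dotProduct, dotProduct_smul, smul_eq_mul, dotProduct_comm (arcD γ 3 s)]
    match_scalars <;> field_simp
    ring
  have h2 := tangent_dot_flowY_succ (hγ.2.1 s) 2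
  rw [tangent_dot_flowY_three hγ] at h2
  rw [flowY_succ, h1, map_sub, map_smul, arcD_one, cross_self, smul_zero, sub_zero,
    ← neg_eq_iff_eq_neg.2 h2, arcD_one]
  module

/-- The coefficients of the density satisfy a linear recursion. -/
theorem sum_coeff_densitySeries (hγ : γ ∈ curveSpace p A a) (n : ℕ) (s : ℝ) :
    ∑ i ∈ range (n + 1), 1 / 2 * coeff i (densitySeries γ s)
        * ((if n - i = 0 then 1 else 0) + tangent γ s ⬝ᵥ flowY γ (n - i) s)
      = flowY γ 1 s ⬝ᵥ flowY γ n s := by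
  have hs := hγ.2.1 s
  have h : PowerSeries.C (1 / 2 : ℝ) * densitySeries γ s
      * (1 + constVec (tangent γ s) ⬝ᵥ hierarchySeries γ s)
      = constVec (flowY γ 1 s) ⬝ᵥ hierarchySeries γ s := by
    rw [half_densitySeries_eq hs, mul_right_comm, inverseSeries_mul hs, one_mul]
  have := congrArg (coeff n) h
  rw [coeff_mul, Nat.sum_antidiagonal_eq_sum_range_succ_mk] at this
  simpa only [coeff_C_mul, map_add, coeff_one, hierarchySeries,
    coeff_constVec_dot_vecSeries] using this

/-- The recursion solved for the first coefficients, with `(T, Y_k)` inserted for `k ≤ 3`. -/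
theorem coeff_densitySeries_low (hγ : γ ∈ curveSpace p A a) (s : ℝ) :
    coeff 2 (densitySeries γ s) = flowY γ 1 s ⬝ᵥ flowY γ 2 s ∧
    coeff 3 (densitySeries γ s) = flowY γ 1 s ⬝ᵥ flowY γ 3 s
      + 1 / 4 * (arcD γ 2 s ⬝ᵥ arcD γ 2 s) ^ 2 ∧
    coeff 4 (densitySeries γ s) = flowY γ 1 s ⬝ᵥ flowY γ 4 s
      - 3 / 4 * (arcD γ 2 s ⬝ᵥ arcD γ 2 s)
        * det3 (arcD γ 1 s) (arcD γ 2 s) (arcD γ 3 s) := by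
  have h0 : coeff 0 (densitySeries γ s) = 0 := coeff_zero_densitySeries s
  have hT := tangent_dot_self (hγ.2.1 s)
  have h1 := sum_coeff_densitySeries hγ 1 s
  have h2 := sum_coeff_densitySeries hγ 2 s
  have h3 := sum_coeff_densitySeries hγ 3 s
  have h4 := sum_coeff_densitySeries hγ 4 s
  simp only [sum_range_succ, sum_range_zero, Nat.sub_self, Nat.reduceSub, h0, flowY_zero, hT,
    tangent_dot_flowY_one (hγ.2.1 s), tangent_dot_flowY_two hγ, tangent_dot_flowY_three hγ,
    flowY_one_dot_self hγ, if_true] at h1 h2 h3 h4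
  norm_num at h1 h2 h3 h4
  have k2 := flowY_one_dot_two hγ s
  have e1 : coeff 1 (densitySeries γ s) = arcD γ 2 s ⬝ᵥ arcD γ 2 s := by linarith
  have e2 : coeff 2 (densitySeries γ s) = flowY γ 1 s ⬝ᵥ flowY γ 2 s := by linarith
  refine ⟨e2, ?_, ?_⟩
  · rw [e1] at h3; linarith
  · rw [e1, e2, k2] at h4; linarith

/-- Integration by parts: modulo derivatives `(Y₁, Y_{k+1}) = (T', Y_k')` is `-(T'', Y_k)`. -/
theorem arcIntegral_flowY_one_dot (hA : A ∈ Matrix.specialOrthogonalGroup (Fin 3) ℝ)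
    (hγ : γ ∈ curveSpace p A a) (x₀ : ℝ) (k : ℕ) :
    arcIntegral x₀ p γ (fun s => flowY γ 1 s ⬝ᵥ flowY γ (k + 1) s)
      = arcIntegral x₀ p γ (fun s => -(arcD γ 3 s ⬝ᵥ flowY γ k s)) := by
  have hY := fun k => contDiff_flowY hγ k
  have hv := contDiff_speed hγ
  have hd : ∀ s, HasDerivAt (fun s => arcD γ 2 s ⬝ᵥ flowY γ k s)
      ((flowY γ 1 s ⬝ᵥ flowY γ (k + 1) s) * speed γ s
        - -(arcD γ 3 s ⬝ᵥ flowY γ k s) * speed γ s) s := fun s => by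
    refine (HasDerivAt.dot (hasDerivAt_arcD hγ 2 s) (hasDerivAt_flowY hγ k s)).congr_deriv ?_
    have e : arcD γ 2 s ⬝ᵥ (tangent γ s ⨯₃ flowY γ (k + 1) s)
        = -(flowY γ 1 s ⬝ᵥ flowY γ (k + 1) s) := by
      rw [flowY_one, arcD_one, ← cross_dot_eq, ← cross_anticomm, neg_dotProduct]
    rw [dotProduct_neg, dotProduct_smul, smul_dotProduct, e, smul_eq_mul, smul_eq_mul]
    ring
  have c1 : Continuous fun s => (flowY γ 1 s ⬝ᵥ flowY γ (k + 1) s) * speed γ s :=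
    ((ContDiff.dot (hY 1) (hY (k + 1))).mul hv).continuous
  have c2 : Continuous fun s => -(arcD γ 3 s ⬝ᵥ flowY γ k s) * speed γ s :=
    ((ContDiff.dot (contDiff_arcD hγ 3) (hY k)).neg.mul hv).continuous
  have hper : arcD γ 2 (x₀ + p) = A *ᵥ arcD γ 2 x₀ := by
    rw [arcD_succ γ 1, arcD_one]
    exact arcDeriv_equivariant hA hγ 0 ((contDiff_tangent hγ).differentiable (by simp))
      (fun s => by rw [tangent_equivariant hA hγ, add_zero]) x₀
  have h := integral_deriv_eq_zero x₀ hd (c1.sub c2)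
    (by rw [flowY_equivariant hA hγ, hper, mulVec_dot_mulVec hA])
  rw [intervalIntegral.integral_sub (c1.intervalIntegrable _ _) (c2.intervalIntegrable _ _)] at h
  exact sub_eq_zero.1 h

theorem arcIntegral_add (hγ : γ ∈ curveSpace p A a) {f g : ℝ → ℝ} (hf : Continuous f)
    (hg : Continuous g) : arcIntegral x₀ p γ (fun s => f s + g s)
      = arcIntegral x₀ p γ f + arcIntegral x₀ p γ g := by
  have hv := (contDiff_speed hγ).continuous
  simp only [arcIntegral, add_mul]
  exact intervalIntegral.integral_add ((hf.mul hv).intervalIntegrable _ _)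
    ((hg.mul hv).intervalIntegrable _ _)

theorem const_mul_arcIntegral (c : ℝ) (f : ℝ → ℝ) :
    c * arcIntegral x₀ p γ f = arcIntegral x₀ p γ fun s => c * f s := by
  simp only [arcIntegral, mul_assoc, intervalIntegral.integral_const_mul]

theorem arcIntegral_congr {f g : ℝ → ℝ} (h : ∀ s, f s = g s) :
    arcIntegral x₀ p γ f = arcIntegral x₀ p γ g := by rw [funext h]

theorem contDiff_det_arcD (hγ : γ ∈ curveSpace p A a) :
    ContDiff ℝ ∞ fun s => det3 (arcD γ 1 s) (arcD γ 2 s) (arcD γ 3 s) := by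
  simp only [det3_eq]
  exact ContDiff.dot (contDiff_arcD hγ 1) (ContDiff.cross (contDiff_arcD hγ 2)
    (contDiff_arcD hγ 3))

theorem hamiltonian_four (hγ : γ ∈ curveSpace p A a) :
    hamiltonian x₀ p γ e₂ 4 = -(1 / 2) * arcIntegral x₀ p γ fun s =>
      det3 (arcD γ 1 s) (arcD γ 2 s) (arcD γ 3 s) := by
  rw [hamiltonian_add_two, if_neg two_ne_zero, zero_add, const_mul_arcIntegral,
    const_mul_arcIntegral]
  refine arcIntegral_congr fun s => ?_
  rw [(coeff_densitySeries_low hγ s).1, flowY_one_dot_two hγ]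
  ring

theorem hamiltonian_five (hA : A ∈ Matrix.specialOrthogonalGroup (Fin 3) ℝ)
    (hγ : γ ∈ curveSpace p A a) :
    hamiltonian x₀ p γ e₂ 5 = arcIntegral x₀ p γ fun s =>
      (1 / 2) * (arcD γ 3 s ⬝ᵥ arcD γ 3 s) - (5 / 8) * (arcD γ 2 s ⬝ᵥ arcD γ 2 s) ^ 2 := by
  have c1 : Continuous fun s => 1 / 4 * (arcD γ 2 s ⬝ᵥ arcD γ 2 s) ^ 2 :=
    (contDiff_const.mul
      ((ContDiff.dot (contDiff_arcD hγ 2) (contDiff_arcD hγ 2)).pow 2)).continuous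
  have hY := fun k => contDiff_flowY hγ k
  rw [hamiltonian_add_two, if_neg three_ne_zero, zero_add,
    arcIntegral_congr fun s => (coeff_densitySeries_low hγ s).2.1,
    arcIntegral_add hγ (ContDiff.dot (hY 1) (hY 3)).continuous c1,
    arcIntegral_flowY_one_dot hA hγ x₀ 2,
    ← arcIntegral_add hγ (ContDiff.dot (contDiff_arcD hγ 3) (hY 2)).neg.continuous c1,
    const_mul_arcIntegral]
  refine arcIntegral_congr fun s => ?_
  rw [flowY_two hγ, dotProduct_sub, dotProduct_neg, dotProduct_smul,
    dotProduct_comm (arcD γ 3 s) (arcD γ 1 s), arcD_one_dot_three hγ, smul_eq_mul]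
  ring

theorem hamiltonian_six (hA : A ∈ Matrix.specialOrthogonalGroup (Fin 3) ℝ)
    (hγ : γ ∈ curveSpace p A a) :
    hamiltonian x₀ p γ e₂ 6 = arcIntegral x₀ p γ fun s =>
      -(1 / 2) * det3 (arcD γ 1 s) (arcD γ 3 s) (arcD γ 4 s)
        + (7 / 8) * (arcD γ 2 s ⬝ᵥ arcD γ 2 s)
          * det3 (arcD γ 1 s) (arcD γ 2 s) (arcD γ 3 s) := by
  have c1 : Continuous fun s => -(3 / 4 * (arcD γ 2 s ⬝ᵥ arcD γ 2 s)
      * det3 (arcD γ 1 s) (arcD γ 2 s) (arcD γ 3 s)) :=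
    ((contDiff_const.mul (ContDiff.dot (contDiff_arcD hγ 2) (contDiff_arcD hγ 2))).mul
      (contDiff_det_arcD hγ)).neg.continuous
  have hY := fun k => contDiff_flowY hγ k
  rw [hamiltonian_add_two, if_neg four_ne_zero, zero_add,
    arcIntegral_congr fun s => ((coeff_densitySeries_low hγ s).2.2.trans (sub_eq_add_neg _ _)),
    arcIntegral_add hγ (ContDiff.dot (hY 1) (hY 4)).continuous c1,
    arcIntegral_flowY_one_dot hA hγ x₀ 3,
    ← arcIntegral_add hγ (ContDiff.dot (contDiff_arcD hγ 3) (hY 3)).neg.continuous c1,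
    const_mul_arcIntegral]
  refine arcIntegral_congr fun s => ?_
  rw [flowY_three hγ, dotProduct_add, dotProduct_smul,
    dotProduct_comm (arcD γ 3 s) (arcD γ 1 s), arcD_one_dot_three hγ, smul_eq_mul]
  simp only [det3_eq, dot_eq, cross_zero, cross_one, cross_two, Pi.sub_apply, Pi.neg_apply,
    Pi.smul_apply, smul_eq_mul]
  ring

end Explicit

end SpaceCurve

end

theorem mainTheorem4 (x₀ p : ℝ) (hp : 0 < p) (A : Matrix (Fin 3) (Fin 3) ℝ)
    (hA : A ∈ Matrix.specialOrthogonalGroup (Fin 3) ℝ) (a : SpaceCurve.R3)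
    (γ : ℝ → SpaceCurve.R3) (hγ : γ ∈ SpaceCurve.curveSpace p A a) :
    -- the `Y_k` are vector fields on the space of curves, solve the recursion, and commute
    (∀ k, SpaceCurve.flowY γ k ∈ SpaceCurve.tangentSpace p A ∧
      ∀ s, SpaceCurve.arcDeriv γ (SpaceCurve.flowY γ k) s
        + SpaceCurve.tangent γ s ⨯₃ SpaceCurve.flowY γ (k + 1) s = 0) ∧
    (∀ k l s, ∃ v : SpaceCurve.R3,
      HasDerivAt (fun t : ℝ =>
        SpaceCurve.flowY (fun u => γ u + t • SpaceCurve.flowY γ k u) l s) v 0 ∧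
      HasDerivAt (fun t : ℝ =>
        SpaceCurve.flowY (fun u => γ u + t • SpaceCurve.flowY γ l u) k s) v 0) ∧
    -- the `E_k` are Hamiltonians for the `Y_k`: `dE_k = σ(Y_k, -)`
    (∀ (ε : ℝ) (Γ : ℝ → ℝ → SpaceCurve.R3), SpaceCurve.IsVariation p A a γ ε Γ →
      ∃ α : ℝ → ℝ, (∀ᶠ t in nhds 0, SpaceCurve.IsTotalTorsion x₀ p A (Γ t) (α t)) ∧
        ∀ k, HasDerivAt (fun t => SpaceCurve.hamiltonian x₀ p (Γ t) (α t) k)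
          (SpaceCurve.sigma x₀ p γ (SpaceCurve.flowY γ k) (SpaceCurve.velocity Γ)) 0) ∧
    -- the `E_k` are the coefficients of the expansion of `λ⁻² θ_λ` at `λ = ∞`
    (∀ e₂ : ℝ, SpaceCurve.IsTotalTorsion x₀ p A γ e₂ →
      ∀ F : ℝ → ℝ → Matrix (Fin 3) (Fin 3) ℝ, SpaceCurve.IsExtendedFrame x₀ γ F →
        ∃ θ : ℝ → ℝ, (∀ l, SpaceCurve.IsRotationAngle (F l (x₀ + p) * A) (θ l)) ∧
          ∀ N : ℕ, Asymptotics.IsBigO (Bornology.cobounded ℝ)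
            (fun l : ℝ => (l ^ 2)⁻¹ * θ l
              - ∑ k ∈ Finset.range (N + 1), SpaceCurve.hamiltonian x₀ p γ e₂ k * (l ^ k)⁻¹)
            (fun l : ℝ => (l ^ (N + 1))⁻¹)) ∧
    -- explicit formulas
    (∀ e₂ : ℝ,
      SpaceCurve.hamiltonian x₀ p γ e₂ 4 = -(1 / 2) * SpaceCurve.arcIntegral x₀ p γ (fun s =>
        SpaceCurve.det3 (SpaceCurve.arcD γ 1 s) (SpaceCurve.arcD γ 2 s)
          (SpaceCurve.arcD γ 3 s)) ∧
      SpaceCurve.hamiltonian x₀ p γ e₂ 5 = SpaceCurve.arcIntegral x₀ p γ (fun s =>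
        (1 / 2) * (SpaceCurve.arcD γ 3 s ⬝ᵥ SpaceCurve.arcD γ 3 s)
          - (5 / 8) * (SpaceCurve.arcD γ 2 s ⬝ᵥ SpaceCurve.arcD γ 2 s) ^ 2) ∧
      SpaceCurve.hamiltonian x₀ p γ e₂ 6 = SpaceCurve.arcIntegral x₀ p γ (fun s =>
        -(1 / 2) * SpaceCurve.det3 (SpaceCurve.arcD γ 1 s) (SpaceCurve.arcD γ 3 s)
            (SpaceCurve.arcD γ 4 s)
          + (7 / 8) * (SpaceCurve.arcD γ 2 s ⬝ᵥ SpaceCurve.arcD γ 2 s)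
            * SpaceCurve.det3 (SpaceCurve.arcD γ 1 s) (SpaceCurve.arcD γ 2 s)
              (SpaceCurve.arcD γ 3 s))) := by
  open SpaceCurve in
  refine ⟨fun k => ⟨flowY_mem_tangentSpace hA hγ k, fun s =>
      (ImmersedFamily.const hγ).arcDeriv_add_cross (t := 0) k (Set.mem_univ _)⟩,
    fun k l s => ⟨_, hasDerivAt_flowY_add_smul hγ k l s,
      flowBracket_comm (fun n => flowY γ n s) k l ▸ hasDerivAt_flowY_add_smul hγ l k s⟩,
    fun ε Γ hΓ => ?_, fun e₂ he F hF => exists_monodromy_angle_expansion hp hA hγ he hF,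
    fun e₂ => ⟨hamiltonian_four hγ, hamiltonian_five hA hγ, hamiltonian_six hA hγ⟩⟩
  open SpaceCurve in
  obtain ⟨α, h1, h2⟩ := hΓ.exists_totalTorsion hp hA x₀
  refine ⟨α, h1, fun k => ?_⟩
  open SpaceCurve in
  match k with
  | 0 => exact hΓ.hasDerivAt_hamiltonian_zero x₀ α
  | 1 => exact hΓ.hasDerivAt_hamiltonian_one hA x₀ α
  | 2 => simpa only [hamiltonian_two] using h2
  | n + 3 => exact hΓ.hasDerivAt_hamiltonian_add_two hA x₀ α n.succ_ne_zero
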